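/- Let $\kappa$ be an algebraically closed field of characteristic $p>0$, let $\mathbb W$ denote $p$-typical Witt vectors, let $K$ be a finite extension of $\mathbb W(\kappa)[1/p]$ with ring of integers $\mathcal O$ and uniformizer $\varpi$, and for a perfect $\kappa$-algebra $R$ put $W_{\mathcal O}(R)=\mathbb W(R)\otimes_{\mathbb W(\kappa)}\mathcal O$. For an affine $\mathcal O$-scheme $Z$ let $L^+(Z)$ be its arc space, the functor $R\mapsto Z(W_{\mathcal O}(R))$ on perfect $\kappa$-algebras. Let $G$ be a connected reductive group over $\mathcal O$ with maximal torus $T$ (both are automatically split), given by its reduced root datum $(X^*(T),\Phi,X_*(T),\Phi^\vee)$. Let $W$ be the Weyl group, $a=|W|$, and assume $p\nmid a$. Let $\mathfrak t=\operatorname{Lie}T=\operatorname{Spec}\operatorname{Sym}_{\mathcal O}(X^*(T)\otimes\mathcal O)$, let $\mathfrak c=\mathfrak t/\!/W=\operatorname{Spec}\mathcal O[\mathfrak t]^W$, and let $\mathfrak D=\prod_{\alpha\in \Phi}d\alpha\in\mathcal O[\mathfrak c]$ be the discriminant. Let $\mathcal O'=\mathcal O[\varpi^{1/a}]$, and let $\mathfrak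 t'$, $\mathfrak c'$ be the Weil restrictions from $\mathcal O'$ to $\mathcal O$ of the base changes of $\mathfrak t$, $\mathfrak c$ to $\mathcal O'$, so that $L^+(\mathfrak t')(R)=\mathfrak t(W_{\mathcal O}(R)\otimes_{\mathcal O}\mathcal O')$, and similarly for $\mathfrak c'$. For an integer $n\ge 0$ let $L^+(\mathfrak c)_{(\mathfrak D;n)}\subset L^+(\mathfrak c)$ be the stratum where $\mathfrak D$ has valuation exactly $n$, that is, $\mathfrak D(y)\in\varpi^n\,W_{\mathcal O}(R)^\times$, and let $$L^+(\mathfrak t')_{L^+(\mathfrak c),(\mathfrak D;n)}=L^+(\mathfrak t')\times_{L^+(\mathfrak c')}L^+(\mathfrak c)_{(\mathfrak D;n)}$$ with the action of $W$ induced by its action on $\mathfrak t$. Then for every $n\ge 0$ the projection $$\pi\colon L^+(\mathfrak t')_{L^+(\mathfrak c),(\mathfrak D;n)}\to L^+(\mathfrak c)_{(\mathfrak D;n)}$$ is a $W$-torsor for the étale topology on perfect affine $\kappa$-schemes. That is, the action of $W$ is over the base, $\pi$ has sections étale-locally on every perfect affine scheme over the base, and, with $X$ and $Y$ the source and target of $\pi$,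 the map $W\times X\to X\times_Y X$, $(w,x)\mapsto(wx,x)$, is an isomorphism. -/

import Mathlib

open CategoryTheory TensorProduct Polynomial

universe u v w

noncomputable section

namespace WittArc

/-! ### Perfect algebras and torsors in the category of presheaves on perfect affine schemes -/

/-- A perfect `κ`-algebra, that is, the coordinate ring of a perfect affine scheme over `κ`. -/
structure PerfAlg (p : ℕ) (κ : Type u) [CommRing κ] where
  carrier : Type u
  [commRing : CommRing carrier]
  [algebra : Algebra κ carrier]
  [perfect : PerfectRing carrier p]

attribute [instance] PerfAlg.commRing PerfAlg.algebra PerfAlg.perfect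

instance (p : ℕ) (κ : Type u) [CommRing κ] : CoeSort (PerfAlg p κ) (Type u) :=
  ⟨PerfAlg.carrier⟩

/-- Perfect `κ`-algebras with `κ`-algebra homomorphisms: the opposite of the category of perfect
affine schemes over `κ`. -/
instance (p : ℕ) (κ : Type u) [CommRing κ] : Category (PerfAlg p κ) where
  Hom R S := R →ₐ[κ] S
  id R := AlgHom.id κ R
  comp φ ψ := ψ.comp φ

/-- The algebra homomorphism underlying a morphism of perfect algebras. -/
def PerfAlg.toAlgHom {p : ℕ} {κ : Type u} [CommRing κ] {R S : PerfAlg p κ} (φ : R ⟶ S) :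
    R →ₐ[κ] S := φ

/-- Let the discrete group `W` act through `ρ` on a functor `X` of perfect `κ`-algebras (a sheaf
for the étale topology), and let `π : X ⟶ Y` be a morphism. Then `π` is a `W`-torsor if the action
is over `Y`, if `π` is a covering, i.e. has sections étale-locally on affine schemes over `Y`, and
if `W × X ⟶ X ×_Y X`, `(g, x) ↦ (g x, x)`, is an isomorphism. Here `W` stands for the constant
group scheme: its sections over `R` are the locally constant maps `g : Spec R → W`, and `x' = g x`
means that `x' = a x` after every base change `R ⟶ S` for which `g` becomes constant with
value `a`. -/
structure IsTorsor {p : ℕ} {κ : Type u} [CommRing κ] {W : Type*} [Group W]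
    {X Y : PerfAlg p κ ⥤ Type w} (ρ : W →* End X) (π : X ⟶ Y) : Prop where
  map_smul : ∀ a : W, ρ a ≫ π = π
  covering : ∀ (R : PerfAlg p κ) (y : Y.obj R), ∃ (S : PerfAlg p κ) (φ : R ⟶ S),
    (PerfAlg.toAlgHom φ).toRingHom.Etale ∧
      Function.Surjective (PrimeSpectrum.comap (PerfAlg.toAlgHom φ).toRingHom) ∧
      ∃ x : X.obj S, π.app S x = Y.map φ y
  simplyTransitive : ∀ (R : PerfAlg p κ) (x x' : X.obj R), π.app R x' = π.app R x →
    ∃! g : LocallyConstant (PrimeSpectrum R) W, ∀ (S : PerfAlg p κ) (φ : R ⟶ S) (a : W),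
      (∀ q : PrimeSpectrum S, g (PrimeSpectrum.comap (PerfAlg.toAlgHom φ).toRingHom q) = a) →
        X.map φ x' = (ρ a).app S (X.map φ x)

/-! ### Ramified Witt vectors and arc spaces -/

section Arc

variable (p : ℕ) [Fact p.Prime] {κ : Type u} [CommRing κ]

instance wittAlgebra (R : PerfAlg p κ) : Algebra (WittVector p κ) (WittVector p R) :=
  (WittVector.map (algebraMap κ R)).toAlgebra

/-- Functoriality of the Witt vectors. -/
def wittMap {R S : PerfAlg p κ} (φ : R ⟶ S) :
    WittVector p R →ₐ[WittVector p κ] WittVector p S :=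
  { WittVector.map (PerfAlg.toAlgHom φ).toRingHom with
    commutes' := fun x => by
      ext n
      change (PerfAlg.toAlgHom φ) ((WittVector.map (algebraMap κ R) x).coeff n) =
        (WittVector.map (algebraMap κ S) x).coeff n
      rw [WittVector.map_coeff, WittVector.map_coeff]
      exact (PerfAlg.toAlgHom φ).commutes _ }

lemma wittMap_id (R : PerfAlg p κ) : wittMap p (𝟙 R) = AlgHom.id _ _ := by
  apply AlgHom.ext
  intro x
  ext n
  change (WittVector.map (PerfAlg.toAlgHom (𝟙 R)).toRingHom x).coeff n = x.coeff n
  rw [WittVector.map_coeff]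
  rfl

lemma wittMap_comp {R S T : PerfAlg p κ} (φ : R ⟶ S) (ψ : S ⟶ T) :
    wittMap p (φ ≫ ψ) = (wittMap p ψ).comp (wittMap p φ) := by
  apply AlgHom.ext
  intro x
  ext n
  change (WittVector.map (PerfAlg.toAlgHom (φ ≫ ψ)).toRingHom x).coeff n =
    (WittVector.map (PerfAlg.toAlgHom ψ).toRingHom
      (WittVector.map (PerfAlg.toAlgHom φ).toRingHom x)).coeff n
  rw [WittVector.map_coeff, WittVector.map_coeff, WittVector.map_coeff]
  rfl

variable (O : Type v) [CommRing O] [Algebra (WittVector p κ) O]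

/-- The `O`-Witt vectors `W_O(R) = O ⊗_{W(κ)} W(R)`. -/
abbrev OWitt (R : PerfAlg p κ) : Type (max u v) := O ⊗[WittVector p κ] WittVector p R

/-- Functoriality of `W_O`. -/
def oWittMap {R S : PerfAlg p κ} (φ : R ⟶ S) : OWitt p O R →ₐ[O] OWitt p O S :=
  Algebra.TensorProduct.map (AlgHom.id O O) (wittMap p φ)

lemma oWittMap_id (R : PerfAlg p κ) : oWittMap p O (𝟙 R) = AlgHom.id _ _ := by
  unfold oWittMap
  rw [wittMap_id]
  exact Algebra.TensorProduct.map_id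

lemma oWittMap_comp {R S T : PerfAlg p κ} (φ : R ⟶ S) (ψ : S ⟶ T) :
    oWittMap p O (φ ≫ ψ) = (oWittMap p O ψ).comp (oWittMap p O φ) := by
  unfold oWittMap
  rw [wittMap_comp, ← Algebra.TensorProduct.map_comp]
  rfl

/-- The arc space `L⁺(Spec A)` of an affine `O`-scheme: `L⁺(Spec A)(R) = (Spec A)(W_O(R))`. -/
abbrev Arc (A : Type w) [CommRing A] [Algebra O A] (R : PerfAlg p κ) : Type (max w (max u v)) :=
  A →ₐ[O] OWitt p O R

variable {O} in
/-- The ramified extension `O' = O[ϖ^{1/a}]`. -/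
abbrev RootExt (ϖ : O) (a : ℕ) : Type v := AdjoinRoot (X ^ a - C ϖ : O[X])

variable {O}

/-- The ring `W_O(R) ⊗_O O'`. -/
abbrev OWittExt (ϖ : O) (a : ℕ) (R : PerfAlg p κ) : Type (max u v) :=
  OWitt p O R ⊗[O] RootExt ϖ a

/-- Functoriality of `W_O(R) ⊗_O O'`. -/
def oWittExtMap (ϖ : O) (a : ℕ) {R S : PerfAlg p κ} (φ : R ⟶ S) :
    OWittExt p ϖ a R →ₐ[O] OWittExt p ϖ a S :=
  Algebra.TensorProduct.map (oWittMap p O φ) (AlgHom.id O (RootExt ϖ a))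

lemma oWittExtMap_id (ϖ : O) (a : ℕ) (R : PerfAlg p κ) :
    oWittExtMap p ϖ a (𝟙 R) = AlgHom.id _ _ := by
  unfold oWittExtMap
  rw [oWittMap_id]
  exact Algebra.TensorProduct.map_id

lemma oWittExtMap_comp (ϖ : O) (a : ℕ) {R S T : PerfAlg p κ} (φ : R ⟶ S) (ψ : S ⟶ T) :
    oWittExtMap p ϖ a (φ ≫ ψ) = (oWittExtMap p ϖ a ψ).comp (oWittExtMap p ϖ a φ) := by
  unfold oWittExtMap
  rw [oWittMap_comp, ← Algebra.TensorProduct.map_comp]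
  rfl

/-- The inclusion `W_O(R) → W_O(R) ⊗_O O'`. -/
def oWittIncl (ϖ : O) (a : ℕ) (R : PerfAlg p κ) : OWitt p O R →ₐ[O] OWittExt p ϖ a R :=
  Algebra.TensorProduct.includeLeft

lemma oWittExtMap_incl (ϖ : O) (a : ℕ) {R S : PerfAlg p κ} (φ : R ⟶ S) :
    (oWittExtMap p ϖ a φ).comp (oWittIncl p ϖ a R) =
      (oWittIncl p ϖ a S).comp (oWittMap p O φ) := by
  ext x
  simp [oWittExtMap, oWittIncl]

/-- The arc space `L⁺(Z')` of the Weil restriction `Z'` from `O' = O[ϖ^{1/a}]` to `O` of the base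
change to `O'` of `Z = Spec A`: `L⁺(Z')(R) = Z(W_O(R) ⊗_O O')`. -/
abbrev RamifiedArc (ϖ : O) (a : ℕ) (A : Type w) [CommRing A] [Algebra O A] (R : PerfAlg p κ) :
    Type (max w (max u v)) :=
  A →ₐ[O] OWittExt p ϖ a R

end Arc

/-! ### The Chevalley space `𝔠 = 𝔱 // W` -/

section Chevalley

variable {ι : Type*} {M : Type w} {N : Type*} [AddCommGroup M] [AddCommGroup N]
  (P : RootDatum ι M N) (O : Type v) [CommRing O]

/-- The coordinate ring `O[𝔱] = Sym_O (O ⊗ X^*(T))` of `𝔱 = Lie T = X_*(T) ⊗ O`. -/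
abbrev CoordT (_P : RootDatum ι M N) : Type (max v w) := SymmetricAlgebra O (O ⊗[ℤ] M)

/-- The differential `dχ`, as a linear function on `𝔱`, of a character `χ` of `T`. -/
def differential (χ : M) : CoordT O P := SymmetricAlgebra.ι O (O ⊗[ℤ] M) (1 ⊗ₜ χ)

/-- The automorphism of `O[𝔱]` that extends the action of an element of the Weyl group on the
character lattice: `a · dχ = d(a χ)`. -/
def weylAct (a : P.weylGroup) : CoordT O P →ₐ[O] CoordT O P :=
  SymmetricAlgebra.lift
    (SymmetricAlgebra.ι O (O ⊗[ℤ] M) ∘ₗ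
      LinearMap.baseChange O (RootPairing.Equiv.weightHom P (a : P.Aut) : M →ₗ[ℤ] M))

lemma weylAct_ι (a : P.weylGroup) (s : O) (m : M) :
    weylAct P O a (SymmetricAlgebra.ι O (O ⊗[ℤ] M) (s ⊗ₜ m)) =
      SymmetricAlgebra.ι O (O ⊗[ℤ] M) (s ⊗ₜ (RootPairing.Equiv.weightHom P (a : P.Aut) m)) := by
  simp [weylAct]

lemma weylAct_one : weylAct P O 1 = AlgHom.id O _ := by
  apply SymmetricAlgebra.algHom_ext
  ext m
  simp [weylAct_ι]

lemma weylAct_mul (a b : P.weylGroup) :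
    weylAct P O (a * b) = (weylAct P O a).comp (weylAct P O b) := by
  apply SymmetricAlgebra.algHom_ext
  ext m
  simp [weylAct_ι]

/-- The coordinate ring `O[𝔠] = O[𝔱]^W` of `𝔠 = 𝔱 // W`. -/
def CoordC : Subalgebra O (CoordT O P) where
  carrier := {f | ∀ a : P.weylGroup, weylAct P O a f = f}
  mul_mem' hf hg a := by rw [map_mul, hf a, hg a]
  add_mem' hf hg a := by rw [map_add, hf a, hg a]
  algebraMap_mem' r a := (weylAct P O a).commutes r

variable [Fintype ι]

/-- The discriminant `𝔇 = ∏_{α ∈ R} dα`, as an element of `O[𝔱]`. -/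
def discriminantT : CoordT O P := ∏ i, differential P O (P.root i)

lemma discriminantT_mem : discriminantT P O ∈ CoordC P O := by
  intro a
  unfold discriminantT
  rw [map_prod]
  refine Fintype.prod_equiv (a : P.Aut).indexEquiv _ _ fun i => ?_
  unfold differential
  rw [weylAct_ι]
  congr 2
  exact RootPairing.Hom.root_weightMap_apply P P i (a : P.Aut).toHom

/-- The discriminant, as an element of `O[𝔠]`. -/
def discriminant : CoordC P O := ⟨discriminantT P O, discriminantT_mem P O⟩

end Chevalley

/-! ### The strata and the morphism -/

section Strata

variable (p : ℕ) [Fact p.Prime] {κ : Type u} [CommRing κ]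
  {ι : Type*} [Fintype ι] {M : Type w} {N : Type*} [AddCommGroup M] [AddCommGroup N]
  (P : RootDatum ι M N) {O : Type v} [CommRing O] [Algebra (WittVector p κ) O] (ϖ : O) (n : ℕ)

/-- The stratum `L⁺(𝔠)_{(𝔇; n)}`: the arcs `y` of `𝔠` at which the discriminant has valuation
exactly `n`, that is, `𝔇(y) ∈ ϖ^n W_O(R)^×`. -/
def stratumC : PerfAlg p κ ⥤ Type (max (max v w) (max u v)) where
  obj R := {y : Arc p O (CoordC P O) R //
    Associated (algebraMap O (OWitt p O R) (ϖ ^ n)) (y (discriminant P O))}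
  map φ := TypeCat.ofHom fun y => ⟨(oWittMap p O φ).comp y.1, by
    have h := y.2.map (oWittMap p O φ)
    rwa [AlgHom.commutes] at h⟩
  map_id R := by
    refine ConcreteCategory.hom_ext _ _ fun y => Subtype.ext ?_
    change (oWittMap p O (𝟙 R)).comp y.1 = y.1
    rw [oWittMap_id, AlgHom.id_comp]
  map_comp φ ψ := by
    refine ConcreteCategory.hom_ext _ _ fun y => Subtype.ext ?_
    change (oWittMap p O (φ ≫ ψ)).comp y.1 = (oWittMap p O ψ).comp ((oWittMap p O φ).comp y.1)
    rw [oWittMap_comp, AlgHom.comp_assoc]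

/-- The exponent `a = |W|` of the ramified extension `O' = O[ϖ^{1/a}]`. -/
abbrev ramIndex : ℕ := Nat.card P.weylGroup

/-- `L⁺(𝔱')_{L⁺(𝔠), (𝔇; n)} = L⁺(𝔱') ×_{L⁺(𝔠')} L⁺(𝔠)_{(𝔇; n)}`: the pairs of
`x ∈ 𝔱(W_O(R) ⊗ O')` and `y` in the stratum whose images in `𝔠(W_O(R) ⊗ O')` coincide. -/
def stratumT : PerfAlg p κ ⥤ Type (max (max v w) (max u v)) where
  obj R := {z : RamifiedArc p ϖ (ramIndex P) (CoordT O P) R × (stratumC p P ϖ n).obj R //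
    z.1.comp (CoordC P O).val = (oWittIncl p ϖ (ramIndex P) R).comp z.2.1}
  map φ := TypeCat.ofHom fun z =>
    ⟨((oWittExtMap p ϖ (ramIndex P) φ).comp z.1.1, (stratumC p P ϖ n).map φ z.1.2), by
      change ((oWittExtMap p ϖ (ramIndex P) φ).comp z.1.1).comp (CoordC P O).val =
        (oWittIncl p ϖ (ramIndex P) _).comp ((oWittMap p O φ).comp z.1.2.1)
      rw [AlgHom.comp_assoc, z.2, ← AlgHom.comp_assoc, ← AlgHom.comp_assoc, oWittExtMap_incl]⟩
  map_id R := by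
    refine ConcreteCategory.hom_ext _ _ fun z => Subtype.ext (Prod.ext ?_ ?_)
    · change (oWittExtMap p ϖ (ramIndex P) (𝟙 R)).comp z.1.1 = z.1.1
      rw [oWittExtMap_id, AlgHom.id_comp]
    · change (stratumC p P ϖ n).map (𝟙 R) z.1.2 = z.1.2
      rw [CategoryTheory.Functor.map_id]
      rfl
  map_comp φ ψ := by
    refine ConcreteCategory.hom_ext _ _ fun z => Subtype.ext (Prod.ext ?_ ?_)
    · change (oWittExtMap p ϖ (ramIndex P) (φ ≫ ψ)).comp z.1.1 =
        (oWittExtMap p ϖ (ramIndex P) ψ).comp ((oWittExtMap p ϖ (ramIndex P) φ).comp z.1.1)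
      rw [oWittExtMap_comp, AlgHom.comp_assoc]
    · change (stratumC p P ϖ n).map (φ ≫ ψ) z.1.2 =
        (stratumC p P ϖ n).map ψ ((stratumC p P ϖ n).map φ z.1.2)
      rw [CategoryTheory.Functor.map_comp]
      rfl

/-- The morphism `π : L⁺(𝔱')_{L⁺(𝔠), (𝔇; n)} ⟶ L⁺(𝔠)_{(𝔇; n)}` induced by `𝔱 → 𝔠`. -/
def chevalleyMap :
    (stratumT p P ϖ n : PerfAlg p κ ⥤ Type (max (max v w) (max u v))) ⟶ stratumC p P ϖ n where
  app R := TypeCat.ofHom fun z => z.1.2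
  naturality R S φ := by
    ext z
    rfl

/-- The left action of `W` on `L⁺(𝔱')_{L⁺(𝔠), (𝔇; n)}` through its action on `𝔱`,
`(a x)(f) = x (a⁻¹ f)` for `f ∈ O[𝔱]`. -/
def weylAction :
    P.weylGroup →* End (stratumT p P ϖ n : PerfAlg p κ ⥤ Type (max (max v w) (max u v))) where
  toFun a :=
    { app := fun R => TypeCat.ofHom fun z => ⟨(z.1.1.comp (weylAct P O a⁻¹), z.1.2), by
        rw [← z.2]
        apply AlgHom.ext
        intro f
        exact congrArg z.1.1 (f.2 a⁻¹)⟩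
      naturality := fun R S φ => by
        ext z
        rfl }
  map_one' := by
    apply NatTrans.ext
    funext R
    refine ConcreteCategory.hom_ext _ _ fun z => ?_
    apply Subtype.ext
    refine Prod.ext ?_ rfl
    change z.1.1.comp (weylAct P O 1⁻¹) = z.1.1
    rw [inv_one, weylAct_one, AlgHom.comp_id]
  map_mul' a b := by
    apply NatTrans.ext
    funext R
    refine ConcreteCategory.hom_ext _ _ fun z => ?_
    apply Subtype.ext
    refine Prod.ext ?_ rfl
    change z.1.1.comp (weylAct P O (a * b)⁻¹) =
      (z.1.1.comp (weylAct P O b⁻¹)).comp (weylAct P O a⁻¹)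
    rw [mul_inv_rev, weylAct_mul, AlgHom.comp_assoc]

end Strata

end WittArc

end

set_option linter.unusedSectionVars false

noncomputable section

namespace WittArc

/-! ### Regular functionals on a root datum -/

section Roots

open RootPairing IsAddIndecomposable

/-! The group theory enters through one fact. If `w ≠ 1` in `W`, some root `α` has zero orbit sum
under `w` (`exists_pow_smul_sum_eq_zero`); otherwise there is a `w`-invariant functional that is
nonzero on all roots, so `w` preserves its positive roots and is trivial. Since `|W|` is invertible
in `O`, `dα` lies in the ideal generated by the elements `f - w f`, and so does `𝔇`
(`discriminant_mem_fixedIdeal`). From there only a ring `T` with an action of `W`, its invariants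
`C`, and an element `d ∈ C` lying in all these ideals matter. They provide Galois coordinates: `∑
x_i y_i = d ^ m` and `∑ x_i (w y_i) = 0` for `w ≠ 1` (`exists_galois_coordinates`).

Over an algebraically closed field `k`, an arc with `d ≠ 0` lifts to `T` over a finite Galois
extension `L` of `K = Frac W_O(k)` whose group embeds in `W`. So `[L : K]` is prime to `p`, the
extension is totally and tamely ramified, and `L` embeds in `K(ϖ^{1/|W|})` (`exists_point`). Two
lifts differ by an element of `W`, because invariants separate orbits with values in a domain
(`exists_smul_of_eq_on_invariants`); that element is unique since `d ≠ 0`.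

To pass to families, `W_O(R)` and `W_O(R) ⊗ O'` are treated as rings of power series `∑ [r_j] ϖ^j`
(`WittLike`), on which ring maps act coefficientwise. The coefficients of a lift over `S` of an arc
over `R` are integral over `R` (`isIntegralElem_coef`). By valuations this reduces to
`mem_range_of_valuationRing`: since `d` has the same valuation at the generic and the special point
of a valuation ring `V`, the trace dual of the order spanned by the conjugates of the lift is an
algebra, and comparison with a lift over the residue field shows that it is free with values in the
integral ring. It then contains the idempotents of the `|W|` points, up to any power of the
uniformizer, so the lift is integral.

For the covering, lifts at all primes of `R` combine to one point over a product `S` of fields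
indexed by primes and elements of `W`. Let `B` be the perfect `R`-subalgebra of `S` generated by its
coefficients. It is integral over `R` and `W` acts freely on it. Its invariants are `R`, because an
integral extension of perfect rings with unique geometric points is trivial
(`surjective_of_unique_geometric_points`). Hence `B` is étale over `R`
(`etale_of_fixedIdeal_eq_top`). For simple transitivity, the loci in `Spec R` where two lifts differ
by a given element of `W` form a finite partition into closed sets, hence a locally constant
function (`existsUnique_locallyConstant`). -/

lemma exists_int_dual_forall_ne_zero {M ι : Type*} [AddCommGroup M] [Module.Finite ℤ M]
    [Module.Free ℤ M] [Finite ι] (v : ι → M) (hv : ∀ i, v i ≠ 0) :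
    ∃ f : Module.Dual ℤ M, ∀ i, f (v i) ≠ 0 := by
  classical
  cases nonempty_fintype ι
  let b := Module.finBasis ℤ M
  -- The functional is evaluation on the moment curve `(1, t, t², …)`. On `v i` it is the polynomial
  -- `q i` in `t`, so any integer avoiding the roots of the product will do.
  let q : ι → ℤ[X] := fun i => ∑ j, C (b.repr (v i) j) * X ^ (j : ℕ)
  have hq : ∀ i, q i ≠ 0 := by
    intro i hi
    refine hv i (b.repr.injective (Finsupp.ext fun j => ?_))
    have := congrArg (fun r => r.coeff (j : ℕ)) hi
    simpa [q, coeff_X_pow, Fin.val_inj] using this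
  have hprod : ∏ i, q i ≠ 0 := Finset.prod_ne_zero_iff.mpr fun i _ => hq i
  obtain ⟨t, ht⟩ : ∃ t : ℤ, (∏ i, q i).eval t ≠ 0 := by
    by_contra! h
    exact hprod (Polynomial.funext fun t => by simpa using h t)
  rw [eval_prod, Finset.prod_ne_zero_iff] at ht
  refine ⟨∑ j : Fin (Module.finrank ℤ M), (t ^ (j : ℕ)) • b.coord j, fun i => ?_⟩
  have := ht i (Finset.mem_univ i)
  simpa [q, eval_finsetSum, mul_comm] using this

variable {ι M N : Type*} [Finite ι] [AddCommGroup M] [AddCommGroup N] (P : RootDatum ι M N)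

omit [Finite ι] in
lemma aut_smul_root (g : P.Aut) (i : ι) : g • P.root i = P.root (Equiv.indexHom P g i) :=
  Hom.root_weightMap_apply _ _ _ _

omit [Finite ι] in
lemma toLinearMap_aut_smul_coroot (g : P.Aut) (m : M) (i : ι) :
    P.toLinearMap (g • m) (P.coroot (Equiv.indexHom P g i)) = P.toLinearMap m (P.coroot i) := by
  have h1 := LinearMap.congr_fun₂ g.weight_coweight_transpose (P.coroot (Equiv.indexHom P g i)) m
  have h2 := congrFun g.coroot_coweightMap (Equiv.indexHom P g i)
  have h3 : P.toLinearMap (g • m) (P.coroot (Equiv.indexHom P g i)) =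
      P.toLinearMap m (g.coweightMap (P.coroot (Equiv.indexHom P g i))) := h1
  rw [h3]
  congr 1
  simpa using h2

omit [Finite ι] in
lemma reflection_indexHom (g : P.Aut) (i : ι) :
    Equiv.reflection P (Equiv.indexHom P g i) = g * Equiv.reflection P i * g⁻¹ := by
  rw [eq_mul_inv_iff_mul_eq]
  apply Equiv.weightHom_injective
  refine LinearEquiv.ext fun m => ?_
  change P.reflection (Equiv.indexHom P g i) (g • m) = g • P.reflection i m
  rw [reflection_apply, reflection_apply, smul_sub, smul_comm g, aut_smul_root]
  exact congrArg (fun c : ℤ => g • m - c • P.root (Equiv.indexHom P g i))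
    (toLinearMap_aut_smul_coroot P g m i)

variable [P.IsReduced] (f : Module.Dual ℤ M) (hf : ∀ i, f (P.root i) ≠ 0)

/-- The simple roots with respect to a regular functional. -/
abbrev simpleRoots : Set ι := baseOf P.root (f : M →+ ℤ)

variable {P f}

include hf in
-- If a positive root `β` became negative under `s_i`, then `β` and `-s_i β` would be nonnegative
-- combinations of simple roots whose sum is a multiple of `α_i`. Linear independence leaves `β = c
-- α_i`, and reducedness gives `β = α_i`.
lemma pos_reflectionPerm {i j : ι} (hi : i ∈ simpleRoots P f) (hij : j ≠ i)
    (hj : 0 < f (P.root j)) : 0 < f (P.root (P.reflectionPerm i j)) := by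
  classical
  have : Fintype ι := Fintype.ofFinite ι
  have : Module.IsReflexive ℤ M := Module.IsReflexive.of_isPerfPair P.toLinearMap
  by_contra hneg
  let _ := P.indexNeg
  let k := P.reflectionPerm i j
  have hk : f (P.root k) < 0 := lt_of_le_of_ne (not_lt.mp hneg) (hf k)
  have hcl : ∀ l : ι, 0 < f (P.root l) →
      ∃ c : ι → ℕ, (∀ i, i ∉ simpleRoots P f → c i = 0) ∧ P.root l = ∑ i, c i • P.root i := by
    intro l hl
    have hmem : P.root l ∈ AddSubmonoid.closure (P.root '' simpleRoots P f) := by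
      rw [AddSubmonoid.closure_image_isAddIndecomposable_baseOf]
      exact AddSubmonoid.subset_closure ⟨l, hl, rfl⟩
    generalize P.root l = y at hmem
    induction hmem using AddSubmonoid.closure_induction with
    | mem x hx =>
      obtain ⟨m, hm, rfl⟩ := hx
      refine ⟨Pi.single m 1, fun i hi => ?_, ?_⟩
      · rw [Pi.single_eq_of_ne]
        rintro rfl
        exact hi hm
      · simp [Pi.single_apply]
    | zero => exact ⟨0, by simp, by simp⟩
    | add x y _ _ hx hy =>
      obtain ⟨c, hc, hx⟩ := hx
      obtain ⟨d, hd, hy⟩ := hy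
      refine ⟨c + d, fun i hi => by simp [hc i hi, hd i hi], ?_⟩
      rw [hx, hy, ← Finset.sum_add_distrib]
      simp [add_smul]
  obtain ⟨c, hc, hcj⟩ := hcl j hj
  obtain ⟨d, hd, hdk⟩ := hcl (-k) (by simpa using hk)
  have hrel : P.root j + P.root (-k) = P.pairing j i • P.root i := by
    have h1 : P.root (-k) = -P.root k := by
      rw [indexNeg_neg, root_reflectionPerm, reflection_apply_self]
    rw [h1, root_reflectionPerm, reflection_apply_root]
    abel
  have hlin := P.linearIndepOn_root_baseOf' f hf
  have hsum : ∑ l, ((c l : ℤ) + d l - if l = i then P.pairing j i else 0) • P.root l = 0 := by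
    simp only [sub_smul, add_smul, Finset.sum_sub_distrib, Finset.sum_add_distrib, ite_smul,
      zero_smul, Finset.sum_ite_eq', Finset.mem_univ, if_true]
    rw [sub_eq_zero, ← hrel, hcj, hdk]
    simp
  have hzero : ∀ l, (c l : ℤ) + d l - (if l = i then P.pairing j i else 0) = 0 := by
    intro l
    by_cases hl : l ∈ simpleRoots P f
    · rw [linearIndepOn_iff'] at hlin
      refine hlin (Finset.univ.filter (· ∈ simpleRoots P f))
        (fun l => (c l : ℤ) + d l - (if l = i then P.pairing j i else 0)) (by simp) ?_ l
        (by simpa using hl)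
      rw [Finset.sum_filter_of_ne, hsum]
      intro l _ hne
      by_contra hl
      refine hne ?_
      have : l ≠ i := fun h => hl (h ▸ hi)
      simp [hc l hl, hd l hl, this]
    · have : l ≠ i := fun h => hl (h ▸ hi)
      simp [hc l hl, hd l hl, this]
  have hci : P.root j = c i • P.root i := by
    rw [hcj, Finset.sum_eq_single i]
    · intro l _ hl
      have := hzero l
      rw [if_neg hl] at this
      have : c l = 0 := by omega
      simp [this]
    · simp
  have hdep : ¬ LinearIndependent ℤ ![P.root j, P.root i] := by
    rw [LinearIndependent.pair_iff]
    push Not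
    refine ⟨1, -(c i : ℤ), ?_, by simp⟩
    rw [hci]
    simp
  have hipos : 0 < f (P.root i) := hi.1
  rcases IsReduced.eq_or_eq_neg j i hdep with h | h
  · exact hij (P.root.injective h)
  · rw [h, map_neg] at hj
    linarith

include hf in
-- Induction on the positive integer `f (root j)`. A positive root that is not simple pairs
-- positively with some simple root, since otherwise its norm under the invariant form would be `≤
-- 0`. Reflecting in that simple root lowers the value of `f` and conjugates the reflection.
lemma reflection_mem_closure_simple (j : ι) :
    Equiv.reflection P j ∈ Subgroup.closure (Equiv.reflection P '' simpleRoots P f) := by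
  have : Fintype ι := Fintype.ofFinite ι
  have : Module.IsReflexive ℤ M := Module.IsReflexive.of_isPerfPair P.toLinearMap
  let _ := P.indexNeg
  have key : ∀ (n : ℕ) (j : ι), 0 < f (P.root j) → f (P.root j) ≤ n →
      Equiv.reflection P j ∈ Subgroup.closure (Equiv.reflection P '' simpleRoots P f) := by
    intro n
    induction n with
    | zero => intro j h h'; simp at h'; omega
    | succ n ih =>
      intro j hj hn
      by_cases hjS : j ∈ simpleRoots P f
      · exact Subgroup.subset_closure ⟨j, hjS, rfl⟩
      obtain ⟨i, hi, hpos⟩ : ∃ i ∈ simpleRoots P f, 0 < P.pairing j i := by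
        by_contra! hcon
        let B := P.posRootForm ℤ
        have hle : ∀ x ∈ AddSubmonoid.closure (P.root '' simpleRoots P f),
            B.form (P.root j) x ≤ 0 := by
          intro x hx
          induction hx using AddSubmonoid.closure_induction with
          | mem x hx =>
            obtain ⟨i, hi, rfl⟩ := hx
            have h2 := B.two_mul_apply_root_root j i
            obtain ⟨s, hs, hs'⟩ := B.exists_pos_eq i
            have hs' : s = B.form (P.root i) (P.root i) := by simpa using hs'
            rw [← hs'] at h2
            have := mul_nonpos_of_nonpos_of_nonneg (hcon i hi) hs.le
            omega
          | zero => simp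
          | add x y _ _ hx hy => rw [map_add]; omega
        have hmem : P.root j ∈ AddSubmonoid.closure (P.root '' simpleRoots P f) := by
          rw [AddSubmonoid.closure_image_isAddIndecomposable_baseOf]
          exact AddSubmonoid.subset_closure ⟨j, hj, rfl⟩
        obtain ⟨s, hs, hs'⟩ := B.exists_pos_eq j
        have hs' : s = B.form (P.root j) (P.root j) := by simpa using hs'
        have := hle _ hmem
        omega
      have hne : j ≠ i := fun h => hjS (h ▸ hi)
      have hipos : 0 < f (P.root i) := hi.1
      have hlt : f (P.root (P.reflectionPerm i j)) ≤ n := by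
        rw [root_reflectionPerm, reflection_apply_root, map_sub, map_smul, smul_eq_mul]
        have h1 : 1 * 1 ≤ P.pairing j i * f (P.root i) :=
          mul_le_mul hpos hipos (by norm_num) hpos.le
        push_cast at hn
        linarith
      have hmem := ih _ (pos_reflectionPerm hf hi hne hj) hlt
      have hconj := reflection_indexHom P (Equiv.reflection P i) (P.reflectionPerm i j)
      have hidx : Equiv.indexHom P (Equiv.reflection P i) (P.reflectionPerm i j) = j := by
        change P.reflectionPerm i (P.reflectionPerm i j) = j
        simp
      rw [hidx] at hconj
      rw [hconj]
      have hgi : Equiv.reflection P i ∈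
          Subgroup.closure (Equiv.reflection P '' simpleRoots P f) :=
        Subgroup.subset_closure ⟨i, hi, rfl⟩
      exact mul_mem (mul_mem hgi hmem) (inv_mem hgi)
  rcases lt_or_gt_of_ne (hf j) with hj | hj
  · have hneg : 0 < f (P.root (-j)) := by simpa using hj
    have := key (f (P.root (-j))).toNat (-j) hneg (by omega)
    have hEq : Equiv.reflection P (-j) = Equiv.reflection P j := by
      have h := reflection_indexHom P (Equiv.reflection P j) j
      rw [mul_inv_cancel_right] at h
      exact h
    rwa [hEq] at this
  · exact key (f (P.root j)).toNat j hj (by omega)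

include hf in
-- Exchange condition: applying the letters from the right, consider the first one that makes the
-- root negative. By `pos_reflectionPerm` the root it acts on must be its own simple root.
lemma exists_split_of_neg (L : List ι) (hL : ∀ i ∈ L, i ∈ simpleRoots P f) (j : ι)
    (hj : 0 < f (P.root j))
    (hneg : f ((L.map (Equiv.reflection P)).prod • P.root j) < 0) :
    ∃ L₁ k L₂, L = L₁ ++ k :: L₂ ∧
      Equiv.indexHom P (L₂.map (Equiv.reflection P)).prod j = k := by
  induction L with
  | nil => simp only [List.map_nil, List.prod_nil, one_smul] at hneg; omega
  | cons k L ih =>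
    set l := Equiv.indexHom P (L.map (Equiv.reflection P)).prod j with hl
    rcases lt_or_gt_of_ne (hf l) with h | h
    · obtain ⟨L₁, k', L₂, rfl, h'⟩ := ih (fun i hi => hL i (List.mem_cons_of_mem _ hi))
        (by rwa [aut_smul_root])
      exact ⟨k :: L₁, k', L₂, rfl, h'⟩
    · refine ⟨[], k, L, rfl, ?_⟩
      by_contra hne
      have := pos_reflectionPerm hf (hL k (by simp)) (Ne.symm fun h' => hne h'.symm) h
      rw [List.map_cons, List.prod_cons, mul_smul, aut_smul_root, ← hl, Equiv.reflection_smul,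
        ← root_reflectionPerm] at hneg
      exact lt_asymm this hneg

include hf in
-- Deletion argument: the last letter `i` sends `α_i` to `-α_i`, so the word before it sends `α_i`
-- to a negative root, and the exchange condition cancels `i` against an earlier letter. The word
-- gets shorter by two.
lemma list_prod_eq_one_of_pos (L : List ι) (hL : ∀ i ∈ L, i ∈ simpleRoots P f)
    (hpos : ∀ j, 0 < f (P.root j) →
      0 < f ((L.map (Equiv.reflection P)).prod • P.root j)) :
    (L.map (Equiv.reflection P)).prod = 1 := by
  induction hn : L.length using Nat.strong_induction_on generalizing L with
  | _ n ih =>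
    rcases L.eq_nil_or_concat with rfl | ⟨L', i, rfl⟩
    · simp
    rw [List.concat_eq_append] at *
    have hi : i ∈ simpleRoots P f := hL i (by simp)
    have hL' : ∀ i ∈ L', i ∈ simpleRoots P f := fun k hk => hL k (by simp [hk])
    have hipos : 0 < f (P.root i) := hi.1
    have hneg : f ((L'.map (Equiv.reflection P)).prod • P.root i) < 0 := by
      have h := hpos i hipos
      rw [List.map_append, List.prod_append, mul_smul, List.map_singleton, List.prod_singleton,
        Equiv.reflection_smul, reflection_apply_self, smul_neg, map_neg] at h
      omega
    obtain ⟨L₁, k, L₂, rfl, hk⟩ := exists_split_of_neg hf L' hL' i hipos hneg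
    -- The tail `L₂` takes `α_i` to `α_k`, so `s_k = L₂ s_i L₂⁻¹` and `L₁ s_k L₂ s_i = L₁ L₂`.
    have hcollapse : ((L₁ ++ k :: L₂ ++ [i]).map (Equiv.reflection P)).prod =
        ((L₁ ++ L₂).map (Equiv.reflection P)).prod := by
      have := reflection_indexHom P (L₂.map (Equiv.reflection P)).prod i
      rw [hk] at this
      have hsq : Equiv.reflection P i * Equiv.reflection P i = 1 := by
        nth_rewrite 1 [← Equiv.reflection_inv]
        exact inv_mul_cancel _
      simp only [List.map_append, List.map_cons, List.prod_append, List.prod_cons, List.map_nil,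
        List.prod_nil, mul_one, this]
      simp only [mul_assoc, inv_mul_cancel_left, hsq, mul_one]
    rw [hcollapse] at hpos ⊢
    refine ih (L₁ ++ L₂).length ?_ (L₁ ++ L₂) ?_ hpos rfl
    · simp at hn ⊢; omega
    · intro l hl
      refine hL l ?_
      simp at hl ⊢
      tauto

include hf in
lemma eq_one_of_pos (g : P.Aut) (hg : g ∈ P.weylGroup)
    (hpos : ∀ j, 0 < f (P.root j) → 0 < f (g • P.root j)) : g = 1 := by
  have hg' : g ∈ Subgroup.closure (Equiv.reflection P '' simpleRoots P f) := by
    refine (Subgroup.closure_le _).mpr ?_ hg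
    rintro _ ⟨j, rfl⟩
    exact reflection_mem_closure_simple hf j
  obtain ⟨L, hL, rfl⟩ : ∃ L : List ι, (∀ i ∈ L, i ∈ simpleRoots P f) ∧
      (L.map (Equiv.reflection P)).prod = g := by
    clear hpos
    induction hg' using Subgroup.closure_induction'' with
    | one => exact ⟨[], by simp, by simp⟩
    | mem x hx => obtain ⟨i, hi, rfl⟩ := hx; exact ⟨[i], by simpa using hi, by simp⟩
    | inv_mem x hx =>
      obtain ⟨i, hi, rfl⟩ := hx
      exact ⟨[i], by simpa using hi, by simp⟩
    | mul x y hx' hy' hx hy =>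
      have hle : Subgroup.closure (Equiv.reflection P '' simpleRoots P f) ≤ P.weylGroup :=
        Subgroup.closure_mono (Set.image_subset_range _ _)
      obtain ⟨L, hL, rfl⟩ := hx (hle hx')
      obtain ⟨L', hL', rfl⟩ := hy (hle hy')
      refine ⟨L ++ L', fun i hi => ?_, by simp only [List.map_append, List.prod_append]⟩
      exact (List.mem_append.mp hi).elim (hL i) (hL' i)
  exact list_prod_eq_one_of_pos hf L hL hpos

omit [Finite ι] in
-- If no orbit sum vanished, a functional `f₀` nonzero on all of them could be averaged over the
-- powers of `g`. The average is `g`-invariant and regular, so `g` preserves its positive roots and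
-- `eq_one_of_pos` applies.
lemma exists_pow_smul_sum_eq_zero [Finite ι] [Module.Finite ℤ M] (g : P.Aut)
    (hg : g ∈ P.weylGroup) (hg1 : g ≠ 1) {m : ℕ} (hm : g ^ m = 1) :
    ∃ i, ∑ j ∈ Finset.range m, g ^ j • P.root i = 0 := by
  have : Module.IsReflexive ℤ M := Module.IsReflexive.of_isPerfPair P.toLinearMap
  by_contra! hne
  obtain ⟨f₀, hf₀⟩ := exists_int_dual_forall_ne_zero _ hne
  let f : Module.Dual ℤ M :=
    ∑ j ∈ Finset.range m, f₀ ∘ₗ (Equiv.weightHom P (g ^ j) : M →ₗ[ℤ] M)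
  have hfm : ∀ x, f x = f₀ (∑ j ∈ Finset.range m, g ^ j • x) := by
    intro x
    rw [map_sum, LinearMap.sum_apply]
    rfl
  refine hg1 (eq_one_of_pos (f := f) (fun i => by rw [hfm]; exact hf₀ i) g hg fun j hj => ?_)
  have hinv : f (g • P.root j) = f (P.root j) := by
    rw [hfm, hfm]
    congr 1
    have h1 : ∀ j', g ^ j' • g • P.root j = g ^ (j' + 1) • P.root j := fun j' => by
      rw [pow_succ, mul_smul]
    simp only [h1]
    have h2 := Finset.sum_range_succ' (fun j' => g ^ j' • P.root j) m
    rw [Finset.sum_range_succ, hm] at h2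
    simpa using h2.symm
  rwa [hinv]

end Roots

/-! ### Free actions of finite groups on rings -/

section Galois

variable {W : Type*} [Group W] (A : Type*) {B : Type*} [CommRing A] [CommRing B] [Algebra A B]
  [MulSemiringAction W B] [SMulCommClass W A B]

/-- The homomorphism `b ⊗ c ↦ b * g c`. -/
def twistedMul (g : W) : B ⊗[A] B →ₐ[A] B :=
  Algebra.TensorProduct.lift (AlgHom.id A B) (MulSemiringAction.toAlgHom A B g)
    fun _ _ => Commute.all _ _

@[simp]
lemma twistedMul_tmul (g : W) (b c : B) : twistedMul A g (b ⊗ₜ c) = b * g • c := by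
  simp [twistedMul]

/-- The ideal of the fixed locus of `g`. -/
def fixedIdeal (B : Type*) [CommRing B] [MulSemiringAction W B] (g : W) : Ideal B :=
  Ideal.span (Set.range fun b : B => b - g • b)

/-- For a generator `b - g b` of the ideal, `1 ⊗ b - (g b) ⊗ 1` works. The general case follows
because both maps are linear over the left factor. -/
lemma exists_twistedMul_eq_zero {g : W} {d : B} (hd : d ∈ fixedIdeal B g) :
    ∃ e : B ⊗[A] B, twistedMul A (1 : W) e = d ∧ twistedMul A g e = 0 := by
  induction hd using Submodule.span_induction with
  | mem x hx =>
    obtain ⟨b, rfl⟩ := hx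
    exact ⟨1 ⊗ₜ b - (g • b) ⊗ₜ 1, by simp, by simp⟩
  | zero => exact ⟨0, by simp, by simp⟩
  | add x y _ _ hx hy =>
    obtain ⟨e, rfl, h2⟩ := hx
    obtain ⟨e', rfl, h2'⟩ := hy
    exact ⟨e + e', by simp, by simp [h2, h2']⟩
  | smul a x _ hx =>
    obtain ⟨e, rfl, h2⟩ := hx
    exact ⟨(a ⊗ₜ 1) * e, by simp, by simp [h2]⟩

omit A [CommRing A] [Algebra A B] [SMulCommClass W A B] in
/-- The coordinates of a Galois element. -/
lemma exists_galois_coordinates [Finite W] {d : B}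
    (hd : ∀ g : W, g ≠ 1 → d ∈ fixedIdeal B g) :
    ∃ (r : ℕ) (x y : Fin r → B) (m : ℕ), ∑ i, x i * y i = d ^ m ∧
      ∀ g : W, g ≠ 1 → ∑ i, x i * g • y i = 0 := by
  classical
  cases nonempty_fintype W
  -- The product of the `e g` over `g ≠ 1` maps to `d ^ (|W| - 1)` under the untwisted
  -- multiplication and to `0` under every twisted one. Its expansion into pure tensors supplies the
  -- `x i` and `y i`.
  choose! e he1 he2 using fun g hg => exists_twistedMul_eq_zero ℤ (hd g hg)
  obtain ⟨S, hS⟩ := TensorProduct.exists_finset (∏ g ∈ Finset.univ.erase (1 : W), e g)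
  let σ := S.equivFin
  have key : ∀ g : W, ∑ i, (σ.symm i).1.1 * g • (σ.symm i).1.2 =
      twistedMul ℤ g (∏ g ∈ Finset.univ.erase (1 : W), e g) := by
    intro g
    rw [hS, map_sum, ← Finset.sum_coe_sort S]
    simp only [twistedMul_tmul]
    exact σ.symm.sum_comp fun i : S => i.1.1 * g • i.1.2
  refine ⟨S.card, fun i => (σ.symm i).1.1, fun i => (σ.symm i).1.2,
    (Finset.univ.erase (1 : W)).card, ?_, fun g hg => ?_⟩
  · have := key 1
    simp only [one_smul] at this
    rw [this, map_prod, Finset.prod_eq_pow_card]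
    exact fun g hg => he1 g (Finset.ne_of_mem_erase hg)
  · rw [key, map_prod]
    exact Finset.prod_eq_zero (Finset.mem_erase.mpr ⟨hg, Finset.mem_univ g⟩) (he2 g hg)

variable [Fintype W]

omit [Algebra A B] [CommRing A] [SMulCommClass W A B] in
-- Dual basis formula: up to the factor `d`, every `z` is recovered from the traces of the `y i *
-- z`.
lemma sum_mul_sum_smul_eq [DecidableEq W] {r : ℕ} {x y : Fin r → B} {d : B}
    (h1 : ∑ i, x i * y i = d) (h : ∀ g : W, g ≠ 1 → ∑ i, x i * g • y i = 0) (z : B) :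
    ∑ i, x i * ∑ g : W, g • (y i * z) = d * z := by
  simp only [Finset.mul_sum, smul_mul']
  rw [Finset.sum_comm]
  simp only [← mul_assoc, ← Finset.sum_mul]
  rw [Finset.sum_eq_single 1 (fun g _ hg => by rw [h g hg, zero_mul]) (by simp)]
  simp [h1]

variable [Algebra.IsInvariant A B W] [FaithfulSMul A B]

/-- The trace of a finite group action with invariants `A`. -/
def groupTrace : B →ₗ[A] A where
  toFun b := (Algebra.IsInvariant.isInvariant (A := A) (G := W) (∑ g : W, g • b) fun h => by
    rw [Finset.smul_sum]
    simp only [smul_smul]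
    exact (Group.mulLeft_bijective h).sum_comp fun g => g • b).choose
  map_add' b c := by
    apply FaithfulSMul.algebraMap_injective A B
    rw [map_add]
    generalize_proofs p q r
    rw [p.choose_spec, q.choose_spec, r.choose_spec]
    simp [Finset.sum_add_distrib]
  map_smul' a b := by
    apply FaithfulSMul.algebraMap_injective A B
    rw [smul_eq_mul, map_mul]
    generalize_proofs p q
    rw [p.choose_spec, RingHom.id_apply, q.choose_spec]
    rw [← Algebra.smul_def, Finset.smul_sum]
    exact Finset.sum_congr rfl fun g _ => smul_comm g a b

lemma algebraMap_groupTrace (b : B) :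
    algebraMap A B (groupTrace (W := W) A b) = ∑ g : W, g • b := by
  have h : ∃ a, algebraMap A B a = ∑ g : W, g • b :=
    Algebra.IsInvariant.isInvariant (A := A) (G := W) (∑ g : W, g • b) fun h => by
      rw [Finset.smul_sum]
      simp only [smul_smul]
      exact (Group.mulLeft_bijective h).sum_comp fun g => g • b
  exact h.choose_spec

/-- A ring is étale over its invariants under a free action of a finite group. -/
theorem etale_of_fixedIdeal_eq_top (hfree : ∀ g : W, g ≠ 1 → fixedIdeal B g = ⊤) :
    (algebraMap A B).Etale := by
  classical
  obtain ⟨r, x, y, m, h1, h⟩ := exists_galois_coordinates (W := W) (d := (1 : B))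
    fun g hg => by rw [hfree g hg]; trivial
  rw [one_pow] at h1
  have hexp : ∀ z : B, z = ∑ i, groupTrace (W := W) A (y i * z) • x i := fun z => by
    have := sum_mul_sum_smul_eq h1 h z
    rw [one_mul] at this
    refine this.symm.trans ?_
    exact Finset.sum_congr rfl fun i _ => by rw [Algebra.smul_def, algebraMap_groupTrace, mul_comm]
  let s : (Fin r → A) →ₗ[A] B := Fintype.linearCombination A x
  let t : B →ₗ[A] (Fin r → A) :=
    LinearMap.pi fun i => groupTrace (W := W) A ∘ₗ LinearMap.mulLeft A (y i)
  have hst : s ∘ₗ t = LinearMap.id := LinearMap.ext fun z => by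
    simpa [s, t, Fintype.linearCombination_apply] using (hexp z).symm
  have : Module.Projective A B := Module.Projective.of_split t s hst
  have : Module.Finite A B :=
    Module.Finite.of_surjective s fun z => ⟨t z, LinearMap.congr_fun hst z⟩
  have : Module.FinitePresentation A B := Module.finitePresentation_of_projective A B
  have : Algebra.FormallyUnramified A B := by
    rw [Algebra.FormallyUnramified.iff_exists_tensorProduct]
    -- This makes `∑ x_i ⊗ y_i` a separability element. Expand `y_i z` in the dual basis, move the
    -- traces across the tensor sign, and collect them again into `z y_j`.
    have hswap : ∀ z, ∑ i, x i ⊗ₜ[A] (y i * z) = ∑ j, (z * y j) ⊗ₜ[A] x j := fun z => by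
      have h2 : ∀ i, x i ⊗ₜ[A] (y i * z) =
          ∑ j, x i ⊗ₜ[A] (groupTrace (W := W) A (y j * (y i * z)) • x j) := fun i => by
        rw [← TensorProduct.tmul_sum, ← hexp]
      simp only [h2]
      rw [Finset.sum_comm]
      refine Finset.sum_congr rfl fun j _ => ?_
      simp only [← TensorProduct.smul_tmul]
      rw [← TensorProduct.sum_tmul]
      congr 1
      rw [hexp (z * y j)]
      refine Finset.sum_congr rfl fun i _ => ?_
      congr 2
      ring
    refine ⟨∑ i, x i ⊗ₜ[A] y i, fun z => ?_, by simpa using h1⟩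
    have hz := hswap z
    have h1' := hswap 1
    simp only [mul_one, one_mul] at h1'
    rw [sub_mul, sub_eq_zero]
    nth_rewrite 2 [h1']
    simp only [Finset.mul_sum, Algebra.TensorProduct.tmul_mul_tmul, one_mul]
    rw [← hz]
    exact Finset.sum_congr rfl fun i _ => by rw [mul_comm]
  rw [RingHom.etale_algebraMap]
  exact Algebra.Etale.of_formallyUnramified_of_flat

end Galois

/-- Two points with values in a domain have the same image in the quotient by a finite group only
if they are conjugate. -/
theorem exists_smul_of_eq_on_invariants {W : Type*} [Group W] [Finite W] {B : Type*} [CommRing B]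
    [MulSemiringAction W B] {Ω : Type*} [CommRing Ω] [IsDomain Ω] (x x' : B →+* Ω)
    (h : ∀ b : B, (∀ g : W, g • b = b) → x' b = x b) : ∃ g : W, ∀ b, x' b = x (g • b) := by
  classical
  cases nonempty_fintype W
  by_contra! hcon
  choose b hb using hcon
  let σ := Fintype.equivFin W
  -- The elements `b g` witnessing that no `g` works are packed into one polynomial, so that a
  -- single root identity refutes all of them.
  let F : B[X] := ∑ g : W, C (b g) * X ^ (σ g : ℕ)
  have hcoeff : ∀ g, F.coeff (σ g) = b g := fun g => by
    simp [F, coeff_X_pow, Fin.val_inj]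
  -- The coefficients of `∏ (X - g F)` are invariant, so `x` and `x'` agree on them. Hence `x' F` is
  -- a root of `∏ (X - x (g F))` over a domain and equals some `x (g F)`.
  let G : B[X][X] := MulSemiringAction.charpoly W F
  have hG : ∀ i j, x' ((G.coeff i).coeff j) = x ((G.coeff i).coeff j) := fun i j => by
    refine h _ fun g => ?_
    have := congrArg (fun q => q.coeff j) (MulSemiringAction.smul_coeff_charpoly F i g)
    rwa [Polynomial.smul_eq_map, Polynomial.coeff_map] at this
  have hGmap : G.map (mapRingHom x') = G.map (mapRingHom x) := by
    ext i j
    simpa using hG i j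
  have hroot : (G.map (mapRingHom x)).eval (F.map x') = 0 := by
    rw [← hGmap]
    have := congrArg (mapRingHom x') (MulSemiringAction.eval_charpoly (G := W) F)
    rw [map_zero] at this
    rw [← this]
    change _ = mapRingHom x' _
    rw [← eval_map_apply]
    rfl
  rw [show G = ∏ g : W, (X - C (g • F)) from rfl, Polynomial.map_prod, eval_prod,
    Finset.prod_eq_zero_iff] at hroot
  obtain ⟨g, -, hg⟩ := hroot
  refine hb g ?_
  simp only [Polynomial.map_sub, map_X, map_C, eval_sub, eval_X, eval_C, coe_mapRingHom,
    sub_eq_zero] at hg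
  have := congrArg (fun q => q.coeff (σ g)) hg
  simpa [Polynomial.smul_eq_map, coeff_map, hcoeff] using this

/-! ### Integral extensions of perfect rings -/

/-- `B ⧸ Q` is algebraic over `A ⧸ ker φ`, so the embedding of the latter into `Ω` extends. The
extension is injective because its kernel contracts to zero in an integral extension of domains. -/
lemma exists_lift_of_isIntegral {A B Ω : Type*} [CommRing A] [CommRing B] [Algebra A B]
    [Algebra.IsIntegral A B] [Field Ω] [IsAlgClosed Ω] (φ : A →+* Ω) (Q : Ideal B) [Q.IsPrime]
    (hQ : Q.comap (algebraMap A B) = RingHom.ker φ) :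
    ∃ ψ : B →+* Ω, ψ.comp (algebraMap A B) = φ ∧ RingHom.ker ψ = Q := by
  let q : Ideal A := Q.comap (algebraMap A B)
  have : Q.LiesOver q := ⟨rfl⟩
  let φ' : A ⧸ q →+* Ω := Ideal.Quotient.lift q φ fun a ha => by
    rwa [show q = RingHom.ker φ from hQ] at ha
  let _ : Algebra (A ⧸ q) Ω := φ'.toAlgebra
  have hφ' : Function.Injective φ' := by
    rw [injective_iff_map_eq_zero]
    intro a
    obtain ⟨a, rfl⟩ := Ideal.Quotient.mk_surjective a
    intro ha
    rw [Ideal.Quotient.eq_zero_iff_mem, show q = RingHom.ker φ from hQ]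
    exact ha
  have : FaithfulSMul (A ⧸ q) Ω := (faithfulSMul_iff_algebraMap_injective _ _).mpr hφ'
  have : Algebra.IsIntegral (A ⧸ q) (B ⧸ Q) := inferInstance
  have : Algebra.IsAlgebraic (A ⧸ q) (B ⧸ Q) := inferInstance
  have : Module.IsTorsionFree (A ⧸ q) (B ⧸ Q) := Module.isTorsionFree_iff_faithfulSMul.mpr inferInstance
  let ψ : B ⧸ Q →ₐ[A ⧸ q] Ω := IsAlgClosed.lift
  refine ⟨ψ.toRingHom.comp (Ideal.Quotient.mk Q), ?_, ?_⟩
  · ext a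
    exact ψ.commutes (Ideal.Quotient.mk q a)
  · have : Function.Injective ψ := by
      rw [← AlgHom.coe_toRingHom, RingHom.injective_iff_ker_eq_bot]
      refine Ideal.eq_bot_of_comap_eq_bot (R := A ⧸ q) ?_
      rw [RingHom.comap_ker, ← RingHom.injective_iff_ker_eq_bot]
      convert hφ'
      exact RingHom.ext ψ.commutes
    ext b
    rw [RingHom.mem_ker, ← Ideal.Quotient.eq_zero_iff_mem]
    exact map_eq_zero_iff ψ this

section Perfect

variable (p : ℕ) [hp : Fact p.Prime]

lemma perfectRing_of_fraction {A K : Type*} [CommRing A] [PerfectRing A p] [Field K]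
    [CharP K p] (φ : A →+* K) (hφ : ∀ x : K, ∃ a s, x = φ a / φ s) : PerfectRing K p := by
  have : ExpChar K p := .prime hp.out
  refine PerfectRing.ofSurjective K p fun x => ?_
  obtain ⟨a, s, rfl⟩ := hφ x
  obtain ⟨a, rfl⟩ := (PerfectRing.bijective_frobenius (R := A) (p := p)).2 a
  obtain ⟨s, rfl⟩ := (PerfectRing.bijective_frobenius (R := A) (p := p)).2 s
  exact ⟨φ a / φ s, by simp [frobenius_def]⟩

lemma residueField_exists_div {A : Type*} [CommRing A] (q : Ideal A) [q.IsPrime]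
    (x : q.ResidueField) :
    ∃ a s, s ∉ q ∧ x = algebraMap A q.ResidueField a / algebraMap A q.ResidueField s := by
  obtain ⟨a, s, hs, rfl⟩ := IsFractionRing.div_surjective (A := A ⧸ q) x
  obtain ⟨a, rfl⟩ := Ideal.Quotient.mk_surjective a
  obtain ⟨s, rfl⟩ := Ideal.Quotient.mk_surjective s
  refine ⟨a, s, fun h => ?_, rfl⟩
  rw [Ideal.Quotient.eq_zero_iff_mem.mpr h] at hs
  exact zero_notMem_nonZeroDivisors hs

lemma charP_residueField {A : Type*} [CommRing A] [CharP A p] (q : Ideal A) [q.IsPrime] :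
    CharP q.ResidueField p := by
  have h : (p : q.ResidueField) = 0 := by
    rw [← map_natCast (algebraMap A q.ResidueField), CharP.cast_eq_zero, map_zero]
  obtain ⟨r, hr⟩ := CharP.exists q.ResidueField
  have hdvd := (CharP.cast_eq_zero_iff q.ResidueField r p).mp h
  rcases (Nat.dvd_prime hp.out).mp hdvd with rfl | rfl
  · exact (CharP.char_ne_one q.ResidueField 1 rfl).elim
  · exact hr

lemma perfectRing_residueField {A : Type*} [CommRing A] [CharP A p] [PerfectRing A p]
    (q : Ideal A) [q.IsPrime] : PerfectRing q.ResidueField p := by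
  have := charP_residueField p q
  refine perfectRing_of_fraction p (algebraMap A q.ResidueField) fun x => ?_
  obtain ⟨a, s, -, h⟩ := residueField_exists_div q x
  exact ⟨a, s, h⟩

lemma isReduced_of_perfectRing {A : Type*} [CommRing A] [PerfectRing A p] :
    _root_.IsReduced A := by
  refine (isReduced_iff_pow_one_lt p hp.out.one_lt).mpr fun x hx => ?_
  refine (PerfectRing.bijective_frobenius (R := A) (p := p)).1 ?_
  simp [hx, hp.out.ne_zero]

/-- An integral extension of perfect rings is trivial if maps to algebraically closed fields extend
in at most one way. -/
theorem surjective_of_unique_geometric_points {A B : Type u} [CommRing A] [CommRing B]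
    [CharP A p] [PerfectRing A p] [PerfectRing B p] [Algebra A B] [Algebra.IsIntegral A B]
    [FaithfulSMul A B]
    (huniq : ∀ (k : Type u) [Field k] [IsAlgClosed k] (φ ψ : B →+* k),
      φ.comp (algebraMap A B) = ψ.comp (algebraMap A B) → φ = ψ) :
    Function.Surjective (algebraMap A B) := by
  intro b
  by_contra hb
  have hinj : Function.Injective (algebraMap A B) := FaithfulSMul.algebraMap_injective A B
  -- Perfectness enters here: the image of `A` is closed under `p`-th roots in `B`, which makes the
  -- conductor `J` radical.
  have hroot : ∀ z : B, z ^ p ∈ (algebraMap A B).range → z ∈ (algebraMap A B).range := by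
    rintro z ⟨a, ha⟩
    obtain ⟨a, rfl⟩ := (PerfectRing.bijective_frobenius (R := A) (p := p)).2 a
    refine ⟨a, (PerfectRing.bijective_frobenius (R := B) (p := p)).1 ?_⟩
    simpa using ha
  let D := Algebra.adjoin A {b}
  let b' : D := ⟨b, Algebra.subset_adjoin rfl⟩
  -- The conductor of `A` in `D = A[b]`. The ideal `I` below consists of the denominators of `b`
  -- alone.
  let J : Ideal D :=
    { carrier := {c | ∀ d : D, ((c * d : D) : B) ∈ (algebraMap A B).range}
      add_mem' := fun {x y} hx hy d => by
        rw [add_mul, Subalgebra.coe_add]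
        exact add_mem (hx d) (hy d)
      zero_mem' := fun d => by simp
      smul_mem' := fun c x hx d => by
        rw [smul_eq_mul, mul_comm c, mul_assoc]
        exact hx _ }
  have hJ : ∀ c : D, c ^ p ∈ J → c ∈ J := fun c hc d => by
    refine hroot _ ?_
    have := hc (d ^ p)
    rwa [← mul_pow] at this
  have hJrad : ∀ (c : D) (n : ℕ), c ^ n ∈ J → c ∈ J := by
    have h1 : ∀ (m : ℕ) (c : D), c ^ p ^ m ∈ J → c ∈ J := by
      intro m
      induction m with
      | zero => intro c hc; simpa using hc
      | succ m ih =>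
        intro c hc
        rw [pow_succ, pow_mul] at hc
        exact ih c (hJ _ hc)
    intro c n hc
    refine h1 n c ?_
    have hle : n ≤ p ^ n := (Nat.lt_pow_self hp.out.one_lt).le
    rw [← Nat.sub_add_cancel hle, pow_add]
    exact J.mul_mem_left _ hc
  let I : Ideal A :=
    { carrier := {a | algebraMap A B a * b ∈ (algebraMap A B).range}
      add_mem' := fun {x y} hx hy => by
        simp only [Set.mem_ofPred_eq, map_add, add_mul]
        exact add_mem hx hy
      zero_mem' := by simp
      smul_mem' := fun c x hx => by
        simp only [Set.mem_ofPred_eq, smul_eq_mul, map_mul, mul_assoc] at hx ⊢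
        exact mul_mem ⟨c, rfl⟩ hx }
  -- `D` is a finite `A`-module, so a power of `a` clears the denominators of all its elements and
  -- lies in `J`; as `J` is radical, so does `a`.
  have hIJ : ∀ a ∈ I, algebraMap A D a ∈ J := by
    intro a ha
    have h1 : ∀ d ∈ D, ∃ N, ∀ n ≥ N, algebraMap A B a ^ n * d ∈ (algebraMap A B).range := by
      intro d hd
      induction hd using Algebra.adjoin_induction with
      | mem x hx =>
        rw [Set.mem_singleton_iff] at hx
        subst hx
        refine ⟨1, fun n hn => ?_⟩
        obtain ⟨m, rfl⟩ := Nat.exists_eq_add_of_le' hn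
        rw [pow_succ, mul_assoc]
        exact mul_mem (pow_mem ((algebraMap A B).mem_range_self a) _) ha
      | algebraMap r => exact ⟨0, fun n _ => mul_mem (pow_mem ((algebraMap A B).mem_range_self a) _) ((algebraMap A B).mem_range_self r)⟩
      | add x y _ _ hx hy =>
        obtain ⟨N, hN⟩ := hx
        obtain ⟨N', hN'⟩ := hy
        refine ⟨N + N', fun n hn => ?_⟩
        rw [mul_add]
        exact add_mem (hN n (by omega)) (hN' n (by omega))
      | mul x y _ _ hx hy =>
        obtain ⟨N, hN⟩ := hx
        obtain ⟨N', hN'⟩ := hy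
        refine ⟨N + N', fun n hn => ?_⟩
        obtain ⟨m, rfl⟩ := Nat.exists_eq_add_of_le hn
        rw [show algebraMap A B a ^ (N + N' + m) * (x * y) =
          (algebraMap A B a ^ N * x) * (algebraMap A B a ^ (N' + m) * y) by ring]
        exact mul_mem (hN N le_rfl) (hN' _ (by omega))
    obtain ⟨s, hs⟩ : (Subalgebra.toSubmodule D).FG :=
      (Algebra.IsIntegral.isIntegral (R := A) b).fg_adjoin_singleton
    obtain ⟨N, hN⟩ : ∃ N, ∀ d ∈ s, ∀ n ≥ N, algebraMap A B a ^ n * d ∈ (algebraMap A B).range := by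
      choose! N hN using h1
      refine ⟨s.sup N, fun d hd n hn => hN d ?_ n ((Finset.le_sup hd).trans hn)⟩
      rw [← Subalgebra.mem_toSubmodule, ← hs]
      exact Submodule.subset_span hd
    refine hJrad _ N fun d => ?_
    have hd : (d : B) ∈ Submodule.span A (s : Set B) := by rw [hs]; exact d.2
    change algebraMap A B a ^ N * (d : B) ∈ (algebraMap A B).range
    generalize (d : B) = d at hd
    induction hd using Submodule.span_induction with
    | mem x hx => exact hN x hx N le_rfl
    | zero => simp
    | add x y _ _ hx hy => rw [mul_add]; exact add_mem hx hy
    | smul r x _ hx =>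
      rw [Algebra.smul_def, mul_left_comm]
      exact mul_mem ⟨r, rfl⟩ hx
  have hI1 : I ≠ ⊤ := by
    intro h
    have : (1 : A) ∈ I := by rw [h]; trivial
    simp only [I, Submodule.mem_mk, AddSubmonoid.mem_mk, AddSubsemigroup.mem_mk,
      Set.mem_ofPred_eq, map_one, one_mul] at this
    exact hb this
  obtain ⟨q, hq⟩ := Ideal.nonempty_minimalPrimes hI1
  have hqp : q.IsPrime := hq.1.1
  -- the unique prime over `q`
  obtain ⟨Q, -, hQp, hQ⟩ := Ideal.exists_ideal_over_prime_of_isIntegral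
    (S := B) q ⊥ (by
      rw [← RingHom.ker_eq_comap_bot, (RingHom.injective_iff_ker_eq_bot _).mp hinj]; exact bot_le)
  let Ω := AlgebraicClosure q.ResidueField
  let φ : A →+* Ω := (algebraMap q.ResidueField Ω).comp (algebraMap A q.ResidueField)
  have hφ : RingHom.ker φ = q := by
    ext z
    rw [RingHom.mem_ker, RingHom.comp_apply, map_eq_zero, Ideal.algebraMap_residueField_eq_zero]
  obtain ⟨ψ, hψ, hψQ⟩ := exists_lift_of_isIntegral φ Q (hQ.trans hφ.symm)
  have hQuniq : ∀ (Q' : Ideal B) [Q'.IsPrime], Q'.comap (algebraMap A B) = q → Q' = Q := by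
    intro Q' hQ'p hQ'
    obtain ⟨ψ', hψ', hψQ'⟩ := exists_lift_of_isIntegral φ Q' (hQ'.trans hφ.symm)
    rw [← hψQ, ← hψQ', huniq Ω ψ' ψ (hψ'.trans hψ.symm)]
  -- By uniqueness of geometric points the value of `b` at `Q` is fixed by all automorphisms over
  -- the residue field of `q`. This field is perfect, so the value lies in it.
  have hval : ∃ a s, s ∉ q ∧ algebraMap A B s * b - algebraMap A B a ∈ Q := by
    have := charP_residueField p q
    have := perfectRing_residueField p q
    have : ExpChar q.ResidueField p := .prime hp.out
    have : PerfectField q.ResidueField := PerfectRing.toPerfectField q.ResidueField p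
    have : IsGalois q.ResidueField Ω := inferInstance
    have hb' : ψ b ∈ (⊥ : IntermediateField q.ResidueField Ω) := by
      rw [InfiniteGalois.mem_bot_iff_fixed]
      intro σ
      refine RingHom.congr_fun (huniq Ω (σ.toRingEquiv.toRingHom.comp ψ) ψ ?_) b
      rw [RingHom.comp_assoc, hψ]
      ext z
      exact σ.commutes _
    obtain ⟨β, hβ⟩ := IntermediateField.mem_bot.mp hb'
    obtain ⟨a, s, hs, rfl⟩ := residueField_exists_div q β
    refine ⟨a, s, hs, ?_⟩
    have hs0 : φ s ≠ 0 := fun h => hs (hφ ▸ h)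
    have h1 : φ a = φ s * ψ b := by
      rw [← hβ, map_div₀]
      exact (mul_div_cancel₀ _ hs0).symm
    rw [← hψQ, RingHom.mem_ker, map_sub, map_mul, ← RingHom.comp_apply, ← RingHom.comp_apply,
      hψ, h1, sub_self]
  obtain ⟨a, s, hs, hc⟩ := hval
  let c : D := algebraMap A D s * b' - algebraMap A D a
  -- Otherwise some prime of `D` contains `J` but misses `c` and the complement of `q`. By
  -- minimality of `q` it lies over `q`, hence under `Q`, and `Q` contains `c`.
  obtain ⟨s', hs', n, hmem⟩ : ∃ s', s' ∉ q ∧ ∃ n, algebraMap A D s' * c ^ n ∈ J := by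
    by_contra! hcon
    let S : Submonoid D := Submonoid.map (algebraMap A D) q.primeCompl ⊔ Submonoid.powers c
    have hdisj : Disjoint (J : Set D) (S : Set D) := by
      rw [Set.disjoint_left]
      intro x hxJ hxS
      obtain ⟨y, ⟨s', hs', rfl⟩, z, ⟨n, rfl⟩, rfl⟩ := Submonoid.mem_sup.mp hxS
      exact hcon s' hs' n hxJ
    obtain ⟨Q₁, hQ₁p, hJQ, hQS⟩ := Ideal.exists_le_prime_disjoint J S hdisj
    rw [Set.disjoint_left] at hQS
    have hQ₁q : Q₁.comap (algebraMap A D) = q := by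
      have hle : Q₁.comap (algebraMap A D) ≤ q := by
        intro x hx
        by_contra hxq
        exact hQS hx (Submonoid.mem_sup_left ⟨x, hxq, rfl⟩)
      exact le_antisymm hle (hq.2 ⟨inferInstance, fun x hx => hJQ (hIJ x hx)⟩ hle)
    have : Algebra.IsIntegral D B := Algebra.IsIntegral.tower_top A
    obtain ⟨Q₂, -, hQ₂p, hQ₂⟩ := Ideal.exists_ideal_over_prime_of_isIntegral
      (R := D) (S := B) Q₁ ⊥ (by
        rw [← RingHom.ker_eq_comap_bot,
          (RingHom.injective_iff_ker_eq_bot _).mp (FaithfulSMul.algebraMap_injective D B)]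
        exact bot_le)
    have hQ₂Q : Q₂ = Q := hQuniq Q₂ (by
      rw [← hQ₁q, ← hQ₂, Ideal.comap_comap]
      rfl)
    refine hQS (a := c) ?_ (Submonoid.mem_sup_right ⟨1, pow_one c⟩)
    rw [← hQ₂, hQ₂Q]
    exact hc
  have hsc : algebraMap A D s' * c ∈ J := by
    refine hJrad _ (n + 1) ?_
    rw [mul_pow, pow_succ, pow_succ' c, mul_mul_mul_comm]
    exact J.mul_mem_left _ hmem
  have hmemI : s' * s ∈ I := by
    have h1 := hsc 1
    have h2 : algebraMap A B (s' * s) * b =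
        ((algebraMap A D s' * c * 1 : D) : B) + algebraMap A B (s' * a) := by
      simp only [c, mul_one, Subalgebra.coe_mul, Subalgebra.coe_sub, Subalgebra.coe_algebraMap,
        map_mul, b', mul_sub, sub_add_cancel, mul_assoc]
    change _ ∈ (algebraMap A B).range
    rw [h2]
    exact add_mem h1 ⟨_, rfl⟩
  rcases hqp.mem_or_mem (hq.1.2 hmemI) with h | h
  · exact hs' h
  · exact hs h

end Perfect

/-! ### Rings of Teichmüller expansions -/

/-- A ring `A` whose elements are the power series `∑ [r_j] ϖ^j` with coefficients in `R`, where
`r ↦ [r]` is multiplicative. -/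
structure WittLike (A R : Type*) [CommRing A] [CommRing R] where
  unif : A
  res : A →+* R
  tch : R →* A
  res_tch : ∀ r, res (tch r) = r
  res_unif : res unif = 0
  unif_dvd : ∀ z, res z = 0 → unif ∣ z
  unif_cancel : ∀ z, unif * z = 0 → z = 0
  separated : ∀ z, (∀ n, unif ^ n ∣ z) → z = 0
  complete : ∀ f : ℕ → A, ∃ z, ∀ n, unif ^ n ∣ z - ∑ j ∈ Finset.range n, unif ^ j * f j

namespace WittLike

/-- A Cauchy sequence is the sequence of partial sums of its increments, the `n`-th of which is a
multiple of `t ^ n`. -/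
lemma isAdicComplete_of_series {A : Type*} [CommRing A] {t : A}
    (hsep : ∀ z, (∀ n, t ^ n ∣ z) → z = 0)
    (hcompl : ∀ f : ℕ → A, ∃ z, ∀ n, t ^ n ∣ z - ∑ j ∈ Finset.range n, t ^ j * f j) :
    IsAdicComplete (Ideal.span {t}) A := by
  have hmod : ∀ (n : ℕ) (x y : A),
      x ≡ y [SMOD (Ideal.span {t} ^ n • ⊤ : Submodule A A)] ↔ t ^ n ∣ x - y := by
    intro n x y
    rw [SModEq.sub_mem, smul_eq_mul, Ideal.mul_top, Ideal.span_singleton_pow,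
      Ideal.mem_span_singleton]
  refine { haus' := fun x hx => hsep x fun n => ?_, prec' := fun f hf => ?_ }
  · simpa using (hmod n x 0).mp (hx n)
  · have h : ∀ n, ∃ c, f (n + 1) - f n = t ^ n * c := fun n =>
      (hmod n _ _).mp (hf n.le_succ).symm
    choose c hc using h
    obtain ⟨z, hz⟩ := hcompl c
    have hsum : ∀ n, ∑ j ∈ Finset.range n, t ^ j * c j = f n - f 0 := by
      intro n
      rw [← Finset.sum_range_sub]
      exact Finset.sum_congr rfl fun j _ => (hc j).symm
    refine ⟨f 0 + z, fun n => (hmod n _ _).mpr ?_⟩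
    rw [← dvd_neg]
    convert hz n using 1
    rw [hsum]
    ring

section Basic

variable {A R : Type*} [CommRing A] [CommRing R] (D : WittLike A R)

lemma unif_dvd_iff {z : A} : D.unif ∣ z ↔ D.res z = 0 := by
  refine ⟨?_, D.unif_dvd z⟩
  rintro ⟨c, rfl⟩
  rw [map_mul, D.res_unif, zero_mul]

lemma unif_mul_cancel {x y : A} (h : D.unif * x = D.unif * y) : x = y :=
  sub_eq_zero.mp (D.unif_cancel _ (by rw [mul_sub, h, sub_self]))

lemma unif_pow_mul_cancel {x y : A} {n : ℕ} (h : D.unif ^ n * x = D.unif ^ n * y) : x = y := by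
  induction n with
  | zero => simpa using h
  | succ n ih =>
    refine ih (D.unif_mul_cancel ?_)
    rwa [pow_succ', mul_assoc, mul_assoc] at h

lemma exists_shift (z : A) : ∃ c, z = D.tch (D.res z) + D.unif * c := by
  obtain ⟨c, hc⟩ := D.unif_dvd (z - D.tch (D.res z)) (by rw [map_sub, D.res_tch, sub_self])
  exact ⟨c, by rw [← hc]; ring⟩

/-- The series `z` without its constant term, divided by `ϖ`. -/
def shift (z : A) : A := (D.exists_shift z).choose

lemma eq_add_shift (z : A) : z = D.tch (D.res z) + D.unif * D.shift z :=
  (D.exists_shift z).choose_spec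

lemma shift_eq {z c : A} {r : R} (h : z = D.tch r + D.unif * c) : D.res z = r ∧ D.shift z = c := by
  have hr : D.res z = r := by rw [h, map_add, D.res_tch, map_mul, D.res_unif, zero_mul, add_zero]
  refine ⟨hr, D.unif_mul_cancel ?_⟩
  have h1 := D.eq_add_shift z
  rw [hr] at h1
  exact add_left_cancel (h1.symm.trans h)

/-- The coefficients of the series `z`. -/
def coef (z : A) (j : ℕ) : R := D.res (D.shift^[j] z)

@[simp] lemma coef_zero (z : A) : D.coef z 0 = D.res z := rfl

lemma coef_succ (z : A) (j : ℕ) : D.coef z (j + 1) = D.coef (D.shift z) j := rfl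

lemma eq_sum_add (z : A) (n : ℕ) :
    z = ∑ j ∈ Finset.range n, D.unif ^ j * D.tch (D.coef z j) + D.unif ^ n * D.shift^[n] z := by
  induction n with
  | zero => simp
  | succ n ih =>
    conv_lhs => rw [ih, D.eq_add_shift (D.shift^[n] z)]
    rw [Finset.sum_range_succ, Function.iterate_succ_apply', coef]
    ring

lemma coef_injective {z z' : A} (h : ∀ j, D.coef z j = D.coef z' j) : z = z' := by
  refine sub_eq_zero.mp (D.separated _ fun n => ?_)
  rw [D.eq_sum_add z n, D.eq_sum_add z' n]
  simp only [h, add_sub_add_left_eq_sub, ← mul_sub]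
  exact dvd_mul_right _ _

/-- Uniqueness of expansions: reducing identifies the constant term; subtract it, cancel one
uniformizer and repeat. -/
lemma coef_eq_of_dvd {r : ℕ → R} {z : A}
    (h : ∀ n, D.unif ^ n ∣ z - ∑ j ∈ Finset.range n, D.unif ^ j * D.tch (r j)) (j : ℕ) :
    D.coef z j = r j := by
  have hstep : ∀ n, z - ∑ j ∈ Finset.range (n + 1), D.unif ^ j * D.tch (r j) =
      D.tch (D.res z) - D.tch (r 0) +
        D.unif * (D.shift z - ∑ j ∈ Finset.range n, D.unif ^ j * D.tch (r (j + 1))) := by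
    intro n
    conv_lhs => rw [D.eq_add_shift z]
    rw [Finset.sum_range_succ', mul_sub, Finset.mul_sum]
    simp only [pow_succ', pow_zero, one_mul, mul_assoc]
    ring
  have h0 : D.res z = r 0 := by
    have h1 := h 1
    rw [pow_one, D.unif_dvd_iff] at h1
    simpa [D.res_tch, sub_eq_zero] using h1
  induction j generalizing r z with
  | zero => exact h0
  | succ j ih =>
    rw [coef_succ]
    have hs : ∀ n, D.unif ^ n ∣
        D.shift z - ∑ j ∈ Finset.range n, D.unif ^ j * D.tch (r (j + 1)) := by
      intro n
      obtain ⟨c, hc⟩ := h (n + 1)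
      rw [hstep, h0, sub_self, zero_add, pow_succ', mul_assoc] at hc
      exact ⟨c, D.unif_mul_cancel hc⟩
    refine ih (r := fun j => r (j + 1)) hs ?_ ?_
    · intro n
      conv_lhs => rw [D.eq_add_shift (D.shift z)]
      rw [Finset.sum_range_succ', mul_sub, Finset.mul_sum]
      simp only [pow_succ', pow_zero, one_mul, mul_assoc]
      ring
    · have h1 := hs 1
      rw [pow_one, D.unif_dvd_iff] at h1
      simpa [D.res_tch, sub_eq_zero] using h1

lemma exists_coef_eq (r : ℕ → R) : ∃ z, ∀ j, D.coef z j = r j := by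
  obtain ⟨z, hz⟩ := D.complete fun j => D.tch (r j)
  exact ⟨z, D.coef_eq_of_dvd hz⟩

lemma isAdicComplete : IsAdicComplete (Ideal.span {D.unif}) A :=
  isAdicComplete_of_series D.separated D.complete

/-- Multiplying by the lift of an inverse residue gives an element congruent to `1`, and the
uniformizer lies in the Jacobson radical by completeness. -/
lemma isUnit_of_isUnit_res {z : A} (h : IsUnit (D.res z)) : IsUnit z := by
  have := D.isAdicComplete
  have hle := IsAdicComplete.le_jacobson_bot (Ideal.span {D.unif})
  obtain ⟨r, hr⟩ := h.exists_right_inv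
  have hker : ∀ x, D.res x = 1 → IsUnit x := by
    intro x hx
    have hmem : 1 - x ∈ Ideal.jacobson (⊥ : Ideal A) := hle (by
      rw [Ideal.mem_span_singleton, D.unif_dvd_iff, map_sub, map_one, hx, sub_self])
    have := (Ideal.mem_jacobson_bot.mp hmem) (-1)
    simpa using this
  exact isUnit_of_mul_isUnit_left (hker (z * D.tch r) (by rw [map_mul, D.res_tch, hr]))

lemma exists_eq_unif_pow_mul {z : A} (hz : z ≠ 0) :
    ∃ n c, z = D.unif ^ n * c ∧ D.res c ≠ 0 := by
  by_contra! hcon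
  refine hz (D.separated z fun n => ?_)
  induction n with
  | zero => simp
  | succ n ih =>
    obtain ⟨c, rfl⟩ := ih
    rw [pow_succ]
    exact mul_dvd_mul_left _ (D.unif_dvd c (hcon n c rfl))

include D in
lemma nontrivial [Nontrivial R] : Nontrivial A := D.res.domain_nontrivial

include D in
lemma isDomain [IsDomain R] : IsDomain A := by
  have := D.nontrivial
  have : NoZeroDivisors A := by
    refine ⟨fun {x y} hxy => ?_⟩
    by_contra! h
    obtain ⟨m, a, rfl, ha⟩ := D.exists_eq_unif_pow_mul h.1
    obtain ⟨n, b, rfl, hb⟩ := D.exists_eq_unif_pow_mul h.2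
    have h0 : a * b = 0 := D.unif_pow_mul_cancel (n := m + n) (by rw [mul_zero, ← hxy]; ring)
    have := congrArg D.res h0
    rw [map_mul, map_zero] at this
    exact mul_ne_zero ha hb this
  exact NoZeroDivisors.to_isDomain A

lemma unif_ne_zero [Nontrivial R] : D.unif ≠ 0 := by
  intro h
  have := D.nontrivial
  exact one_ne_zero (D.unif_cancel 1 (by rw [h, zero_mul]))

lemma irreducible_unif {k : Type*} [Field k] (D : WittLike A k) : Irreducible D.unif := by
  have := D.isDomain
  refine ⟨fun h => ?_, fun a b hab => ?_⟩
  · have := h.map D.res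
    rw [D.res_unif] at this
    exact not_isUnit_zero this
  · by_contra! h
    have hz : ∀ c, ¬ IsUnit c → D.unif ∣ c := fun c hc => D.unif_dvd c (by
      by_contra hne
      exact hc (D.isUnit_of_isUnit_res (isUnit_iff_ne_zero.mpr hne)))
    obtain ⟨a, rfl⟩ := hz a h.1
    obtain ⟨b, rfl⟩ := hz b h.2
    have h1 : (1 : A) = a * (D.unif * b) := D.unif_mul_cancel (by rw [mul_one, ← mul_assoc, ← hab])
    have := congrArg D.res h1
    simp [D.res_unif] at this

lemma isDiscreteValuationRing {k : Type*} [Field k] [IsDomain A] (D : WittLike A k) :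
    IsDiscreteValuationRing A := by
  refine IsDiscreteValuationRing.ofHasUnitMulPowIrreducibleFactorization
    ⟨D.unif, D.irreducible_unif, fun {x} hx => ?_⟩
  obtain ⟨n, c, rfl, hc⟩ := D.exists_eq_unif_pow_mul hx
  exact ⟨n, associated_mul_unit_right _ _ (D.isUnit_of_isUnit_res (isUnit_iff_ne_zero.mpr hc))⟩

end Basic

/-- A morphism of rings of Teichmüller expansions, acting on the coefficients. -/
structure IsMap {A R A' R' : Type*} [CommRing A] [CommRing R] [CommRing A'] [CommRing R']
    (D : WittLike A R) (D' : WittLike A' R') (f : A →+* A') (g : R →+* R') : Prop where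
  map_unif : f D.unif = D'.unif
  res_map : ∀ z, D'.res (f z) = g (D.res z)
  map_tch : ∀ r, f (D.tch r) = D'.tch (g r)

namespace IsMap

variable {A R A' R' : Type*} [CommRing A] [CommRing R] [CommRing A'] [CommRing R']
    {D : WittLike A R} {D' : WittLike A' R'} {f : A →+* A'} {g : R →+* R'} (h : IsMap D D' f g)

include h

lemma map_shift (z : A) : f (D.shift z) = D'.shift (f z) := by
  refine (D'.shift_eq (r := g (D.res z)) ?_).2.symm
  conv_lhs => rw [D.eq_add_shift z]
  rw [map_add, map_mul, h.map_tch, h.map_unif]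

lemma coef_map (z : A) (j : ℕ) : D'.coef (f z) j = g (D.coef z j) := by
  induction j generalizing z with
  | zero => exact h.res_map z
  | succ j ih => rw [coef_succ, coef_succ, ← ih, h.map_shift]

lemma injective (hg : Function.Injective g) : Function.Injective f := fun x y hxy =>
  D.coef_injective fun j => hg (by rw [← h.coef_map, ← h.coef_map, hxy])

/-- The basis of all descent arguments below. Every sequence of coefficients is realised by some
element, so membership in the smaller ring may be tested coefficient by coefficient. -/
lemma mem_range_iff {z : A'} : z ∈ f.range ↔ ∀ j, D'.coef z j ∈ g.range := by
  refine ⟨?_, fun hz => ?_⟩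
  · rintro ⟨x, rfl⟩ j
    exact ⟨_, (h.coef_map x j).symm⟩
  · choose r hr using hz
    obtain ⟨x, hx⟩ := D.exists_coef_eq r
    exact ⟨x, D'.coef_injective fun j => by rw [h.coef_map, hx, hr]⟩

/-- The range is saturated: if `ϖ z` comes from `x`, injectivity on coefficients makes the residue
of `x` vanish, so `x` is divisible by the uniformizer already in the source. -/
lemma mem_range_of_unif_pow_mul {z : A'} {n : ℕ} (hg : Function.Injective g)
    (hz : D'.unif ^ n * z ∈ f.range) : z ∈ f.range := by
  induction n generalizing z with
  | zero => simpa using hz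
  | succ n ih =>
    obtain ⟨x, hx⟩ := hz
    obtain ⟨c, rfl⟩ := D.unif_dvd x (hg (by
      rw [← h.res_map, hx, map_zero, pow_succ', mul_assoc, map_mul, D'.res_unif, zero_mul]))
    refine ih ⟨c, D'.unif_mul_cancel ?_⟩
    rw [← h.map_unif, ← map_mul, hx, pow_succ', mul_assoc, h.map_unif]

/-- The range is closed, since the coefficient with index `j` depends only on the class modulo the
power `j + 1` of the uniformizer. -/
lemma mem_range_of_approx {z : A'}
    (hz : ∀ n, ∃ x c, z = f x + D'.unif ^ n * c) : z ∈ f.range := by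
  rw [h.mem_range_iff]
  intro j
  obtain ⟨x, c, rfl⟩ := hz (j + 1)
  refine ⟨D.coef x j, ?_⟩
  rw [← h.coef_map]
  clear hz
  generalize f x = y
  induction j generalizing y with
  | zero => rw [coef_zero, coef_zero, map_add, zero_add, pow_one, map_mul, D'.res_unif]; simp
  | succ j ih =>
    rw [coef_succ, coef_succ, ih]
    congr 1
    symm
    refine (D'.shift_eq (r := D'.res y) ?_).2
    conv_lhs => rw [D'.eq_add_shift y]
    ring

end IsMap

end WittLike

namespace WittLike

/-! ### Witt vectors of perfect rings -/

section Witt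

variable (p : ℕ) [Fact p.Prime]

lemma separated_witt (R : Type*) [CommRing R] [CharP R p] [PerfectRing R p]
    (z : WittVector p R) (hz : ∀ n, (p : WittVector p R) ^ n ∣ z) : z = 0 := by
  refine IsHausdorff.haus (I := Ideal.span {(p : WittVector p R)}) inferInstance z fun n => ?_
  rw [SModEq.zero, smul_eq_mul, Ideal.mul_top, Ideal.span_singleton_pow, Ideal.mem_span_singleton]
  exact hz n

lemma complete_witt (R : Type*) [CommRing R] [CharP R p] [PerfectRing R p]
    (f : ℕ → WittVector p R) : ∃ z, ∀ n, (p : WittVector p R) ^ n ∣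
      z - ∑ j ∈ Finset.range n, (p : WittVector p R) ^ j * f j := by
  obtain ⟨z, hz⟩ := IsPrecomplete.prec (I := Ideal.span {(p : WittVector p R)}) inferInstance
    (f := fun n => ∑ j ∈ Finset.range n, (p : WittVector p R) ^ j * f j) (fun {m n} hmn => by
      rw [SModEq.comm, SModEq.sub_mem, smul_eq_mul, Ideal.mul_top, Ideal.span_singleton_pow,
        Ideal.mem_span_singleton, Finset.sum_range_sub_sum_range hmn]
      refine Finset.dvd_sum fun j hj => Dvd.dvd.mul_right (pow_dvd_pow _ ?_) _
      exact (Finset.mem_filter.mp hj).2)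
  refine ⟨z, fun n => ?_⟩
  have := (hz n).symm
  rwa [SModEq.sub_mem, smul_eq_mul, Ideal.mul_top, Ideal.span_singleton_pow,
        Ideal.mem_span_singleton] at this

/-- The zero ring is a perfect algebra that must be allowed, but its characteristic is `1`; it is
treated separately. -/
lemma subsingleton_or_charP {R : Type*} [CommRing R] (h : (p : R) = 0) :
    Subsingleton (WittVector p R) ∨ CharP R p := by
  rcases subsingleton_or_nontrivial R with h' | h'
  · exact Or.inl ⟨fun x y => WittVector.ext fun n => Subsingleton.elim _ _⟩
  · exact Or.inr ((CharP.charP_iff_prime_eq_zero Fact.out).mpr h)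

/-- The Witt vectors of a perfect ring of characteristic `p`. -/
def witt (R : Type*) [CommRing R] [PerfectRing R p] (h : (p : R) = 0) :
    WittLike (WittVector p R) R where
  unif := p
  res := WittVector.constantCoeff
  tch := WittVector.teichmuller p
  res_tch r := WittVector.teichmuller_coeff_zero p r
  res_unif := by rw [map_natCast, h]
  unif_dvd z hz := by
    rcases subsingleton_or_charP p h with h | h
    · exact ⟨0, Subsingleton.elim _ _⟩
    · exact Ideal.mem_span_singleton.mp ((WittVector.mem_span_p_iff_coeff_zero_eq_zero z).mpr hz)
  unif_cancel z hz := by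
    rcases subsingleton_or_charP p h with h | h
    · exact Subsingleton.elim _ _
    · exact WittVector.eq_zero_of_p_mul_eq_zero z (by rwa [mul_comm])
  separated z hz := by
    rcases subsingleton_or_charP p h with h | h
    · exact Subsingleton.elim _ _
    · exact separated_witt p R z hz
  complete f := by
    rcases subsingleton_or_charP p h with h | h
    · exact ⟨0, fun n => ⟨0, Subsingleton.elim _ _⟩⟩
    · exact complete_witt p R f

end Witt

/-! ### Free totally ramified extensions -/

section Extend

variable {A B R ι : Type*} [CommRing A] [CommRing B] [CommRing R]

/-- Divisibility by `s ^ (e * n)` entails divisibility by `i t ^ n`, which can be read off the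
coordinates. -/
lemma separated_of_free {t : A} (i : A →+* B) (φ : (ι → A) ≃+ B)
    (hφ : ∀ a v, φ (fun j => a * v j) = i a * φ v) {s u : B} {e : ℕ}
    (hs : s ^ e = i t * u) (hsep : ∀ z, (∀ n, t ^ n ∣ z) → z = 0) (z : B) (hz : ∀ n, s ^ n ∣ z) :
    z = 0 := by
  obtain ⟨v, rfl⟩ := φ.surjective z
  rw [map_eq_zero_iff φ φ.injective]
  ext j
  refine hsep _ fun n => ?_
  obtain ⟨c, hc⟩ := hz (e * n)
  rw [pow_mul, hs, mul_pow, mul_assoc] at hc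
  obtain ⟨c', hc'⟩ := φ.surjective (u ^ n * c)
  rw [← hc', ← map_pow, ← hφ] at hc
  exact ⟨c' j, congrFun (φ.injective hc) j⟩

lemma complete_of_free {t : A} (i : A →+* B) (φ : (ι → A) ≃+ B)
    (hφ : ∀ a v, φ (fun j => a * v j) = i a * φ v) {s u : B} {e : ℕ} (he : e ≠ 0)
    (hu : IsUnit u) (hs : s ^ e = i t * u)
    (hcompl : ∀ f : ℕ → A, ∃ z, ∀ n, t ^ n ∣ z - ∑ j ∈ Finset.range n, t ^ j * f j) (f : ℕ → B) :
    ∃ z, ∀ n, s ^ n ∣ z - ∑ j ∈ Finset.range n, s ^ j * f j := by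
  obtain ⟨u, rfl⟩ := hu
  -- Blocks of `e` consecutive terms of the `s`-series become one coefficient of a `t`-series,
  -- because `s ^ (e * q) = i t ^ q * u ^ q`.
  let F : ℕ → B := fun q => ∑ l ∈ Finset.range e, (u : B) ^ q * s ^ l * f (e * q + l)
  choose z hz using fun j => hcompl fun q => φ.symm (F q) j
  have hsum : ∀ n, φ (fun j => ∑ q ∈ Finset.range n, t ^ q * φ.symm (F q) j) =
      ∑ j ∈ Finset.range (e * n), s ^ j * f j := by
    intro n
    induction n with
    | zero => simp; rfl
    | succ n ih =>
      have h1 : (fun j => ∑ q ∈ Finset.range (n + 1), t ^ q * φ.symm (F q) j) =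
          (fun j => ∑ q ∈ Finset.range n, t ^ q * φ.symm (F q) j) +
            fun j => t ^ n * φ.symm (F n) j := by
        ext j
        exact Finset.sum_range_succ _ _
      rw [h1, map_add, ih, hφ, AddEquiv.apply_symm_apply, mul_add_one, Finset.sum_range_add]
      congr 1
      rw [map_pow, Finset.mul_sum]
      refine Finset.sum_congr rfl fun l _ => ?_
      rw [pow_add, pow_mul, hs, mul_pow]
      ring
  refine ⟨φ z, fun n => ?_⟩
  have hle : n ≤ e * n := Nat.le_mul_of_pos_left n (Nat.pos_of_ne_zero he)
  have h2 : s ^ (e * n) ∣ φ z - ∑ j ∈ Finset.range (e * n), s ^ j * f j := by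
    choose c hc using fun j => hz j n
    rw [← hsum, ← map_sub]
    have h3 : z - (fun j => ∑ q ∈ Finset.range n, t ^ q * φ.symm (F q) j) =
        fun j => t ^ n * c j := funext hc
    rw [h3, hφ, pow_mul, hs, mul_pow, map_pow]
    refine Dvd.intro (((u⁻¹ : Bˣ) : B) ^ n * φ c) ?_
    rw [mul_assoc, ← mul_assoc (_ ^ n) (_ ^ n) (φ c), ← mul_pow, Units.mul_inv, one_pow, one_mul]
  have h4 : s ^ n ∣ ∑ j ∈ Finset.range (e * n), s ^ j * f j -
      ∑ j ∈ Finset.range n, s ^ j * f j := by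
    rw [Finset.sum_range_sub_sum_range hle]
    exact Finset.dvd_sum fun j hj =>
      Dvd.dvd.mul_right (pow_dvd_pow _ (Finset.mem_filter.mp hj).2) _
  convert dvd_add ((pow_dvd_pow s hle).trans h2) h4 using 1
  ring

/-- An extension of a ring of Teichmüller expansions that is free of finite rank and totally
ramified, with uniformizer `s`. -/
def extend (D : WittLike A R) (i : A →+* B) (φ : (ι → A) ≃+ B)
    (hφ : ∀ a v, φ (fun j => a * v j) = i a * φ v) (s u : B) (e : ℕ) (he : e ≠ 0) (hu : IsUnit u)
    (hs : s ^ e = i D.unif * u) (res : B →+* R) (hres : ∀ a, res (i a) = D.res a)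
    (hress : res s = 0) (hdec : ∀ b, ∃ a c, b = i a + s * c) : WittLike B R where
  unif := s
  res := res
  tch := i.toMonoidHom.comp D.tch
  res_tch r := (hres _).trans (D.res_tch r)
  res_unif := hress
  unif_dvd b hb := by
    obtain ⟨a, c, rfl⟩ := hdec b
    rw [map_add, map_mul, hress, zero_mul, add_zero, hres] at hb
    obtain ⟨a, rfl⟩ := D.unif_dvd a hb
    obtain ⟨u, rfl⟩ := hu
    have h1 : i D.unif = s * (s ^ (e - 1) * ↑u⁻¹) := by
      rw [← mul_assoc, mul_pow_sub_one he, hs, mul_assoc, Units.mul_inv, mul_one]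
    rw [map_mul, h1, mul_assoc, ← mul_add]
    exact dvd_mul_right _ _
  unif_cancel z hz := by
    obtain ⟨v, rfl⟩ := φ.surjective z
    have h1 : s ^ e * φ v = 0 := by
      rw [← pow_sub_one_mul he, mul_assoc, hz, mul_zero]
    rw [hs, mul_right_comm, hu.mul_left_eq_zero, ← hφ, map_eq_zero_iff φ φ.injective] at h1
    rw [map_eq_zero_iff φ φ.injective]
    ext j
    exact D.unif_cancel _ (congrFun h1 j)
  separated := separated_of_free i φ hφ hs D.separated
  complete := complete_of_free i φ hφ he hu hs D.complete

end Extend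

/-! ### Finite extensions of complete discrete valuation rings -/

section DVR

/-- `B ⧸ J` is artinian, so stabilization of the powers of `b` produces an idempotent there. By
Hensel it lifts to an idempotent of the domain `B`, which is `0` or `1`: in the first case `b` is
nilpotent modulo `J`, in the second it is a unit. -/
lemma isUnit_or_isUnit_one_sub {A B : Type*} [CommRing A] [CommRing B] [IsDomain B] [Algebra A B]
    (I : Ideal A) (hI : I.IsMaximal) [Module.Finite A B]
    [IsAdicComplete (I.map (algebraMap A B)) B] (b : B) : IsUnit b ∨ IsUnit (1 - b) := by
  let J := I.map (algebraMap A B)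
  have hJ : J ≤ Ideal.jacobson ⊥ := IsAdicComplete.le_jacobson_bot J
  have hunit : ∀ x : B, IsUnit (Ideal.Quotient.mk J x) → IsUnit x := by
    intro x hx
    obtain ⟨y, hy⟩ := hx.exists_right_inv
    obtain ⟨y, rfl⟩ := Ideal.Quotient.mk_surjective y
    rw [← map_mul, ← map_one (Ideal.Quotient.mk J), Ideal.Quotient.eq] at hy
    have := (Ideal.mem_jacobson_bot.mp (hJ hy)) 1
    rw [mul_one, sub_add_cancel] at this
    exact isUnit_of_mul_isUnit_left this
  have : HenselianRing B J := inferInstance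
  let _ : Field (A ⧸ I) := Ideal.Quotient.field I
  let _ : Algebra (A ⧸ I) (B ⧸ J) :=
    (Ideal.quotientMap J (algebraMap A B) Ideal.le_comap_map).toAlgebra
  have : IsScalarTower A (A ⧸ I) (B ⧸ J) := IsScalarTower.of_algebraMap_eq fun _ => rfl
  have : Module.Finite A (B ⧸ J) := inferInstance
  have : Module.Finite (A ⧸ I) (B ⧸ J) := Module.Finite.of_restrictScalars_finite A _ _
  have : IsArtinianRing (B ⧸ J) := IsArtinianRing.of_finite (A ⧸ I) (B ⧸ J)
  obtain ⟨n, y, hy⟩ := IsArtinian.exists_pow_succ_smul_dvd (Ideal.Quotient.mk J b) (1 : B ⧸ J)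
  set β := Ideal.Quotient.mk J b with hβ
  rw [smul_eq_mul, smul_eq_mul, mul_one, Nat.succ_eq_add_one] at hy
  have hm : ∀ m, β ^ (n + m) * y ^ m = β ^ n := by
    intro m
    induction m with
    | zero => simp
    | succ m ih =>
      calc β ^ (n + (m + 1)) * y ^ (m + 1) = (β ^ (n + 1) * y) * (β ^ m * y ^ m) := by ring
        _ = β ^ n := by rw [hy, ← mul_assoc, ← pow_add, ih]
  have hidem : (β ^ n * y ^ n) * (β ^ n * y ^ n) = β ^ n * y ^ n := by
    conv_rhs => rw [← hm n]
    ring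
  obtain ⟨a₀, ha₀⟩ := Ideal.Quotient.mk_surjective (β ^ n * y ^ n)
  obtain ⟨a, ha, haa⟩ := HenselianRing.is_henselian (I := J) (X ^ 2 - X : B[X])
    (by monicity!) a₀ (by
      rw [← Ideal.Quotient.eq_zero_iff_mem]
      simp [ha₀, pow_two, hidem]) (by
      -- At an idempotent the derivative `2 a₀ - 1` of `X ^ 2 - X` is its own inverse.
      refine IsUnit.of_mul_eq_one (Ideal.Quotient.mk J
        (Polynomial.eval a₀ (Polynomial.derivative (X ^ 2 - X : B[X])))) ?_
      have h2 : Polynomial.eval a₀ (Polynomial.derivative (X ^ 2 - X : B[X])) = 2 * a₀ - 1 := by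
        simp [one_add_one_eq_two]
      rw [h2, map_sub, map_mul, map_one, map_ofNat, ha₀]
      linear_combination 4 * hidem)
  have ha' : a * (a - 1) = 0 := by
    have : a ^ 2 - a = 0 := by simpa [IsRoot.def] using ha
    rw [← this]
    ring
  rw [← Ideal.Quotient.eq, ha₀] at haa
  rcases mul_eq_zero.mp ha' with h | h
  · right
    apply hunit
    rw [h, map_zero] at haa
    have h0 : β ^ n = 0 := by
      rw [← hm n, pow_add, mul_assoc, ← haa, mul_zero]
    rw [map_sub, map_one]
    exact IsNilpotent.isUnit_one_sub ⟨n, h0⟩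
  · left
    apply hunit
    rw [sub_eq_zero.mp h, map_one] at haa
    refine IsUnit.of_mul_eq_one y ?_
    calc β * y = (β * y) * (β ^ n * y ^ n) := by rw [← haa, mul_one]
      _ = (β ^ (n + 1) * y) * y ^ n := by ring
      _ = 1 := by rw [hy, ← haa]

/-- A finite integrally closed extension of a complete discrete valuation ring with algebraically
closed residue field. -/
theorem exists_of_isDedekindDomain {A k B : Type*} [CommRing A] [Field k] [IsAlgClosed k]
    (D : WittLike A k) [CommRing B] [IsDedekindDomain B] [Algebra A B] [FaithfulSMul A B]
    [Module.Finite A B] :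
    IsDiscreteValuationRing B ∧ ∀ s : B, Irreducible s →
      ∃ D' : WittLike B k, D'.unif = s ∧ (∀ a, D'.res (algebraMap A B a) = D.res a) ∧
        ∀ r, D'.tch r = algebraMap A B (D.tch r) := by
  have := D.isDomain
  have := D.isDiscreteValuationRing
  have : Module.IsTorsionFree A B := Module.isTorsionFree_iff_faithfulSMul.mpr inferInstance
  have : Module.Free A B := inferInstance
  let bs := Module.Free.chooseBasis A B
  let φ : (Module.Free.ChooseBasisIndex A B → A) ≃+ B := bs.equivFun.symm.toAddEquiv
  have hφ : ∀ a v, φ (fun j => a * v j) = algebraMap A B a * φ v := by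
    intro a v
    rw [← Algebra.smul_def]
    exact map_smul bs.equivFun.symm a v
  let t := algebraMap A B D.unif
  have ht : t ≠ 0 := (map_ne_zero_iff _ (FaithfulSMul.algebraMap_injective A B)).mpr D.unif_ne_zero
  have hmax : (Ideal.span {D.unif}).IsMaximal :=
    PrincipalIdealRing.isMaximal_of_irreducible D.irreducible_unif
  have hcompl : IsAdicComplete ((Ideal.span {D.unif}).map (algebraMap A B)) B := by
    rw [Ideal.map_span, Set.image_singleton]
    exact isAdicComplete_of_series
      (separated_of_free (algebraMap A B) φ hφ (e := 1) (u := 1) (by simp) D.separated)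
      (complete_of_free (algebraMap A B) φ hφ one_ne_zero isUnit_one (by simp) D.complete)
  have : IsLocalRing B := IsLocalRing.of_isUnit_or_isUnit_one_sub_self
    (isUnit_or_isUnit_one_sub (A := A) _ hmax)
  have htu : ¬ IsUnit t := by
    intro h
    have h1 : IsUnit D.unif := by
      have : Algebra.IsIntegral A B := inferInstance
      exact isUnit_of_map_unit (algebraMap A B) _ h
    exact D.irreducible_unif.not_isUnit h1
  have hnf : ¬ IsField B := fun hF => htu (by
    let _ := hF.toField
    exact isUnit_iff_ne_zero.mpr ht)
  have hB : IsDiscreteValuationRing B :=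
    ((IsDiscreteValuationRing.TFAE B hnf).out 0 2 :
      IsDiscreteValuationRing B ↔ IsDedekindDomain B).mpr inferInstance
  refine ⟨hB, fun s hs => ?_⟩
  obtain ⟨e, u, hu⟩ := IsDiscreteValuationRing.associated_pow_irreducible ht hs
  have he : e ≠ 0 := by
    rintro rfl
    rw [pow_zero] at hu
    exact htu (IsUnit.of_mul_eq_one _ hu)
  let κ := IsLocalRing.ResidueField B
  have hker : ∀ a, D.res a = 0 → algebraMap A κ a = 0 := by
    intro a ha
    obtain ⟨c, rfl⟩ := D.unif_dvd a ha
    rw [map_mul, IsScalarTower.algebraMap_apply A B κ D.unif]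
    have : algebraMap B κ t = 0 := (IsLocalRing.residue_eq_zero_iff t).mpr htu
    rw [this, zero_mul]
  -- The residue field of `B` is integral over that of `A`, because `B` is finite over `A`. As `k`
  -- is algebraically closed the two coincide, so there is no residual extension.
  let ψ : k →+* κ := RingHom.liftOfRightInverse D.res D.tch D.res_tch ⟨algebraMap A κ, fun a ha => hker a ha⟩
  have hψ : ∀ a, ψ (D.res a) = algebraMap A κ a := fun a =>
    RingHom.liftOfRightInverse_comp_apply _ _ _ _ a
  let _ : Algebra k κ := ψ.toAlgebra
  have hint : Algebra.IsIntegral k κ := by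
    let _ : Algebra A k := D.res.toAlgebra
    have : IsScalarTower A k κ := IsScalarTower.of_algebraMap_eq fun a => (hψ a).symm
    have : Algebra.IsIntegral A κ := Algebra.IsIntegral.trans B
    exact Algebra.IsIntegral.tower_top A
  have hbij : Function.Bijective ψ := IsAlgClosed.algebraMap_bijective_of_isIntegral
  let E := RingEquiv.ofBijective ψ hbij
  let res : B →+* k := E.symm.toRingHom.comp (IsLocalRing.residue B)
  have hres : ∀ a, res (algebraMap A B a) = D.res a := by
    intro a
    apply E.injective
    exact (E.apply_symm_apply _).trans (hψ a).symm
  have hres0 : ∀ b, res b = 0 ↔ s ∣ b := by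
    intro b
    rw [← Ideal.mem_span_singleton, ← hs.maximalIdeal_eq, ← IsLocalRing.residue_eq_zero_iff]
    exact map_eq_zero_iff E.symm.toRingHom E.symm.injective
  refine ⟨D.extend (algebraMap A B) φ hφ s u e he u.isUnit hu.symm res hres
    ((hres0 s).mpr dvd_rfl) fun b => ?_, rfl, hres, fun r => rfl⟩
  obtain ⟨c, hc⟩ := (hres0 (b - algebraMap A B (D.tch (res b)))).mp (by
    rw [map_sub, hres, D.res_tch, sub_self])
  exact ⟨_, c, by rw [← hc]; ring⟩

end DVR

end WittLike

/-! ### Ramified Witt vectors as Teichmüller expansions -/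

section Ramified

variable (p : ℕ) [Fact p.Prime] {κ : Type u} [Field κ] [CharP κ p] [PerfectRing κ p]

lemma PerfAlg.natCast_eq_zero (R : PerfAlg p κ) : (p : R) = 0 := by
  rw [← map_natCast (algebraMap κ R), CharP.cast_eq_zero, map_zero]

/-- The Witt vectors of a perfect `κ`-algebra. -/
def wittLike (R : PerfAlg p κ) : WittLike (WittVector p R) R :=
  WittLike.witt p R (PerfAlg.natCast_eq_zero p R)

/-- Data that exhibit `O` as a finite totally ramified extension of `W(κ)`. -/
structure Ramified (O : Type v) [CommRing O] [Algebra (WittVector p κ) O] where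
  series : WittLike O κ
  res_algebraMap : ∀ a, series.res (algebraMap (WittVector p κ) O a) = a.coeff 0
  index : ℕ
  index_ne_zero : index ≠ 0
  unit : Oˣ
  pow_index : series.unif ^ index = p * unit
  free : Module.Free (WittVector p κ) O
  finite : Module.Finite (WittVector p κ) O

variable {p} {O : Type v} [CommRing O] [Algebra (WittVector p κ) O] (E : Ramified (κ := κ) p O)

namespace Ramified

/-- The residue map `O ⊗ W(R) → R`. -/
def oWittRes (R : PerfAlg p κ) : OWitt p O R →+* R :=
  letI : Algebra (WittVector p κ) R :=
    ((algebraMap κ R).comp WittVector.constantCoeff).toAlgebra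
  (Algebra.TensorProduct.lift
    { (algebraMap κ R).comp E.series.res with
      commutes' := fun a => congrArg (algebraMap κ R) (E.res_algebraMap a) :
      O →ₐ[WittVector p κ] R }
    { (WittVector.constantCoeff : WittVector p R →+* R) with
      commutes' := fun a => WittVector.map_coeff (algebraMap κ R) a 0 :
      WittVector p R →ₐ[WittVector p κ] R }
    (fun _ _ => Commute.all _ _)).toRingHom

lemma oWittRes_tmul (R : PerfAlg p κ) (o : O) (z : WittVector p R) :
    E.oWittRes R (o ⊗ₜ z) = algebraMap κ R (E.series.res o) * z.coeff 0 := rfl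

lemma exists_eq_add (o : O) : ∃ a o', o = algebraMap (WittVector p κ) O a + E.series.unif * o' := by
  obtain ⟨o', h⟩ := E.series.unif_dvd (o - algebraMap _ O (WittVector.teichmuller p (E.series.res o)))
    (by rw [map_sub, E.res_algebraMap, WittVector.teichmuller_coeff_zero, sub_self])
  exact ⟨_, o', by rw [← h]; ring⟩

include E in
lemma exists_oWitt_equiv (R : PerfAlg p κ) :
    ∃ (n : ℕ) (φ : (Fin n → WittVector p R) ≃+ OWitt p O R), ∀ a v, φ (fun j => a * v j) =
        (Algebra.TensorProduct.includeRight : WittVector p R →ₐ[WittVector p κ] OWitt p O R) a *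
          φ v := by
  have := E.free
  have := E.finite
  let bs := Algebra.TensorProduct.basis (WittVector p R)
    (Module.finBasis (WittVector p κ) O)
  let c := Algebra.TensorProduct.comm (WittVector p κ) (WittVector p R) O
  refine ⟨_, bs.equivFun.symm.toAddEquiv.trans c.toAddEquiv, fun a v => ?_⟩
  have h1 : bs.equivFun.symm (fun j => a * v j) = a • bs.equivFun.symm v :=
    map_smul bs.equivFun.symm a v
  change c (bs.equivFun.symm (fun j => a * v j)) = _ * c (bs.equivFun.symm v)
  rw [h1, Algebra.smul_def, map_mul]
  rfl

/-- `O`-Witt vectors as Teichmüller expansions. -/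
def oWitt (R : PerfAlg p κ) : WittLike (OWitt p O R) R :=
  (wittLike p R).extend (Algebra.TensorProduct.includeRight :
      WittVector p R →ₐ[WittVector p κ] OWitt p O R).toRingHom
    (E.exists_oWitt_equiv R).choose_spec.choose (E.exists_oWitt_equiv R).choose_spec.choose_spec
    (E.series.unif ⊗ₜ 1) ((E.unit : O) ⊗ₜ 1) E.index E.index_ne_zero
    (E.unit.isUnit.map (Algebra.TensorProduct.includeLeft : O →ₐ[O] OWitt p O R))
    (by
      have h := congrArg (Algebra.TensorProduct.includeLeft : O →ₐ[O] OWitt p O R) E.pow_index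
      rw [map_pow, map_mul, map_natCast] at h
      refine h.trans ?_
      change _ = Algebra.TensorProduct.includeRight ((p : ℕ) : WittVector p R) * _
      rw [map_natCast]
      rfl)
    (E.oWittRes R)
    (fun a => by
      change E.oWittRes R (1 ⊗ₜ a) = a.coeff 0
      rw [oWittRes_tmul, map_one, map_one, one_mul])
    (by rw [oWittRes_tmul, E.series.res_unif, map_zero, zero_mul])
    (fun b => by
      induction b using TensorProduct.induction_on with
      | zero => exact ⟨0, 0, by simp⟩
      | tmul o z =>
        obtain ⟨a, o', rfl⟩ := E.exists_eq_add o
        refine ⟨algebraMap _ _ a * z, o' ⊗ₜ z, ?_⟩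
        rw [add_tmul, Algebra.TensorProduct.tmul_mul_tmul, one_mul]
        congr 1
        rw [Algebra.algebraMap_eq_smul_one, smul_tmul, ← Algebra.smul_def]
        rfl
      | add x y hx hy =>
        obtain ⟨a, c, rfl⟩ := hx
        obtain ⟨a', c', rfl⟩ := hy
        exact ⟨a + a', c + c', by rw [map_add]; ring⟩)

lemma oWitt_unif (R : PerfAlg p κ) :
    (E.oWitt R).unif = algebraMap O (OWitt p O R) E.series.unif := rfl

lemma oWitt_res_algebraMap (R : PerfAlg p κ) (o : O) :
    (E.oWitt R).res (algebraMap O (OWitt p O R) o) = algebraMap κ R (E.series.res o) := by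
  change E.oWittRes R (o ⊗ₜ 1) = _
  rw [oWittRes_tmul, WittVector.one_coeff_zero, mul_one]

lemma isMap_oWitt {R S : PerfAlg p κ} (φ : R ⟶ S) :
    (E.oWitt R).IsMap (E.oWitt S) (oWittMap p O φ).toRingHom (PerfAlg.toAlgHom φ).toRingHom where
  map_unif := (oWittMap p O φ).commutes _
  res_map z := by
    induction z using TensorProduct.induction_on with
    | zero => simp
    | tmul o z =>
      change E.oWittRes S (o ⊗ₜ wittMap p φ z) = PerfAlg.toAlgHom φ (E.oWittRes R (o ⊗ₜ z))
      rw [oWittRes_tmul, oWittRes_tmul, map_mul, AlgHom.commutes]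
      rfl
    | add x y hx hy => rw [map_add, map_add, hx, hy, map_add, map_add]
  map_tch r := by
    change (1 : O) ⊗ₜ[WittVector p κ] wittMap p φ (WittVector.teichmuller p r) = _
    have : wittMap p φ (WittVector.teichmuller p r) =
      WittVector.teichmuller p (PerfAlg.toAlgHom φ r) := WittVector.map_teichmuller p _ r
    rw [this]
    rfl

variable {a : ℕ} (ha : a ≠ 0)

include ha in
lemma res_pow_sub_eq_zero (R : PerfAlg p κ) :
    (X ^ a - C E.series.unif : O[X]).eval₂ ((algebraMap κ R).comp E.series.res) 0 = 0 := by
  simp [ha, E.series.res_unif]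

/-- The residue map `W_O(R) ⊗ O' → R`. -/
def oWittExtRes (R : PerfAlg p κ) : OWittExt p E.series.unif a R →+* R :=
  letI : Algebra O R := ((algebraMap κ R).comp E.series.res).toAlgebra
  (Algebra.TensorProduct.lift
    { (E.oWitt R).res with commutes' := fun o => E.oWitt_res_algebraMap R o :
      OWitt p O R →ₐ[O] R }
    { AdjoinRoot.lift ((algebraMap κ R).comp E.series.res) 0 (E.res_pow_sub_eq_zero ha R) with
      commutes' := fun _ => AdjoinRoot.lift_of (E.res_pow_sub_eq_zero ha R) :
      RootExt E.series.unif a →ₐ[O] R }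
    (fun _ _ => Commute.all _ _)).toRingHom

lemma oWittExtRes_incl (R : PerfAlg p κ) (z : OWitt p O R) :
    E.oWittExtRes ha R (oWittIncl p E.series.unif a R z) = (E.oWitt R).res z := by
  exact (congrArg ((E.oWitt R).res z * ·) (map_one (AdjoinRoot.lift
    ((algebraMap κ R).comp E.series.res) 0 (E.res_pow_sub_eq_zero ha R)))).trans (mul_one _)

lemma oWittExtRes_root (R : PerfAlg p κ) :
    E.oWittExtRes ha R (1 ⊗ₜ AdjoinRoot.root (X ^ a - C E.series.unif)) = 0 := by
  have := AdjoinRoot.lift_root (E.res_pow_sub_eq_zero ha R)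
  exact (congrArg ((E.oWitt R).res 1 * ·) this).trans (mul_zero _)

lemma root_pow_eq (R : PerfAlg p κ) :
    ((1 ⊗ₜ AdjoinRoot.root (X ^ a - C E.series.unif)) : OWittExt p E.series.unif a R) ^ a =
      oWittIncl p E.series.unif a R (E.oWitt R).unif := by
  rw [Algebra.TensorProduct.tmul_pow, one_pow]
  have h : AdjoinRoot.root (X ^ a - C E.series.unif) ^ a =
      algebraMap O (RootExt E.series.unif a) E.series.unif := by
    have := AdjoinRoot.eval₂_root (X ^ a - C E.series.unif)
    rw [eval₂_sub, eval₂_pow, eval₂_X, eval₂_C, sub_eq_zero] at this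
    exact this
  rw [h, ← Algebra.TensorProduct.algebraMap_apply', E.oWitt_unif, AlgHom.commutes]

lemma exists_oWittExt_equiv (R : PerfAlg p κ) :
    ∃ φ : (Fin (AdjoinRoot.powerBasis' (monic_X_pow_sub_C E.series.unif ha)).dim → OWitt p O R) ≃+
        OWittExt p E.series.unif a R,
      ∀ z v, φ (fun j => z * v j) = oWittIncl p E.series.unif a R z * φ v := by
  let bs := Algebra.TensorProduct.basis (OWitt p O R)
    (AdjoinRoot.powerBasis' (monic_X_pow_sub_C E.series.unif ha)).basis
  refine ⟨bs.equivFun.symm.toAddEquiv, fun z v => ?_⟩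
  have h1 : bs.equivFun.symm (fun j => z * v j) = z • bs.equivFun.symm v :=
    map_smul bs.equivFun.symm z v
  change bs.equivFun.symm (fun j => z * v j) = _ * bs.equivFun.symm v
  rw [h1, Algebra.smul_def]
  rfl

/-- The ring `W_O(R) ⊗ O'` as a ring of Teichmüller expansions. -/
def oWittExt (R : PerfAlg p κ) : WittLike (OWittExt p E.series.unif a R) R :=
  (E.oWitt R).extend (oWittIncl p E.series.unif a R).toRingHom
    (E.exists_oWittExt_equiv ha R).choose (E.exists_oWittExt_equiv ha R).choose_spec
    (1 ⊗ₜ AdjoinRoot.root (X ^ a - C E.series.unif)) 1 a ha isUnit_one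
    (by rw [mul_one]; exact E.root_pow_eq R) (E.oWittExtRes ha R) (E.oWittExtRes_incl ha R)
    (E.oWittExtRes_root ha R)
    (fun b => by
      induction b using TensorProduct.induction_on with
      | zero => exact ⟨0, 0, by simp⟩
      | tmul z g =>
        obtain ⟨f, rfl⟩ := AdjoinRoot.mk_surjective g
        -- Only the constant coefficient of `f` survives modulo the root; the rest is `X` times
        -- `divX`.
        refine ⟨f.coeff 0 • z, z ⊗ₜ AdjoinRoot.mk _ f.divX, ?_⟩
        rw [Algebra.TensorProduct.tmul_mul_tmul, one_mul, ← AdjoinRoot.mk_X, ← map_mul]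
        conv_lhs => rw [← Polynomial.divX_mul_X_add f, mul_comm, map_add, tmul_add, add_comm]
        congr 1
        rw [AdjoinRoot.mk_C, ← AdjoinRoot.algebraMap_eq, Algebra.algebraMap_eq_smul_one,
          ← smul_tmul]
        rfl
      | add x y hx hy =>
        obtain ⟨a, c, rfl⟩ := hx
        obtain ⟨a', c', rfl⟩ := hy
        exact ⟨a + a', c + c', by rw [map_add]; ring⟩)

lemma oWittExt_tch (R : PerfAlg p κ) (r : R) :
    (E.oWittExt ha R).tch r = oWittIncl p E.series.unif a R ((E.oWitt R).tch r) := rfl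

lemma oWittExt_unif_pow (R : PerfAlg p κ) :
    (E.oWittExt ha R).unif ^ a = oWittIncl p E.series.unif a R (E.oWitt R).unif :=
  E.root_pow_eq R

lemma oWittExt_res_incl (R : PerfAlg p κ) (z : OWitt p O R) :
    (E.oWittExt ha R).res (oWittIncl p E.series.unif a R z) = (E.oWitt R).res z :=
  E.oWittExtRes_incl ha R z

lemma oWittExtMap_incl_apply {R S : PerfAlg p κ} (φ : R ⟶ S) (z : OWitt p O R) :
    oWittExtMap p E.series.unif a φ (oWittIncl p E.series.unif a R z) =
      oWittIncl p E.series.unif a S (oWittMap p O φ z) :=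
  DFunLike.congr_fun (oWittExtMap_incl p E.series.unif a φ) z

lemma isMap_oWittExt {R S : PerfAlg p κ} (φ : R ⟶ S) :
    (E.oWittExt ha R).IsMap (E.oWittExt ha S) (oWittExtMap p E.series.unif a φ).toRingHom
      (PerfAlg.toAlgHom φ).toRingHom where
  map_unif := congrArg (· ⊗ₜ[O] AdjoinRoot.root (X ^ a - C E.series.unif))
    (map_one (oWittMap p O φ))
  res_map z := by
    obtain ⟨y, c, rfl⟩ : ∃ y c, z = oWittIncl p E.series.unif a R y +
        (E.oWittExt ha R).unif * c := by
      obtain ⟨c, hc⟩ := (E.oWittExt ha R).exists_shift z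
      exact ⟨_, c, hc⟩
    have h1 : oWittExtMap p E.series.unif a φ (E.oWittExt ha R).unif = (E.oWittExt ha S).unif :=
      congrArg (· ⊗ₜ[O] AdjoinRoot.root (X ^ a - C E.series.unif)) (map_one (oWittMap p O φ))
    change (E.oWittExt ha S).res (oWittExtMap p E.series.unif a φ _) = _
    rw [map_add, map_mul, h1, oWittExtMap_incl_apply, map_add, map_mul, map_add, map_mul,
      WittLike.res_unif, WittLike.res_unif, zero_mul, zero_mul, add_zero, add_zero,
      oWittExt_res_incl, oWittExt_res_incl]
    exact (E.isMap_oWitt φ).res_map y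
  map_tch r := by
    rw [oWittExt_tch, oWittExt_tch]
    refine (E.oWittExtMap_incl_apply φ _).trans ?_
    congr 1
    exact (E.isMap_oWitt φ).map_tch r

end Ramified

end Ramified

/-! ### The ring of integers as a totally ramified extension -/

section Existence

/-- A positive characteristic of the domain would be a prime that vanishes in `k`, hence `p` itself,
which is excluded. -/
lemma charZero_of_ringHom (p : ℕ) [Fact p.Prime] {A k : Type*} [CommRing A] [IsDomain A] [Field k]
    [CharP k p] (f : A →+* k) (hp : (p : A) ≠ 0) : CharZero A := by
  obtain ⟨q, hq⟩ := CharP.exists A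
  have hq0 : (q : k) = 0 := by rw [← map_natCast f, CharP.cast_eq_zero, map_zero]
  have hpq := (CharP.cast_eq_zero_iff k p q).mp hq0
  rcases CharP.char_is_prime_or_zero A q with h | rfl
  · rw [← (Nat.prime_dvd_prime_iff_eq Fact.out h).mp hpq, ] at hq
    exact absurd (CharP.cast_eq_zero A p) hp
  · exact CharP.charP_to_charZero A

variable {p : ℕ} [Fact p.Prime] {κ : Type u} [Field κ] [IsAlgClosed κ] [CharP κ p]
    {K : Type*} [Field K] [Algebra (WittVector p κ) K] [Algebra (FractionRing (WittVector p κ)) K]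
    [IsScalarTower (WittVector p κ) (FractionRing (WittVector p κ)) K]
    [FiniteDimensional (FractionRing (WittVector p κ)) K]
    {O : Type v} [CommRing O] [Algebra (WittVector p κ) O] [Algebra O K]
    [IsScalarTower (WittVector p κ) O K] [IsIntegralClosure O (WittVector p κ) K]

omit [IsAlgClosed κ] in
instance charZero_wittVector : CharZero (WittVector p κ) :=
  charZero_of_ringHom p WittVector.constantCoeff (WittVector.irreducible p).ne_zero

include K in
/-- The ring of integers of a finite extension of the fraction field of `W(κ)` is a finite totally
ramified extension of `W(κ)`. -/
theorem exists_ramified (ϖ : O) (hϖ : Irreducible ϖ) :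
    ∃ E : Ramified (κ := κ) p O, E.series.unif = ϖ := by
  have hinj := IsIntegralClosure.algebraMap_injective O (WittVector p κ) K
  have : IsDomain O := hinj.isDomain
  have : IsDedekindDomain O :=
    IsIntegralClosure.isDedekindDomain (WittVector p κ) (FractionRing (WittVector p κ)) K O
  have : Module.Finite (WittVector p κ) O :=
    IsIntegralClosure.finite (WittVector p κ) (FractionRing (WittVector p κ)) K O
  have hinj' : Function.Injective (algebraMap (WittVector p κ) O) := by
    have : Function.Injective (algebraMap (WittVector p κ) K) := by
      rw [IsScalarTower.algebraMap_eq (WittVector p κ) (FractionRing (WittVector p κ)) K]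
      exact (algebraMap (FractionRing (WittVector p κ)) K).injective.comp
        (IsFractionRing.injective _ _)
    rw [IsScalarTower.algebraMap_eq (WittVector p κ) O K] at this
    exact Function.Injective.of_comp this
  have : FaithfulSMul (WittVector p κ) O := (faithfulSMul_iff_algebraMap_injective _ _).mpr hinj'
  have : Module.IsTorsionFree (WittVector p κ) O :=
    Module.isTorsionFree_iff_faithfulSMul.mpr inferInstance
  obtain ⟨hdvr, h⟩ := (WittLike.witt p κ (CharP.cast_eq_zero κ p)).exists_of_isDedekindDomain
    (B := O)
  obtain ⟨D, rfl, hres, -⟩ := h ϖ hϖ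
  have hp0 : (p : O) ≠ 0 := by
    rw [← map_natCast (algebraMap (WittVector p κ) O), map_ne_zero_iff _ hinj']
    exact Nat.cast_ne_zero.mpr (Fact.out : p.Prime).ne_zero
  obtain ⟨e, u, hu⟩ := IsDiscreteValuationRing.associated_pow_irreducible hp0 hϖ
  refine ⟨⟨D, hres, e, ?_, u, hu.symm, inferInstance, inferInstance⟩, rfl⟩
  rintro rfl
  rw [pow_zero] at hu
  have := congrArg D.res hu
  rw [map_mul, map_natCast, CharP.cast_eq_zero, zero_mul, map_one] at this
  exact zero_ne_one this

end Existence

/-! ### Points over valuation rings -/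

namespace WittLike

/-- `[0]` is idempotent and divisible by the uniformizer, hence divisible by all its powers. -/
lemma tch_zero {A R : Type*} [CommRing A] [CommRing R] (D : WittLike A R) : D.tch 0 = 0 := by
  refine D.separated _ fun n => ?_
  have h1 : D.tch 0 * D.tch 0 = D.tch 0 := by rw [← map_mul, mul_zero]
  have h2 : D.unif ∣ D.tch 0 := D.unif_dvd _ (D.res_tch 0)
  induction n with
  | zero => simp
  | succ n ih =>
    rw [pow_succ, ← h1]
    exact mul_dvd_mul ih h2

end WittLike

/-- Normalize by a coordinate of maximal valuation. -/
lemma exists_div_mem_range {V L : Type*} [CommRing V] [IsDomain V] [ValuationRing V] [Field L]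
    [Algebra V L] [IsFractionRing V L] {ι : Type*} [Finite ι] (l : ι → L) (hl : l ≠ 0) :
    ∃ b, l b ≠ 0 ∧ ∀ a, ∃ v : V, algebraMap V L v = l a / l b := by
  have := Fintype.ofFinite ι
  obtain ⟨c, hc⟩ := Function.ne_iff.mp hl
  obtain ⟨b, -, hb⟩ := Finset.exists_max_image Finset.univ
    (fun a => ValuationRing.valuation V L (l a)) ⟨c, Finset.mem_univ c⟩
  have hb0 : l b ≠ 0 := by
    intro h0
    have := hb c (Finset.mem_univ c)
    rw [h0, map_zero, le_zero_iff, map_eq_zero] at this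
    exact hc this
  refine ⟨b, hb0, fun a => (ValuationRing.mem_integer_iff V L _).mp ?_⟩
  rw [Valuation.mem_integer_iff, map_div₀]
  exact div_le_one_of_le₀ (hb a (Finset.mem_univ a)) zero_le

section Valuation

variable {T W : Type*} [CommRing T] [Group W] [Fintype W] [MulSemiringAction W T]
  {A' L A V Ak k : Type*} [CommRing A'] [CommRing A] [CommRing Ak] [Field L] [CommRing V]
  [IsDomain V] [ValuationRing V] [Algebra V L] [IsFractionRing V L] [Field k]
  {D' : WittLike A' L} {D : WittLike A V} {Dk : WittLike Ak k}
  {i : A →+* A'} (hi : D.IsMap D' i (algebraMap V L)) {j : A →+* Ak} {ρ : V →+* k}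
  (hj : D.IsMap Dk j ρ) (hρ : Function.Surjective ρ) (hρ' : ∀ v, ρ v = 0 ↔ ¬ IsUnit v)
  (x : T →+* A') (xk : T →+* Ak)
  (hx : ∀ f : T, (∀ g : W, g • f = f) → ∃ z, i z = x f ∧ j z = xk f)
  {r : ℕ} {xs ys : Fin r → T} {δ : T} (hδ : ∑ l, xs l * ys l = δ)
  (hδ' : ∀ g : W, g ≠ 1 → ∑ l, xs l * g • ys l = 0) (hinv : ∀ g : W, g • δ = δ)
  {N : ℕ} {u : A} (hu : IsUnit u) (hxδ : x δ = D'.unif ^ N * i u) (hxk : xk δ ≠ 0)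

include hδ hδ' hinv in
-- Orthogonality of the translates: pulling out `g` reduces it to the Galois relation for `g⁻¹ * w`.
lemma sum_smul_mul_smul [DecidableEq W] (g w : W) :
    ∑ l, w • ys l * g • xs l = if w = g then δ else 0 := by
  have h : ∑ l, w • ys l * g • xs l = g • ∑ l, xs l * (g⁻¹ * w) • ys l := by
    rw [Finset.smul_sum]
    refine Finset.sum_congr rfl fun l _ => ?_
    rw [smul_mul', ← mul_smul, mul_inv_cancel_left, mul_comm]
  rw [h]
  split_ifs with hw
  · subst hw
    simp only [inv_mul_cancel, one_smul]
    rw [hδ, hinv]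
  · rw [hδ' _ (fun h => hw (by rw [← mul_inv_cancel_left g w, h, mul_one])), smul_zero]

variable (W i) in
/-- The functions `c` on `W` that are integral with respect to the trace pairing with the
translates of `x`. -/
def IntegralFun (x : T →+* A') (c : W → A') : Prop :=
  ∀ f : T, ∑ w, c w * x (w • f) ∈ i.range

namespace IntegralFun

variable {x}

lemma add {c c' : W → A'} (h : IntegralFun W i x c) (h' : IntegralFun W i x c') :
    IntegralFun W i x (c + c') := fun f => by
  simp only [Pi.add_apply, add_mul, Finset.sum_add_distrib]
  exact add_mem (h f) (h' f)

lemma smul {c : W → A'} (h : IntegralFun W i x c) {z : A'} (hz : z ∈ i.range) :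
    IntegralFun W i x (z • c) := fun f => by
  simp only [Pi.smul_apply, smul_eq_mul, mul_assoc, ← Finset.mul_sum]
  exact mul_mem hz (h f)

lemma zero : IntegralFun W i x 0 := fun f => by simp

lemma sub {c c' : W → A'} (h : IntegralFun W i x c) (h' : IntegralFun W i x c') :
    IntegralFun W i x (c - c') := fun f => by
  simp only [Pi.sub_apply, sub_mul, Finset.sum_sub_distrib]
  exact sub_mem (h f) (h' f)

lemma sum {ι : Type*} (s : Finset ι) {c : ι → W → A'} (h : ∀ a ∈ s, IntegralFun W i x (c a)) :
    IntegralFun W i x (∑ a ∈ s, c a) := by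
  classical
  induction s using Finset.induction_on with
  | empty => simpa using zero
  | insert a s ha ih =>
    rw [Finset.sum_insert ha]
    exact (h a (Finset.mem_insert_self a s)).add
      (ih fun b hb => h b (Finset.mem_insert_of_mem hb))

include hi in
lemma of_unif_smul {c : W → A'} (h : IntegralFun W i x (D'.unif • c)) : IntegralFun W i x c := by
  intro f
  refine hi.mem_range_of_unif_pow_mul (n := 1) (IsFractionRing.injective V L) ?_
  rw [pow_one, Finset.mul_sum]
  convert h f using 2 with w
  simp [mul_assoc]

include hx in
-- The pairing is the trace of `f * f'`, an invariant, on which `x` is integral by hypothesis.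
lemma apply (f : T) : IntegralFun W i x fun w => x (w • f) := by
  intro f'
  obtain ⟨z, hz, -⟩ := hx (∑ w : W, w • (f * f')) (fun g => by
    rw [Finset.smul_sum]
    simp only [← mul_smul]
    exact Fintype.sum_equiv (Equiv.mulLeft g) _ _ fun _ => rfl)
  refine ⟨z, hz.trans ?_⟩
  rw [map_sum]
  exact Finset.sum_congr rfl fun w _ => by rw [smul_mul', map_mul]

include hδ hδ' hinv in
-- Inversion formula: the traces of `c` against the `ys l` determine `c`, up to the factor `x δ`.
lemma _root_.WittArc.sum_trace_mul (c : W → A') (g : W) :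
    ∑ l, (∑ w, c w * x (w • ys l)) * x (g • xs l) = x δ * c g := by
  classical
  simp only [Finset.sum_mul]
  rw [Finset.sum_comm]
  have h : ∀ w, ∑ l, c w * x (w • ys l) * x (g • xs l) = c w * x (if w = g then δ else 0) := by
    intro w
    rw [← sum_smul_mul_smul hδ hδ' hinv g w, map_sum, Finset.mul_sum]
    exact Finset.sum_congr rfl fun l _ => by rw [map_mul, mul_assoc]
  simp only [h]
  rw [Finset.sum_eq_single g (fun w _ hw => by simp [hw]) (by simp), if_pos rfl, mul_comm]

include hi hδ hδ' hinv hu hxδ in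
-- By the inversion formula `x δ` times the trace of `c * c' * f` is a sum of products of integral
-- traces. Since `x δ` is a power of the uniformizer times a unit, saturation of the range removes
-- it. This is where the fixed valuation of the discriminant is used.
lemma mul {c c' : W → A'} (h : IntegralFun W i x c) (h' : IntegralFun W i x c') :
    IntegralFun W i x (c * c') := by
  intro f
  have h1 : x δ * ∑ w, (c * c') w * x (w • f) =
      ∑ l, (∑ w, c' w * x (w • ys l)) * ∑ w, c w * x (w • (xs l * f)) := by
    have h2 : ∀ l, (∑ w, c' w * x (w • ys l)) * ∑ w, c w * x (w • (xs l * f)) =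
        ∑ w, (c w * x (w • f)) * ((∑ w, c' w * x (w • ys l)) * x (w • xs l)) := by
      intro l
      rw [Finset.mul_sum]
      refine Finset.sum_congr rfl fun w _ => ?_
      rw [smul_mul', map_mul]
      ring
    simp only [h2]
    rw [Finset.sum_comm, Finset.mul_sum]
    refine Finset.sum_congr rfl fun w _ => ?_
    rw [← Finset.mul_sum, sum_trace_mul hδ hδ' hinv c' w, Pi.mul_apply]
    ring
  have h3 : x δ * ∑ w, (c * c') w * x (w • f) ∈ i.range := by
    rw [h1]
    exact sum_mem fun l _ => mul_mem (h' _) (h _)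
  rw [hxδ, mul_assoc] at h3
  have h4 := hi.mem_range_of_unif_pow_mul (IsFractionRing.injective V L) h3
  obtain ⟨v, hv⟩ := hu.exists_left_inv
  have h5 := mul_mem (i.mem_range_self v) h4
  rwa [← mul_assoc, ← map_mul, hv, map_one, one_mul] at h5

end IntegralFun

open IntegralFun

include hi hx hj hρ hδ hδ' hinv hxk in
-- Integral functions specialize to `k` through their traces against the `ys l`. The specializations
-- form a submodule of a free module over the discrete valuation ring `Ak`, hence have a basis, and
-- the `n a` are lifts of it. The last clause carries the independence of that basis back to a
-- statement about residues over `L`.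
lemma exists_specialization_basis :
    ∃ (s : ℕ) (n : Fin s → W → A'), Fintype.card W ≤ s ∧ (∀ a, IntegralFun W i x (n a)) ∧
      ∀ (v : Fin s → V) (m : V) (c : W → A'), ρ m = 0 → IntegralFun W i x c →
        (∀ w, ∑ a, algebraMap V L (v a) * D'.res (n a w) = algebraMap V L m * D'.res (c w)) →
          ∀ a, ρ (v a) = 0 := by
  classical
  have := Dk.isDomain
  have := Dk.isDiscreteValuationRing
  have hj' : Function.Surjective j := fun z => by
    have : z ∈ j.range := hj.mem_range_iff.mpr fun q => hρ _
    exact this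
  let Spec : (W → A') → (Fin r → Ak) → Prop := fun c v =>
    ∀ l, ∃ z, i z = ∑ w, c w * x (w • ys l) ∧ j z = v l
  have hSpec : ∀ c, IntegralFun W i x c → ∃ v, Spec c v := by
    intro c hc
    choose z hz using fun l => hc (ys l)
    exact ⟨fun l => j (z l), fun l => ⟨z l, hz l, rfl⟩⟩
  have hinj : Function.Injective i := hi.injective (IsFractionRing.injective V L)
  have hSpecU : ∀ c v v', Spec c v → Spec c v' → v = v' := by
    intro c v v' h h'
    ext l
    obtain ⟨z, hz, hzv⟩ := h l
    obtain ⟨z', hz', hzv'⟩ := h' l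
    rw [← hzv, ← hzv', hinj (hz.trans hz'.symm)]
  have hSadd : ∀ c c' v v', Spec c v → Spec c' v' → Spec (c + c') (v + v') := by
    intro c c' v v' h h' l
    obtain ⟨z, hz, hzv⟩ := h l
    obtain ⟨z', hz', hzv'⟩ := h' l
    refine ⟨z + z', ?_, by rw [map_add, hzv, hzv']; rfl⟩
    simp only [map_add, hz, hz', Pi.add_apply, add_mul, Finset.sum_add_distrib]
  have hSsmul : ∀ c v b, Spec c v → Spec (i b • c) (j b • v) := by
    intro c v b h l
    obtain ⟨z, hz, hzv⟩ := h l
    refine ⟨b * z, ?_, by rw [map_mul, hzv]; rfl⟩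
    simp only [map_mul, hz, Pi.smul_apply, smul_eq_mul, Finset.mul_sum, mul_assoc]
  have hSzero : Spec 0 0 := fun l => ⟨0, by simp⟩
  let Nk : Submodule Ak (Fin r → Ak) :=
    { carrier := {v | ∃ c, IntegralFun W i x c ∧ Spec c v}
      add_mem' := by
        rintro v v' ⟨c, hc, h⟩ ⟨c', hc', h'⟩
        exact ⟨c + c', hc.add hc', hSadd _ _ _ _ h h'⟩
      zero_mem' := ⟨0, zero, hSzero⟩
      smul_mem' := by
        rintro b v ⟨c, hc, h⟩
        obtain ⟨b, rfl⟩ := hj' b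
        exact ⟨i b • c, hc.smul ⟨b, rfl⟩, hSsmul _ _ _ h⟩ }
  obtain ⟨s, bs⟩ := Submodule.basisOfPid (Pi.basisFun Ak (Fin r)) Nk
  choose n hn hnS using fun a => (bs a).2
  refine ⟨s, n, ?_, hn, ?_⟩
  · -- the rank
    -- The rank is at least `|W|`: the point `xk` provides specializations which the inversion
    -- formula turns into nonzero multiples of the `|W|` coordinate vectors.
    let Φ : (Fin r → Ak) →ₗ[Ak] (W → Ak) :=
      { toFun := fun v g => ∑ l, v l * xk (g • xs l)
        map_add' := fun v v' => by ext g; simp [add_mul, Finset.sum_add_distrib]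
        map_smul' := fun b v => by ext g; simp [mul_assoc, Finset.mul_sum] }
    have hrow : ∀ f : T, (fun l => ∑ w : W, xk (w • f) * xk (w • ys l)) ∈ Nk := by
      intro f
      refine ⟨fun w => x (w • f), IntegralFun.apply xk hx f, fun l => ?_⟩
      obtain ⟨z, hz, hzk⟩ := hx (∑ w : W, w • (f * ys l)) (fun g => by
        rw [Finset.smul_sum]
        simp only [← mul_smul]
        exact Fintype.sum_equiv (Equiv.mulLeft g) _ _ fun _ => rfl)
      refine ⟨z, hz.trans ?_, hzk.trans ?_⟩ <;> rw [map_sum] <;>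
        exact Finset.sum_congr rfl fun w _ => by rw [smul_mul', map_mul]
    have hΦ : ∀ w : W, ∃ v ∈ Nk, Φ v = Pi.single w (xk δ * xk δ) := by
      intro w
      refine ⟨∑ l, xk (w • ys l) • (fun l' => ∑ w : W, xk (w • xs l) * xk (w • ys l')),
        Submodule.sum_mem _ fun l _ => Nk.smul_mem _ (hrow (xs l)), ?_⟩
      rw [map_sum]
      ext g
      rw [Finset.sum_apply]
      simp only [map_smul, Pi.smul_apply, smul_eq_mul]
      have h1 : ∀ l, Φ (fun l' => ∑ w : W, xk (w • xs l) * xk (w • ys l')) g =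
          xk δ * xk (g • xs l) := fun l =>
        sum_trace_mul (x := xk) hδ hδ' hinv (fun w => xk (w • xs l)) g
      simp only [h1]
      have h2 := congrArg xk (sum_smul_mul_smul hδ hδ' hinv g w)
      rw [map_sum] at h2
      simp only [map_mul] at h2
      simp only [mul_left_comm _ (xk δ), ← Finset.mul_sum, h2]
      rw [Pi.single_apply]
      by_cases hgw : w = g
      · simp [hgw]
      · simp [hgw, Ne.symm hgw]
    choose nv hnv hnvΦ using hΦ
    have hli : LinearIndependent Ak (fun w => (⟨nv w, hnv w⟩ : Nk)) := by
      refine LinearIndependent.of_comp (Φ ∘ₗ Nk.subtype) ?_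
      have h3 : ((Φ ∘ₗ Nk.subtype) ∘ fun w => (⟨nv w, hnv w⟩ : Nk)) =
          fun w => Pi.single w (xk δ * xk δ) := funext hnvΦ
      rw [h3, Fintype.linearIndependent_iff]
      intro b hb w
      have h4 := congrFun hb w
      simp only [Finset.sum_apply, Pi.smul_apply, smul_eq_mul, Pi.zero_apply] at h4
      rw [Finset.sum_eq_single w (fun w' _ hw' => by simp [Ne.symm hw']) (by simp),
        Pi.single_eq_same] at h4
      exact (mul_eq_zero.mp h4).resolve_right (mul_ne_zero hxk hxk)
    have := Module.Finite.of_basis bs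
    have hle := hli.fintype_card_le_finrank
    rwa [Module.finrank_eq_card_basis bs, Fintype.card_fin] at hle
  · intro v m c hm hc hrel a
    -- The relation between residues says that the Teichmüller combination is `ϖ c'` with `c'` again
    -- integral. Specializing kills the `m` term because `[0] = 0`, so the combination of basis
    -- vectors is divisible by the uniformizer, and so is each coordinate.
    have hc' : ∃ c', (∑ a, i (D.tch (v a)) • n a) - i (D.tch m) • c = D'.unif • c' := by
      have : ∀ w, ∃ y, ((∑ a, i (D.tch (v a)) • n a) - i (D.tch m) • c) w = D'.unif * y := by
        intro w
        refine D'.unif_dvd _ ?_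
        rw [Pi.sub_apply, Finset.sum_apply, map_sub, map_sum, sub_eq_zero]
        simp only [Pi.smul_apply, smul_eq_mul, map_mul, hi.res_map, D.res_tch]
        exact hrel w
      choose c' hc' using this
      exact ⟨c', funext hc'⟩
    obtain ⟨c', hc'⟩ := hc'
    have hc'M : IntegralFun W i x c' := IntegralFun.of_unif_smul hi (by
      rw [← hc']
      exact (IntegralFun.sum _ fun a _ => (hn a).smul ⟨_, rfl⟩).sub (hc.smul ⟨_, rfl⟩))
    obtain ⟨vc, hvc⟩ := hSpec c hc
    obtain ⟨vc', hvc'⟩ := hSpec c' hc'M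
    have hsum : ∀ t : Finset (Fin s), Spec (∑ a ∈ t, i (D.tch (v a)) • n a)
        (∑ a ∈ t, j (D.tch (v a)) • (bs a : Fin r → Ak)) := by
      intro t
      induction t using Finset.induction_on with
      | empty => exact hSzero
      | insert a t ha ih =>
        rw [Finset.sum_insert ha, Finset.sum_insert ha]
        exact hSadd _ _ _ _ (hSsmul _ _ _ (hnS a)) ih
    have h1 := hSadd _ _ _ _ (hSsmul c' vc' D.unif hvc') (hSsmul _ _ (D.tch m) hvc)
    rw [hi.map_unif, ← hc', sub_add_cancel] at h1
    have h2 := hSpecU _ _ _ (hsum Finset.univ) h1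
    rw [hj.map_unif, hj.map_tch m, hm, Dk.tch_zero, zero_smul, add_zero] at h2
    have hvcN : vc' ∈ Nk := ⟨c', hc'M, hvc'⟩
    have h3 : ∑ a, j (D.tch (v a)) • bs a = Dk.unif • (⟨vc', hvcN⟩ : Nk) := by
      apply Subtype.ext
      refine Eq.trans ?_ h2
      simp
    have h4 := congrArg (fun y => bs.repr y a) h3
    simp only [map_sum, map_smul, Finsupp.coe_finsetSum, Finset.sum_apply, Finsupp.smul_apply,
      Module.Basis.repr_self, smul_eq_mul] at h4
    rw [Finset.sum_eq_single a (fun b _ hb => by rw [Finsupp.single_eq_of_ne hb.symm, mul_zero])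
      (by simp), Finsupp.single_eq_same, mul_one, hj.map_tch] at h4
    have h5 := congrArg Dk.res h4
    rwa [Dk.res_tch, map_mul, Dk.res_unif, zero_mul] at h5

include hi hj hρ hρ' hx hδ hδ' hinv hu hxδ hxk in
/-- A point over the fraction field of a valuation ring is integral if its invariants are and if
there is a point over the residue field with the same invariants. -/
theorem mem_range_of_valuationRing (f : T) : x f ∈ i.range := by
  classical
  have hVL : Function.Injective (algebraMap V L) := IsFractionRing.injective V L
  obtain ⟨s, n, hs, hn, hstar⟩ :=
    exists_specialization_basis (W := W) hi hj hρ x xk hx hδ hδ' hinv hxk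
  -- A normalized relation has a coefficient equal to `1`, whereas specialization forces all
  -- coefficients into the maximal ideal.
  have hmax : ∀ l : Fin s → L, l ≠ 0 → ∀ (m : V) (c : W → A'), ρ m = 0 → IntegralFun W i x c →
      ∀ t : L, t ≠ 0 → (∀ a, ∃ v : V, algebraMap V L v = l a / t) → (∃ b, l b = t) →
      (∀ w, ∑ a, l a / t * D'.res (n a w) = algebraMap V L m * D'.res (c w)) → False := by
    intro l hl m c hm hc t ht hlt ⟨b, hb⟩ hrel
    choose v hv using hlt
    have h1 := hstar v m c hm hc (fun w => by simpa only [hv] using hrel w) b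
    have h2 : v b = 1 := hVL (by rw [hv, map_one, hb, div_self ht])
    rw [h2, map_one] at h1
    exact one_ne_zero h1
  have hli : LinearIndependent L (fun a w => D'.res (n a w)) := by
    rw [Fintype.linearIndependent_iff]
    intro l hl
    by_contra! hne
    have hl0 : l ≠ 0 := fun h => by
      obtain ⟨a, ha⟩ := hne
      exact ha (congrFun h a)
    obtain ⟨b, hb, hdiv⟩ := exists_div_mem_range (V := V) l hl0
    refine hmax l hl0 0 0 (map_zero ρ) IntegralFun.zero (l b) hb hdiv ⟨b, rfl⟩ fun w => ?_
    have h1 := congrFun hl w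
    simp only [Finset.sum_apply, Pi.smul_apply, smul_eq_mul, Pi.zero_apply] at h1
    rw [map_zero, zero_mul]
    simp only [div_mul_eq_mul_div, ← Finset.sum_div, h1, zero_div]
  -- The residues of the `n a` are independent in `L ^ W`, so there are exactly `|W|` of them and
  -- the matrix `X` is invertible over `A'`.
  have hcard : s = Fintype.card W := by
    refine le_antisymm ?_ hs
    have := hli.fintype_card_le_finrank
    rwa [Fintype.card_fin, Module.finrank_fintype_fun_eq_card] at this
  let e : W ≃ Fin s := Fintype.equivFinOfCardEq hcard.symm
  let X : Matrix W W A' := fun a w => n (e a) w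
  have hXM : ∀ a, IntegralFun W i x (X a) := fun a => hn (e a)
  have hdet : IsUnit X.det := by
    refine D'.isUnit_of_isUnit_res ?_
    rw [RingHom.map_det, ← Matrix.isUnit_iff_isUnit_det, ← Matrix.linearIndependent_rows_iff_isUnit]
    exact hli.comp e e.injective
  let Y : Matrix W W A' := X⁻¹
  have hXY : X * Y = 1 := Matrix.mul_nonsing_inv X hdet
  have hYX : Y * X = 1 := Matrix.nonsing_inv_mul X hdet
  -- coordinates of integral functions
  have hcoord : ∀ (c : W → A') (w : W), ∑ a, (∑ w', c w' * Y w' a) * X a w = c w := by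
    intro c w
    have h1 : Matrix.vecMul (Matrix.vecMul c Y) X = c := by
      rw [Matrix.vecMul_vecMul, hYX, Matrix.vecMul_one]
    exact congrFun h1 w
  have hcoord' : ∀ (v : W → A') (b : W), ∑ w, (∑ a, v a * X a w) * Y w b = v b := by
    intro v b
    have h1 : Matrix.vecMul (Matrix.vecMul v X) Y = v := by
      rw [Matrix.vecMul_vecMul, hXY, Matrix.vecMul_one]
    exact congrFun h1 b
  -- If a coordinate were not in `V`, the largest one would have its inverse `m` in the maximal
  -- ideal. Dividing by it gives a normalized relation, contradicting `hmax`.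
  have hresV : ∀ c, IntegralFun W i x c → ∀ b, ∃ v : V,
      algebraMap V L v = D'.res (∑ w, c w * Y w b) := by
    intro c hc b
    let l : Fin s → L := fun a => D'.res (∑ w, c w * Y w (e.symm a))
    have hl : ∀ w, ∑ a, l a * D'.res (n a w) = D'.res (c w) := by
      intro w
      rw [← hcoord c w, map_sum, ← e.sum_comp]
      refine Finset.sum_congr rfl fun a _ => ?_
      simp only [l, e.symm_apply_apply, map_mul, X]
    by_contra hb
    have hl0 : l ≠ 0 := fun h => hb ⟨0, by
      have := congrFun h (e b)
      simp only [l, e.symm_apply_apply, Pi.zero_apply] at this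
      rw [this, map_zero]⟩
    obtain ⟨b', hb', hdiv⟩ := exists_div_mem_range (V := V) l hl0
    have hnot : ∀ v : V, algebraMap V L v ≠ l b' := by
      intro v hv
      obtain ⟨v', hv'⟩ := hdiv (e b)
      refine hb ⟨v' * v, ?_⟩
      rw [map_mul, hv', hv, div_mul_cancel₀ _ hb']
      simp only [l, e.symm_apply_apply]
    obtain ⟨m, hm⟩ := (ValuationRing.isInteger_or_isInteger V (l b')).resolve_left
      (fun ⟨v, hv⟩ => hnot v hv)
    have hm0 : ρ m = 0 := by
      rw [hρ']
      intro hmu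
      obtain ⟨m', hm'⟩ := hmu.exists_right_inv
      refine hnot m' ?_
      have h1 := congrArg (algebraMap V L) hm'
      rw [map_mul, hm, map_one] at h1
      rwa [inv_mul_eq_iff_eq_mul₀ hb', mul_one] at h1
    refine hmax l hl0 m c hm0 hc (l b') hb' hdiv ⟨b', rfl⟩ fun w => ?_
    simp only [div_mul_eq_mul_div, ← Finset.sum_div, hl]
    rw [hm, inv_mul_eq_div]
  -- Subtract the Teichmüller lifts of the residues of the coordinates, divide by the uniformizer,
  -- and repeat. Thus integral functions have integral coordinates in the basis `X`.
  have hcoordV : ∀ (q : ℕ) (c : W → A'), IntegralFun W i x c → ∀ b,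
      D'.coef (∑ w, c w * Y w b) q ∈ (algebraMap V L).range := by
    intro q
    induction q with
    | zero => exact fun c hc b => hresV c hc b
    | succ q ih =>
      intro c hc b
      choose v hv using hresV c hc
      have hsum : ∀ w, (∑ a, i (D.tch (v a)) • X a) w = ∑ a, i (D.tch (v a)) * X a w := by
        intro w
        simp [Finset.sum_apply]
      obtain ⟨c', hc'⟩ : ∃ c', c - ∑ a, i (D.tch (v a)) • X a = D'.unif • c' := by
        have : ∀ w, ∃ y, (c - ∑ a, i (D.tch (v a)) • X a) w = D'.unif * y := by
          intro w
          refine D'.unif_dvd _ ?_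
          rw [Pi.sub_apply, hsum, map_sub, sub_eq_zero]
          conv_lhs => rw [← hcoord c w]
          simp only [map_sum, map_mul D'.res, hi.res_map, D.res_tch, hv]
        choose c' hc' using this
        exact ⟨c', funext hc'⟩
      have hc'M : IntegralFun W i x c' := IntegralFun.of_unif_smul hi (by
        rw [← hc']
        exact hc.sub (IntegralFun.sum _ fun a _ => (hXM a).smul ⟨_, rfl⟩))
      rw [D'.coef_succ]
      convert ih c' hc'M b using 2
      refine (D'.shift_eq (r := algebraMap V L (v b)) ?_).2
      have h1 : ∀ w, c w = D'.unif * c' w + ∑ a, i (D.tch (v a)) * X a w := by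
        intro w
        have := congrFun hc' w
        rw [Pi.sub_apply, hsum, Pi.smul_apply, smul_eq_mul] at this
        rw [← this]
        ring
      simp only [h1, add_mul, Finset.sum_add_distrib, hcoord', mul_assoc, ← Finset.mul_sum]
      rw [hi.map_tch, add_comm]
  have hcoordi : ∀ (c : W → A'), IntegralFun W i x c → ∀ b, ∑ w, c w * Y w b ∈ i.range :=
    fun c hc b => hi.mem_range_iff.mpr fun q => hcoordV q c hc b
  -- Pairing the column `b` of `X⁻¹` with `f` gives the coordinate `b` of the function `w ↦ x (w •
  -- f)`, which is integral.
  have hYM : ∀ b, IntegralFun W i x fun w => Y w b := by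
    intro b f
    convert hcoordi _ (IntegralFun.apply xk hx f) b using 2
    exact mul_comm _ _
  -- integral functions have integral values modulo the uniformizer
  have hval : ∀ c, IntegralFun W i x c → ∀ w, ∃ v : V, algebraMap V L v = D'.res (c w) := by
    intro c hc w
    let Nw : Submodule V L := Submodule.span V (Set.range fun a => D'.res (X a w))
    have hmem : ∀ c, IntegralFun W i x c → D'.res (c w) ∈ Nw := by
      intro c hc
      rw [← hcoord c w, map_sum]
      refine Submodule.sum_mem _ fun a _ => ?_
      obtain ⟨v, hv⟩ := hresV c hc a
      rw [map_mul, ← hv, ← Algebra.smul_def]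
      exact Submodule.smul_mem _ _ (Submodule.subset_span ⟨a, rfl⟩)
    have hone : IntegralFun W i x 1 := by
      have := IntegralFun.apply (i := i) xk hx (1 : T)
      convert this using 1
      ext w
      simp
    have hN : Nw ≠ ⊥ := by
      intro h
      have h1 := hmem 1 hone
      rw [h, Submodule.mem_bot, Pi.one_apply, map_one] at h1
      exact one_ne_zero h1
    have hfg : Nw.FG := Submodule.fg_span (Set.finite_range _)
    have hint : IsIntegral V (D'.res (c w)) := by
      refine isIntegral_of_smul_mem_submodule Nw hN hfg _ fun y hy => ?_
      induction hy using Submodule.span_induction with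
      | mem y hy =>
        obtain ⟨a, rfl⟩ := hy
        rw [smul_eq_mul, ← map_mul]
        exact hmem _ (IntegralFun.mul hi hδ hδ' hinv hu hxδ hc (hXM a))
      | zero => rw [smul_zero]; exact zero_mem _
      | add y y' _ _ h h' => rw [smul_add]; exact add_mem h h'
      | smul v y _ h => rw [smul_comm]; exact Submodule.smul_mem _ _ h
    exact IsIntegrallyClosed.isIntegral_iff.mp hint
  -- lifts of the idempotents
  have hidem : ∀ q, ∃ c, IntegralFun W i x c ∧ ∃ h, c = Pi.single 1 1 + D'.unif ^ (q + 1) • h := by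
    intro q
    induction q with
    | zero =>
      choose v hv using fun a => hval _ (hYM a) 1
      refine ⟨∑ a, i (D.tch (v a)) • X a, IntegralFun.sum _ fun a _ => (hXM a).smul ⟨_, rfl⟩, ?_⟩
      have h1 : ∀ w, ∃ y, (∑ a, i (D.tch (v a)) • X a) w - (Pi.single 1 1 : W → A') w =
          D'.unif * y := by
        intro w
        refine D'.unif_dvd _ ?_
        have h2 : (Pi.single 1 1 : W → A') w = ∑ a, Y 1 a * X a w := by
          have := congrFun (congrFun hYX 1) w
          rw [Matrix.mul_apply, Matrix.one_apply] at this
          rw [this, Pi.single_apply]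
          simp only [eq_comm]
        rw [h2, Finset.sum_apply, map_sub, map_sum, map_sum, sub_eq_zero]
        refine Finset.sum_congr rfl fun a _ => ?_
        rw [Pi.smul_apply, smul_eq_mul, map_mul, map_mul, hi.res_map, D.res_tch, hv]
      choose y hy using h1
      refine ⟨y, ?_⟩
      ext w
      have := hy w
      rw [sub_eq_iff_eq_add'] at this
      rw [this, zero_add, pow_one]
      rfl
    | succ q ih =>
      obtain ⟨c, hc, h, rfl⟩ := ih
      set c := (Pi.single 1 1 : W → A') + D'.unif ^ (q + 1) • h with hcdef
      have hmul := fun {c c'} => IntegralFun.mul (c := c) (c' := c') hi hδ hδ' hinv hu hxδ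
      -- The idempotent-lifting polynomial `3 c² - 2 c³`: its derivative vanishes at idempotents, so
      -- the error is squared and acquires order `2 (q + 1) = (q + 2) + q`.
      refine ⟨c * c + c * c + c * c - (c * c * c + c * c * c),
        (((hmul hc hc).add (hmul hc hc)).add (hmul hc hc)).sub
          ((hmul (hmul hc hc) hc).add (hmul (hmul hc hc) hc)),
        D'.unif ^ q • (3 * h * h - 6 * Pi.single 1 1 * h * h - 2 * D'.unif ^ (q + 1) • h * h * h),
        ?_⟩
      have hsq : (Pi.single 1 1 : W → A') * Pi.single 1 1 = Pi.single 1 1 := by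
        rw [← Pi.single_mul, one_mul]
      ext w
      have hw := congrFun hsq w
      simp only [hcdef, Pi.add_apply, Pi.sub_apply, Pi.mul_apply, Pi.smul_apply, smul_eq_mul,
        Pi.ofNat_apply] at hw ⊢
      generalize (Pi.single 1 1 : W → A') w = ε at hw ⊢
      rw [show q + 1 + 1 = 1 + 1 + q by ring, pow_add D'.unif (1 + 1) q, pow_add D'.unif q 1]
      linear_combination (1 - 2 * ε - 6 * D'.unif ^ q * D'.unif * h w) * hw
  refine hi.mem_range_of_approx fun q => ?_
  obtain ⟨c, hc, h, rfl⟩ := hidem q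
  obtain ⟨z, hz⟩ := hc f
  refine ⟨z, -(D'.unif * ∑ w, h w * x (w • f)), ?_⟩
  rw [hz]
  simp only [Pi.add_apply, add_mul, Finset.sum_add_distrib, Pi.smul_apply, smul_eq_mul, mul_assoc,
    ← Finset.mul_sum]
  rw [Finset.sum_eq_single 1 (fun w _ hw => by simp [hw]) (by simp), Pi.single_eq_same, one_mul,
    one_smul, pow_succ]
  ring

end Valuation

/-! ### Tamely ramified extensions -/

lemma exists_lift_of_injective {T A B : Type*} [CommRing T] [CommRing A] [CommRing B]
    (i : A →+* B) (hi : Function.Injective i) (x : T →+* B) (hx : ∀ f, ∃ z, i z = x f) :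
    ∃ x' : T →+* A, i.comp x' = x := by
  choose x' hx' using hx
  exact ⟨{ toFun := x'
           map_one' := hi (by rw [hx', map_one, map_one])
           map_mul' := fun f f' => hi (by rw [map_mul, hx', hx', hx', map_mul])
           map_zero' := hi (by rw [hx', map_zero, map_zero])
           map_add' := fun f f' => hi (by rw [map_add, hx', hx', hx', map_add]) },
    RingHom.ext hx'⟩

namespace WittLike

section Tame

variable {A B k : Type*} [CommRing A] [CommRing B] [Field k] [Algebra A B]
  (D : WittLike A k) (D' : WittLike B k) (hres : ∀ a, D'.res (algebraMap A B a) = D.res a)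
  {e : ℕ} {u : B} (hu : IsUnit u) (hs : D'.unif ^ e = algebraMap A B D.unif * u)

include hres hu hs in
-- The valuations of nonzero terms are distinct modulo `e`. Inductively, terms before `j` are
-- divisible by `s ^ e` and terms after it by `s ^ (j + 1)`, so the coefficient `a j` has zero
-- residue.
lemma unif_dvd_of_sum_pow {a : ℕ → A}
    (h : ∑ j ∈ Finset.range e, algebraMap A B (a j) * D'.unif ^ j = 0) (j : ℕ)
    (hj : j < e) : D.unif ∣ a j := by
  have ht : ∀ c, D.unif ∣ c → D'.unif ^ e ∣ algebraMap A B c := by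
    rintro c ⟨c, rfl⟩
    obtain ⟨v, hv⟩ := hu.exists_right_inv
    refine ⟨v * algebraMap A B c, ?_⟩
    rw [hs, map_mul, ← mul_assoc, mul_assoc (algebraMap A B D.unif), hv, mul_one]
  induction j using Nat.strong_induction_on with
  | _ j ih =>
    rw [← Finset.add_sum_erase _ _ (Finset.mem_range.mpr hj)] at h
    have h1 : D'.unif ^ (j + 1) ∣ algebraMap A B (a j) * D'.unif ^ j := by
      rw [eq_neg_of_add_eq_zero_left h, dvd_neg]
      refine Finset.dvd_sum fun l hl => ?_
      rw [Finset.mem_erase, Finset.mem_range] at hl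
      rcases lt_or_gt_of_ne hl.1 with hlj | hlj
      · exact ((pow_dvd_pow _ hj).trans (ht _ (ih l hlj hl.2))).mul_right _
      · exact (pow_dvd_pow _ hlj).mul_left _
    obtain ⟨c, hc⟩ := h1
    rw [pow_succ, mul_assoc, mul_comm] at hc
    refine D.unif_dvd _ ?_
    rw [← hres, D'.unif_pow_mul_cancel hc, map_mul, D'.res_unif, zero_mul]

include hres hu hs in
-- Descent: all coefficients of a relation are divisible by the uniformizer of `A`; dividing gives
-- another relation, so they are divisible by all its powers.
lemma linearIndependent_pow : LinearIndependent A fun j : Fin e => D'.unif ^ (j : ℕ) := by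
  have hdvd : ∀ (n : ℕ) (a : ℕ → A),
      ∑ j ∈ Finset.range e, algebraMap A B (a j) * D'.unif ^ j = 0 → ∀ j < e, D.unif ^ n ∣ a j := by
    intro n
    induction n with
    | zero => simp
    | succ n ih =>
      intro a ha j hj
      choose! b hb using fun j hj => D.unif_dvd_of_sum_pow D' hres hu hs ha j hj
      have h1 : ∑ j ∈ Finset.range e, algebraMap A B (b j) * D'.unif ^ j = 0 := by
        have h2 : algebraMap A B D.unif *
            ∑ j ∈ Finset.range e, algebraMap A B (b j) * D'.unif ^ j = 0 := by
          rw [← ha, Finset.mul_sum]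
          refine Finset.sum_congr rfl fun j hj => ?_
          conv_rhs => rw [hb j (Finset.mem_range.mp hj), map_mul, mul_assoc]
        refine D'.unif_pow_mul_cancel (n := e) ?_
        rw [hs, mul_right_comm, h2, zero_mul, mul_zero]
      rw [hb j hj, pow_succ']
      exact mul_dvd_mul_left _ (ih b h1 j hj)
  rw [Fintype.linearIndependent_iff]
  intro a ha j
  let a' : ℕ → A := fun l => if h : l < e then a ⟨l, h⟩ else 0
  have h1 : ∑ j ∈ Finset.range e, algebraMap A B (a' j) * D'.unif ^ j = 0 := by
    rw [Finset.sum_range, ← ha]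
    refine Finset.sum_congr rfl fun l _ => ?_
    rw [Algebra.smul_def]
    simp [a']
  have h2 := D.separated (a' j) fun n => hdvd n a' h1 j j.2
  simpa [a'] using h2

include hres hs in
-- Nakayama: since the residue fields agree, successive subtraction of `[c] s ^ j` for `j < e`
-- leaves a multiple of `s ^ e`, which is a multiple of the uniformizer of `A`.
lemma span_pow_eq_top [Module.Finite A B] :
    Submodule.span A (Set.range fun j : Fin e => D'.unif ^ (j : ℕ)) = ⊤ := by
  refine top_le_iff.mp (Submodule.le_of_le_smul_of_le_jacobson_bot (I := Ideal.span {D.unif})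
    Module.Finite.fg_top ?_ ?_)
  · have := D.isAdicComplete
    exact IsAdicComplete.le_jacobson_bot _
  · have hstep : ∀ n ≤ e, ∀ b : B, ∃ y ∈ Submodule.span A
        (Set.range fun j : Fin e => D'.unif ^ (j : ℕ)), ∃ c, b = y + D'.unif ^ n * c := by
      intro n
      induction n with
      | zero => exact fun _ b => ⟨0, zero_mem _, b, by simp⟩
      | succ n ih =>
        intro hn b
        obtain ⟨y, hy, c, rfl⟩ := ih (by omega) b
        obtain ⟨c', hc'⟩ := D'.unif_dvd (c - algebraMap A B (D.tch (D'.res c))) (by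
          rw [map_sub, hres, D.res_tch, sub_self])
        refine ⟨y + D.tch (D'.res c) • D'.unif ^ n, add_mem hy (Submodule.smul_mem _ _
          (Submodule.subset_span ⟨⟨n, hn⟩, rfl⟩)), c', ?_⟩
        rw [sub_eq_iff_eq_add] at hc'
        rw [Algebra.smul_def]
        conv_lhs => rw [hc']
        ring
    intro b _
    obtain ⟨y, hy, c, rfl⟩ := hstep e le_rfl b
    refine Submodule.add_mem_sup hy ?_
    rw [hs, mul_assoc, ← Algebra.smul_def]
    exact Submodule.smul_mem_smul (Ideal.mem_span_singleton_self _) trivial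

include hres hu hs in
lemma finrank_eq_index [Module.Finite A B] : Module.finrank A B = e := by
  have := D.nontrivial
  let bs := Module.Basis.mk (D.linearIndependent_pow D' hres hu hs)
    (D.span_pow_eq_top D' hres hs).ge
  rw [Module.finrank_eq_card_basis bs, Fintype.card_fin]

end Tame

/-- Hensel for `X ^ e - w`: a root exists in `k`, and it is simple because `e` is nonzero in `k`. -/
lemma exists_pow_eq {B k : Type*} [CommRing B] [Field k] [IsAlgClosed k] (D : WittLike B k) {e : ℕ}
    (he : (e : k) ≠ 0) {w : B} (hw : IsUnit w) : ∃ v, IsUnit v ∧ v ^ e = w := by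
  have := D.isAdicComplete
  have he0 : e ≠ 0 := by
    rintro rfl
    simp at he
  obtain ⟨c, hc⟩ := IsAlgClosed.exists_pow_nat_eq (D.res w) (Nat.pos_of_ne_zero he0)
  have hc0 : c ≠ 0 := by
    rintro rfl
    rw [zero_pow he0] at hc
    exact (hw.map D.res).ne_zero hc.symm
  obtain ⟨v, hv, hvc⟩ := HenselianRing.is_henselian (I := Ideal.span {D.unif})
    (X ^ e - C w) (monic_X_pow_sub_C w he0) (D.tch c) (by
      rw [Ideal.mem_span_singleton, D.unif_dvd_iff]
      simp [D.res_tch, hc]) (by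
      refine IsUnit.map _ (D.isUnit_of_isUnit_res ?_)
      simp [derivative_X_pow, D.res_tch, hc0, he])
  have hve : v ^ e = w := by simpa [IsRoot.def, sub_eq_zero] using hv
  exact ⟨v, isUnit_of_mul_isUnit_left (y := v ^ (e - 1)) (by
    rwa [mul_pow_sub_one he0, hve]), hve⟩

/-- A finite extension of degree `n` prime to the residue characteristic of a complete discrete
valuation field with algebraically closed residue field is generated by an `n`-th root of the
uniformizer. -/
theorem nonempty_algHom_of_finrank {A k K L E : Type*} [CommRing A] [IsDomain A] [CharZero A]
    [Field k] [IsAlgClosed k] (D : WittLike A k) [Field K] [Algebra A K] [IsFractionRing A K]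
    [Field L] [Algebra K L] [FiniteDimensional K L] (hn : (Module.finrank K L : k) ≠ 0)
    [Field E] [Algebra K E] (γ : E)
    (hγ : γ ^ Module.finrank K L = algebraMap K E (algebraMap A K D.unif)) :
    Nonempty (L →ₐ[K] E) := by
  let _ : Algebra A L := ((algebraMap K L).comp (algebraMap A K)).toAlgebra
  have : IsScalarTower A K L := IsScalarTower.of_algebraMap_eq fun _ => rfl
  have : CharZero K := charZero_of_injective_algebraMap (IsFractionRing.injective A K)
  have := D.isDiscreteValuationRing
  let B := integralClosure A L
  have hAL : Function.Injective (algebraMap A L) :=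
    (algebraMap K L).injective.comp (IsFractionRing.injective A K)
  have : FaithfulSMul A L := (faithfulSMul_iff_algebraMap_injective _ _).mpr hAL
  have : IsDedekindDomain B := IsIntegralClosure.isDedekindDomain A K L B
  have : Module.Finite A B := IsIntegralClosure.finite A K L B
  have : FaithfulSMul A B := by
    rw [faithfulSMul_iff_algebraMap_injective]
    refine Function.Injective.of_comp (f := algebraMap B L) ?_
    exact hAL
  have : Module.IsTorsionFree A L := Module.isTorsionFree_iff_faithfulSMul.mpr inferInstance
  have hrank : Module.finrank A B = Module.finrank K L := IsIntegralClosure.rank A K L B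
  obtain ⟨hB, hD⟩ := D.exists_of_isDedekindDomain (B := B)
  obtain ⟨s, hs⟩ := IsDiscreteValuationRing.exists_irreducible B
  obtain ⟨D', rfl, hres, -⟩ := hD s hs
  have ht : algebraMap A B D.unif ≠ 0 :=
    (map_ne_zero_iff _ (FaithfulSMul.algebraMap_injective A B)).mpr D.unif_ne_zero
  obtain ⟨e, u, hu⟩ := IsDiscreteValuationRing.associated_pow_irreducible ht hs
  have he : Module.finrank K L = e :=
    hrank.symm.trans (D.finrank_eq_index D' hres u.isUnit hu.symm)
  rw [he] at hn hγ
  have he0 : e ≠ 0 := by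
    rintro rfl
    simp at hn
  -- The unit `v` corrects the uniformizer of `B` so that its `e`-th power is exactly that of `A`.
  obtain ⟨v, hv, hve⟩ := D'.exists_pow_eq hn (u⁻¹).isUnit
  have hβ : (D'.unif * v) ^ e = algebraMap A B D.unif := by
    rw [mul_pow, ← hu, hve, mul_assoc, Units.mul_inv, mul_one]
  obtain ⟨D'', hD'', hres'', -⟩ := hD (D'.unif * v) ((irreducible_mul_isUnit hv).mpr hs)
  have hli : LinearIndependent A fun j : Fin e => D''.unif ^ (j : ℕ) :=
    D.linearIndependent_pow D'' hres'' isUnit_one (by rw [hD'', hβ, mul_one])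
  let β : L := ((D'.unif * v : B) : L)
  have hβL : β ^ e = algebraMap K L (algebraMap A K D.unif) := by
    have := congrArg (algebraMap B L) hβ
    rw [map_pow] at this
    exact this
  have hliL : LinearIndependent K fun j : Fin e => β ^ (j : ℕ) := by
    rw [← LinearIndependent.iff_fractionRing A K]
    have := hli.map' (IsScalarTower.toAlgHom A B L).toLinearMap
      (LinearMap.ker_eq_bot.mpr Subtype.val_injective)
    rw [hD''] at this
    exact this
  have hint : IsIntegral K β := Algebra.IsIntegral.isIntegral β
  have hdvd : minpoly K β ∣ X ^ e - C (algebraMap A K D.unif) := by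
    apply minpoly.dvd
    simp [hβL]
  -- Independence of the powers of `β` makes `X ^ e - ϖ` its minimal polynomial. So `L = K(β)`, and
  -- sending `β` to `γ` defines the embedding.
  have hdeg : e ≤ (minpoly K β).natDegree := by
    by_contra! hlt
    have h1 := aeval_eq_sum_range' hlt β
    rw [minpoly.aeval, Finset.sum_range] at h1
    rw [Fintype.linearIndependent_iff] at hliL
    have h2 := hliL (fun j => (minpoly K β).coeff j) h1.symm ⟨_, hlt⟩
    rw [coeff_natDegree, (minpoly.monic hint).leadingCoeff] at h2
    exact one_ne_zero h2
  have hmin : minpoly K β = X ^ e - C (algebraMap A K D.unif) :=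
    (eq_of_monic_of_dvd_of_natDegree_le (minpoly.monic hint) (monic_X_pow_sub_C _ he0) hdvd
      (by rwa [natDegree_X_pow_sub_C])).symm
  have htop : IntermediateField.adjoin K {β} = ⊤ := by
    rw [Field.primitive_element_iff_minpoly_natDegree_eq, hmin, natDegree_X_pow_sub_C, he]
  have hroot : γ ∈ (minpoly K β).aroots E := by
    rw [mem_aroots, hmin]
    refine ⟨(monic_X_pow_sub_C _ he0).ne_zero, ?_⟩
    simp [hγ]
  let ψ := (IntermediateField.algHomAdjoinIntegralEquiv K hint).symm ⟨γ, hroot⟩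
  exact ⟨ψ.comp ((IntermediateField.equivOfEq htop.symm).toAlgHom.comp
    (IntermediateField.topEquiv.symm.toAlgHom))⟩

end WittLike

/-! ### Lifting arcs over algebraically closed fields -/

section Geometric

variable {T C W : Type*} [CommRing T] [CommRing C] [Algebra C T] [Group W] [Finite W]
  [MulSemiringAction W T] [Algebra.IsInvariant C T W] [SMulCommClass W C T] [FaithfulSMul C T]

/-- Over an algebraically closed field, arcs of the quotient by `W` with generically étale
ramification lift to arcs after adjoining a root of the uniformizer. -/
theorem exists_point {A A' k : Type*} [CommRing A] [CommRing A'] [Field k] [IsAlgClosed k]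
    [CharZero A] (D : WittLike A k) (D' : WittLike A' k) (incl : A →+* A')
    (hW : (Nat.card W : k) ≠ 0) (hincl : Function.Injective incl)
    (hunif : D'.unif ^ Nat.card W = incl D.unif)
    {d : C} (hd : ∀ g : W, g ≠ 1 → algebraMap C T d ∈ fixedIdeal T g)
    (y : C →+* A) (hy : y d ≠ 0) :
    ∃ x : T →+* A', x.comp (algebraMap C T) = incl.comp y := by
  have := D.isDomain
  have := D'.isDomain
  have := D'.isDiscreteValuationRing
  let K := FractionRing A
  let Ω := AlgebraicClosure K
  have hAK : Function.Injective (algebraMap A K) := IsFractionRing.injective A K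
  have : CharZero K := charZero_of_injective_algebraMap hAK
  let φ : C →+* Ω := (algebraMap K Ω).comp ((algebraMap A K).comp y)
  have : Algebra.IsIntegral C T := Algebra.IsInvariant.isIntegral C T W
  have := RingHom.ker_isPrime φ
  obtain ⟨Q, -, hQ, hQφ⟩ := Ideal.exists_ideal_over_prime_of_isIntegral (S := T)
    (RingHom.ker φ) ⊥ (by
      rw [← RingHom.ker_eq_comap_bot,
        (RingHom.injective_iff_ker_eq_bot _).mp (FaithfulSMul.algebraMap_injective C T)]
      exact bot_le)
  obtain ⟨x, hx, -⟩ := exists_lift_of_isIntegral φ Q hQφ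
  have hxC : ∀ c, x (algebraMap C T c) = φ c := RingHom.congr_fun hx
  have hinvC : ∀ b : T, (∀ g : W, g • b = b) → ∃ c, algebraMap C T c = b := fun b hb =>
    Algebra.IsInvariant.isInvariant (A := C) (G := W) b hb
  have hxd : x (algebraMap C T d) ≠ 0 := by
    rw [hxC]
    change algebraMap K Ω (algebraMap A K (y d)) ≠ 0
    exact (_root_.map_ne_zero _).mpr ((map_ne_zero_iff _ hAK).mpr hy)
  obtain ⟨r, xs, ys, m, hxy, hxy'⟩ := exists_galois_coordinates (W := W) hd
  let L : IntermediateField K Ω := IntermediateField.adjoin K (Set.range fun l => x (xs l))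
  have hintx : ∀ f, IsIntegral K (x f) := by
    intro f
    have h1 : IsIntegral C f := Algebra.IsIntegral.isIntegral f
    obtain ⟨q, hq, hq0⟩ := h1
    refine ⟨q.map ((algebraMap A K).comp y), hq.map _, ?_⟩
    rw [eval₂_map]
    have h2 := congrArg x hq0
    rw [hom_eval₂, map_zero, hx] at h2
    exact h2
  have : FiniteDimensional K L := IntermediateField.finiteDimensional_adjoin (by
    rintro _ ⟨l, rfl⟩
    exact hintx _)
  have hKL : ∀ c, x (algebraMap C T c) ∈ L := by
    intro c
    rw [hxC]
    exact L.algebraMap_mem _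
  -- The dual basis formula writes `d ^ m` times `f` through the `xs l` and traces in `C`, and `x d
  -- ≠ 0`, so `L` contains all values of `x`.
  have hxL : ∀ f, x f ∈ L := by
    classical
    intro f
    cases nonempty_fintype W
    have h1 := sum_mul_sum_smul_eq hxy hxy' f
    have h2 : x (algebraMap C T d ^ m) * x f ∈ L := by
      rw [← map_mul, ← h1, map_sum]
      refine sum_mem fun l _ => ?_
      rw [map_mul]
      refine mul_mem (IntermediateField.subset_adjoin _ _ ⟨l, rfl⟩) ?_
      rw [← algebraMap_groupTrace (A := C)]
      exact hKL _
    have h3 : x (algebraMap C T d ^ m) ∈ L := by rw [map_pow]; exact pow_mem (hKL d) m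
    have h4 : x (algebraMap C T d ^ m) ≠ 0 := by rw [map_pow]; exact pow_ne_zero _ hxd
    rw [← inv_mul_cancel_left₀ h4 (x f)]
    exact mul_mem (inv_mem h3) h2
  have hconj : ∀ σ : Ω →ₐ[K] Ω, ∃ g : W, ∀ f, σ (x f) = x (g • f) := by
    intro σ
    refine exists_smul_of_eq_on_invariants x (σ.toRingHom.comp x) fun b hb => ?_
    obtain ⟨c, rfl⟩ := hinvC b hb
    rw [RingHom.comp_apply, hxC]
    exact σ.commutes _
  -- Every conjugate of `x` is `x` composed with an element of `W`, so its values stay in `L`.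
  have : Normal K L := by
    rw [IntermediateField.normal_iff_forall_map_le]
    intro σ
    obtain ⟨g, hg⟩ := hconj σ
    rw [IntermediateField.adjoin_map, IntermediateField.adjoin_le_iff]
    rintro _ ⟨_, ⟨l, rfl⟩, rfl⟩
    change σ (x (xs l)) ∈ L
    rw [hg]
    exact hxL _
  have : IsGalois K L := {}
  let xL : T →+* L := x.codRestrict L hxL
  have hxLC : ∀ c, xL (algebraMap C T c) = algebraMap K L (algebraMap A K (y c)) := fun c =>
    Subtype.ext (hxC c)
  have hxLd : xL (algebraMap C T d) ≠ 0 := fun h => hxd (congrArg Subtype.val h)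
  have hgal : ∀ σ : Gal(L/K), ∃ g : W, ∀ f, σ (xL f) = xL (g • f) := by
    intro σ
    refine exists_smul_of_eq_on_invariants xL (σ.toRingEquiv.toRingHom.comp xL) fun b hb => ?_
    obtain ⟨c, rfl⟩ := hinvC b hb
    rw [RingHom.comp_apply, hxLC]
    exact σ.commutes _
  have huniq : ∀ g g' : W, (∀ f, xL (g • f) = xL (g' • f)) → g = g' := by
    intro g g' h
    by_contra hne
    have hne' : g⁻¹ * g' ≠ 1 := fun h1 => hne (inv_mul_eq_one.mp h1)
    have h0 : ∀ z ∈ fixedIdeal T (g⁻¹ * g'), xL (g • z) = 0 := by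
      intro z hz
      induction hz using Submodule.span_induction with
      | mem z hz =>
        obtain ⟨b, rfl⟩ := hz
        rw [smul_sub, smul_smul, mul_inv_cancel_left, map_sub, h, sub_self]
      | zero => rw [smul_zero, map_zero]
      | add z z' _ _ hz hz' => rw [smul_add, map_add, hz, hz', add_zero]
      | smul c z _ hz => rw [smul_eq_mul, smul_mul', map_mul, hz, mul_zero]
    refine hxLd ?_
    have := h0 _ (hd _ hne')
    rwa [smul_algebraMap] at this
  choose w hw using hgal
  -- Freeness where `d ≠ 0` makes the element of `W` attached to an automorphism unique, hence
  -- multiplicative. The degree of `L` therefore divides `|W|` and is prime to the characteristic of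
  -- `k`.
  let wHom : Gal(L/K) →* W := MonoidHom.mk' w fun σ τ => huniq _ _ fun f => by
    rw [← hw, AlgEquiv.mul_apply, hw τ, hw σ, smul_smul]
  have hwinj : Function.Injective wHom := by
    rw [injective_iff_map_eq_one]
    intro σ hσ
    have h1 : ∀ f, σ (xL f) = xL f := by
      intro f
      have h2 := hw σ f
      have h3 : w σ = 1 := hσ
      rwa [h3, one_smul] at h2
    have h4 : σ.toAlgHom = AlgHom.id K L :=
      IntermediateField.algHom_ext_of_eq_adjoin K (S := L) rfl (by
        rintro _ ⟨l, rfl⟩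
        exact h1 (xs l))
    ext z
    exact congrArg Subtype.val (DFunLike.congr_fun h4 z)
  have hdvd : Module.finrank K L ∣ Nat.card W := by
    rw [← IsGalois.card_aut_eq_finrank]
    exact Subgroup.card_dvd_of_injective wHom hwinj
  obtain ⟨q, hq⟩ := hdvd
  let K' := FractionRing A'
  have hAK' : Function.Injective (algebraMap A' K') := IsFractionRing.injective A' K'
  have hcomp : Function.Injective ((algebraMap A' K').comp incl) := by
    rw [RingHom.coe_comp]
    exact hAK'.comp hincl
  let _ : Algebra K K' := (IsFractionRing.lift (A := A) (K := K)
    hcomp).toAlgebra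
  have hKK' : ∀ z, algebraMap K K' (algebraMap A K z) = algebraMap A' K' (incl z) := fun z =>
    IsFractionRing.lift_algebraMap hcomp z
  obtain ⟨ψ⟩ := D.nonempty_algHom_of_finrank (K := K) (L := L) (E := K')
    (fun h => hW (by rw [hq, Nat.cast_mul, h, zero_mul]))
    -- With `|W| = [L : K] * q`, the `q`-th power of the root of order `|W|` is a root of order `[L
    -- : K]` of the uniformizer.
    (algebraMap A' K' D'.unif ^ q) (by
      rw [← pow_mul, mul_comm, ← hq, ← map_pow, hunif, hKK'])
  have hψ : ∀ f, ∃ z, algebraMap A' K' z = ψ (xL f) := by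
    intro f
    have : IsIntegral A' (ψ (xL f)) := by
      obtain ⟨q, hq, hq0⟩ : IsIntegral C f := Algebra.IsIntegral.isIntegral f
      refine ⟨q.map (incl.comp y), hq.map _, ?_⟩
      rw [eval₂_map]
      have h2 := congrArg (ψ.toRingHom.comp xL) hq0
      rw [hom_eval₂, map_zero] at h2
      have h3 : (algebraMap A' K').comp (incl.comp y) =
          (ψ.toRingHom.comp xL).comp (algebraMap C T) := by
        ext c
        change algebraMap A' K' (incl (y c)) = ψ (xL (algebraMap C T c))
        rw [hxLC, ← hKK', AlgHom.commutes]
      rw [h3]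
      exact h2
    exact IsIntegrallyClosed.isIntegral_iff.mp this
  obtain ⟨x', hx'⟩ := exists_lift_of_injective (algebraMap A' K') hAK' (ψ.toRingHom.comp xL) hψ
  refine ⟨x', ?_⟩
  ext c
  refine hAK' ?_
  refine (RingHom.congr_fun hx' (algebraMap C T c)).trans ?_
  change ψ (xL (algebraMap C T c)) = _
  rw [hxLC, AlgHom.commutes, hKK']
  rfl

end Geometric

/-! ### The Weyl group action on the coordinate ring -/

section WeylAction

variable {ι : Type*} {M : Type w} {N : Type*} [AddCommGroup M] [AddCommGroup N]
  (P : RootDatum ι M N) (O : Type v) [CommRing O]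

instance weylMulSemiringAction : MulSemiringAction P.weylGroup (CoordT O P) where
  smul a f := weylAct P O a f
  one_smul f := by
    change weylAct P O 1 f = f
    rw [weylAct_one]
    rfl
  mul_smul a b f := by
    change weylAct P O (a * b) f = weylAct P O a (weylAct P O b f)
    rw [weylAct_mul]
    rfl
  smul_zero a := map_zero (weylAct P O a)
  smul_add a := map_add (weylAct P O a)
  smul_one a := map_one (weylAct P O a)
  smul_mul a := map_mul (weylAct P O a)

lemma weyl_smul_differential (a : P.weylGroup) (m : M) :
    a • differential P O m = differential P O ((a : P.Aut) • m) := weylAct_ι P O a 1 m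

instance : Algebra.IsInvariant (CoordC P O) (CoordT O P) P.weylGroup where
  isInvariant f hf := ⟨⟨f, hf⟩, rfl⟩

instance : SMulCommClass P.weylGroup (CoordC P O) (CoordT O P) where
  smul_comm a c f := by
    rw [Algebra.smul_def, Algebra.smul_def, smul_mul']
    congr 1
    exact c.2 a

instance : FaithfulSMul (CoordC P O) (CoordT O P) :=
  (faithfulSMul_iff_algebraMap_injective _ _).mpr Subtype.val_injective

lemma sub_pow_smul_mem_fixedIdeal {W B : Type*} [Group W] [CommRing B] [MulSemiringAction W B]
    (g : W) (b : B) (j : ℕ) : b - g ^ j • b ∈ fixedIdeal B g := by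
  induction j with
  | zero => simp
  | succ j ih =>
    rw [← sub_add_sub_cancel b (g ^ j • b)]
    refine add_mem ih ?_
    rw [pow_succ', mul_smul]
    exact Ideal.subset_span ⟨_, rfl⟩

variable [Fintype ι] [Module.Finite ℤ M] [P.IsReduced]

/-- The branch locus of `𝔱 → 𝔠` lies in the zero locus of the discriminant. -/
theorem discriminant_mem_fixedIdeal (hW : IsUnit (Nat.card P.weylGroup : O)) (g : P.weylGroup)
    (hg : g ≠ 1) :
    algebraMap (CoordC P O) (CoordT O P) (discriminant P O) ∈ fixedIdeal (CoordT O P) g := by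
  have hpow : (g : P.Aut) ^ Nat.card P.weylGroup = 1 := by
    rw [← Subgroup.coe_pow, pow_card_eq_one', Subgroup.coe_one]
  obtain ⟨i, hi⟩ := exists_pow_smul_sum_eq_zero (g : P.Aut) g.2
    (fun h => hg (Subtype.ext h)) hpow
  -- The subtracted orbit sum of the root vanishes. So `|W| dα` is a sum of elements of the fixed
  -- ideal, and `|W|` is invertible.
  have h1 : (Nat.card P.weylGroup : CoordT O P) * differential P O (P.root i) =
      ∑ j ∈ Finset.range (Nat.card P.weylGroup),
        (differential P O (P.root i) - g ^ j • differential P O (P.root i)) := by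
    have h2 : ∑ j ∈ Finset.range (Nat.card P.weylGroup),
        g ^ j • differential P O (P.root i) = 0 := by
      have h3 : ∀ m m' : M, differential P O (m + m') = differential P O m + differential P O m' :=
        fun m m' => by rw [differential, tmul_add, map_add]; rfl
      let dm : M →+ CoordT O P := AddMonoidHom.mk' (differential P O) h3
      have h4 : ∀ j, g ^ j • differential P O (P.root i) = dm ((g : P.Aut) ^ j • P.root i) :=
        fun j => weyl_smul_differential P O (g ^ j) _
      simp only [h4, ← map_sum, hi, map_zero]
    rw [Finset.sum_sub_distrib, h2, Finset.sum_const, Finset.card_range, sub_zero, nsmul_eq_mul]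
  have h5 : differential P O (P.root i) ∈ fixedIdeal (CoordT O P) g := by
    have hu : IsUnit (Nat.card P.weylGroup : CoordT O P) := by
      have := hW.map (algebraMap O (CoordT O P))
      rwa [map_natCast] at this
    rw [← (fixedIdeal (CoordT O P) g).unit_mul_mem_iff_mem hu, h1]
    exact sum_mem fun j _ => sub_pow_smul_mem_fixedIdeal g _ j
  change discriminantT P O ∈ _
  exact Ideal.mem_of_dvd _ (Finset.dvd_prod_of_mem _ (Finset.mem_univ i)) h5

end WeylAction

/-! ### Points over fields and integrality -/

/-- A perfect `κ`-algebra, as an object of the category of perfect `κ`-algebras. -/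
abbrev PerfAlg.of (p : ℕ) {κ : Type u} [CommRing κ] (A : Type u) [CommRing A] [Algebra κ A]
    [PerfectRing A p] : PerfAlg p κ := ⟨A⟩

/-- An algebra homomorphism, as a morphism of perfect algebras. -/
def PerfAlg.homMk {p : ℕ} {κ : Type u} [CommRing κ] {R S : PerfAlg p κ} (f : R →ₐ[κ] S) :
    R ⟶ S := f

section Comp

variable (p : ℕ) [Fact p.Prime] {κ : Type u} [CommRing κ] {O : Type v} [CommRing O]
  [Algebra (WittVector p κ) O]

lemma oWittMap_comp_apply {R S T : PerfAlg p κ} (φ : R ⟶ S) (ψ : S ⟶ T) (z : OWitt p O R) :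
    oWittMap p O (φ ≫ ψ) z = oWittMap p O ψ (oWittMap p O φ z) := by
  rw [oWittMap_comp]
  rfl

end Comp

section Field

variable (p : ℕ) [Fact p.Prime] {κ : Type u} [Field κ] [CharP κ p]

lemma perfectRing_of_isAlgClosed (k : Type u) [Field k] [IsAlgClosed k] [Algebra κ k] :
    PerfectRing k p := by
  have : CharP k p := charP_of_injective_algebraMap (algebraMap κ k).injective p
  have : ExpChar k p := ExpChar.prime Fact.out
  exact PerfectField.toPerfectRing p

/-- Every prime of a perfect algebra is the kernel of a morphism to an algebraically closed
field. -/
lemma exists_geometric_point (S : PerfAlg p κ) (q : Ideal S) [q.IsPrime] :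
    ∃ (k : Type u) (_ : Field k) (_ : IsAlgClosed k) (_ : Algebra κ k) (_ : PerfectRing k p)
      (ψ : S ⟶ PerfAlg.of p k), RingHom.ker (PerfAlg.toAlgHom ψ).toRingHom = q := by
  let k := AlgebraicClosure q.ResidueField
  have := perfectRing_of_isAlgClosed p (κ := κ) k
  refine ⟨k, inferInstance, inferInstance, inferInstance, this,
    PerfAlg.homMk (IsScalarTower.toAlgHom κ S k), ?_⟩
  ext s
  change algebraMap S k s = 0 ↔ _
  rw [IsScalarTower.algebraMap_apply S q.ResidueField k, map_eq_zero,
    Ideal.algebraMap_residueField_eq_zero]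

end Field

/-- The action is free where `d` does not vanish. -/
lemma eq_one_of_map_smul_eq {C T W Ω : Type*} [CommRing C] [CommRing T] [Algebra C T] [Group W]
    [MulSemiringAction W T] [CommRing Ω] {d : C}
    (hd : ∀ g : W, g ≠ 1 → algebraMap C T d ∈ fixedIdeal T g) (x : T →+* Ω)
    (hxd : x (algebraMap C T d) ≠ 0) {g : W} (h : ∀ f, x (g • f) = x f) : g = 1 := by
  by_contra hg
  have hle : fixedIdeal T g ≤ RingHom.ker x := by
    rw [fixedIdeal, Ideal.span_le]
    rintro _ ⟨b, rfl⟩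
    rw [SetLike.mem_coe, RingHom.mem_ker, map_sub, h, sub_self]
  exact hxd (hle (hd g hg))

namespace Ramified

variable {p : ℕ} [Fact p.Prime] {κ : Type u} [Field κ] [CharP κ p] [PerfectRing κ p]
  {O : Type v} [CommRing O] [Algebra (WittVector p κ) O] (E : Ramified (κ := κ) p O)

section OverField

variable {k : Type u} [Field k] [Algebra κ k] [PerfectRing k p]

include E in
lemma charZero_oWitt : CharZero (OWitt p O (PerfAlg.of (κ := κ) p k)) := by
  let D : WittLike (OWitt p O (PerfAlg.of (κ := κ) p k)) k := E.oWitt (PerfAlg.of p k)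
  have := D.isDomain
  have : CharP k p := charP_of_injective_algebraMap (algebraMap κ k).injective p
  refine charZero_of_ringHom p D.res fun h => ?_
  have h1 : D.unif ^ E.index = 0 := by
    change (E.oWitt (PerfAlg.of p k)).unif ^ E.index = 0
    rw [E.oWitt_unif, ← map_pow, E.pow_index, map_mul, map_natCast, h, zero_mul]
  exact D.unif_ne_zero (eq_zero_of_pow_eq_zero h1)

lemma oWittIncl_injective {a : ℕ} (ha : a ≠ 0) :
    Function.Injective (oWittIncl p E.series.unif a (PerfAlg.of (κ := κ) p k)) := by
  let D : WittLike (OWitt p O (PerfAlg.of (κ := κ) p k)) k := E.oWitt (PerfAlg.of p k)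
  let D' : WittLike (OWittExt p E.series.unif a (PerfAlg.of (κ := κ) p k)) k :=
    E.oWittExt ha (PerfAlg.of p k)
  have := D'.isDomain
  rw [injective_iff_map_eq_zero]
  intro z hz
  by_contra hne
  obtain ⟨m, c, rfl, hc⟩ := D.exists_eq_unif_pow_mul hne
  rw [map_mul, map_pow] at hz
  have h1 : D'.unif ^ a = oWittIncl p E.series.unif a (PerfAlg.of p k) D.unif :=
    E.oWittExt_unif_pow ha _
  rw [← h1] at hz
  have h2 := (mul_eq_zero.mp hz).resolve_left (pow_ne_zero _ (pow_ne_zero _ D'.unif_ne_zero))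
  refine hc ?_
  have h3 := E.oWittExt_res_incl ha (PerfAlg.of p k) c
  rw [h2, map_zero] at h3
  exact h3.symm

end OverField

variable {T C W : Type*} [CommRing T] [CommRing C] [Algebra C T] [Group W] [Finite W]
  [MulSemiringAction W T] [Algebra.IsInvariant C T W] [SMulCommClass W C T] [FaithfulSMul C T]
  {d : C} {n : ℕ}

lemma map_associated {R S : PerfAlg p κ} (φ : R ⟶ S) {z : OWitt p O R}
    (h : Associated (algebraMap O (OWitt p O R) (E.series.unif ^ n)) z) :
    Associated (algebraMap O (OWitt p O S) (E.series.unif ^ n)) (oWittMap p O φ z) := by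
  have h := h.map (oWittMap p O φ)
  rwa [AlgHom.commutes] at h

lemma ne_zero_of_associated {k : Type u} [Field k] [Algebra κ k] [PerfectRing k p]
    {z : OWitt p O (PerfAlg.of (κ := κ) p k)}
    (h : Associated (algebraMap O (OWitt p O (PerfAlg.of (κ := κ) p k)) (E.series.unif ^ n)) z) :
    z ≠ 0 := by
  let D : WittLike (OWitt p O (PerfAlg.of (κ := κ) p k)) k := E.oWitt (PerfAlg.of p k)
  have := D.isDomain
  refine h.ne_zero_iff.mp ?_
  rw [map_pow, ← E.oWitt_unif]
  exact pow_ne_zero _ D.unif_ne_zero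

lemma incl_ne_zero_of_associated {k : Type u} [Field k] [Algebra κ k] [PerfectRing k p] {a : ℕ}
    (ha : a ≠ 0) {z : OWitt p O (PerfAlg.of (κ := κ) p k)}
    (h : Associated (algebraMap O (OWitt p O (PerfAlg.of (κ := κ) p k)) (E.series.unif ^ n)) z) :
    oWittIncl p E.series.unif a (PerfAlg.of (κ := κ) p k) z ≠ 0 :=
  (map_ne_zero_iff _ (E.oWittIncl_injective ha)).mpr (E.ne_zero_of_associated h)

lemma exists_point_of_isAlgClosed {k : Type u} [Field k] [IsAlgClosed k] [Algebra κ k]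
    [PerfectRing k p] (hW : (Nat.card W : κ) ≠ 0)
    (hd : ∀ g : W, g ≠ 1 → algebraMap C T d ∈ fixedIdeal T g)
    (y : C →+* OWitt p O (PerfAlg.of (κ := κ) p k))
    (hy : Associated (algebraMap O _ (E.series.unif ^ n)) (y d)) :
    ∃ x : T →+* OWittExt p E.series.unif (Nat.card W) (PerfAlg.of (κ := κ) p k),
      ∀ c, x (algebraMap C T c) = oWittIncl p E.series.unif (Nat.card W) _ (y c) := by
  have ha : Nat.card W ≠ 0 := Nat.card_pos.ne'
  have := E.charZero_oWitt (k := k)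
  obtain ⟨x, hx⟩ := exists_point (W := W) (A := OWitt p O (PerfAlg.of (κ := κ) p k))
    (A' := OWittExt p E.series.unif (Nat.card W) (PerfAlg.of (κ := κ) p k)) (k := k)
    (E.oWitt (PerfAlg.of p k)) (E.oWittExt ha (PerfAlg.of p k))
    (oWittIncl p E.series.unif (Nat.card W) (PerfAlg.of (κ := κ) p k)).toRingHom
    (by
      have := (map_ne_zero (algebraMap κ k)).mpr hW
      rwa [map_natCast] at this)
    (E.oWittIncl_injective ha) (E.oWittExt_unif_pow ha _) hd y (E.ne_zero_of_associated hy)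
  exact ⟨x, RingHom.congr_fun hx⟩

end Ramified

/-- Non-integrality over `R` is detected by a valuation. -/
lemma exists_valuationSubring_of_not_isIntegralElem {R S : Type*} [CommRing R] [CommRing S]
    (φ : R →+* S) {s : S} (hs : ¬ φ.IsIntegralElem s) :
    ∃ q : Ideal S, q.IsPrime ∧ ∀ {L : Type u} [Field L] (ψ : S →+* L), RingHom.ker ψ = q →
      ∃ V : ValuationSubring L, (∀ r, ψ (φ r) ∈ V) ∧ ψ s ∉ V := by
  -- That `s` is not integral means exactly that `0` is not a monic polynomial in `s`. A prime
  -- missing all monic polynomials in `s` keeps it non-integral in every field whose map from `S`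
  -- has kernel `q`.
  let M : Submonoid S :=
    { carrier := {t | ∃ f : R[X], f.Monic ∧ f.eval₂ φ s = t}
      one_mem' := ⟨1, monic_one, eval₂_one _ _⟩
      mul_mem' := by
        rintro _ _ ⟨f, hf, rfl⟩ ⟨g, hg, rfl⟩
        exact ⟨f * g, hf.mul hg, eval₂_mul _ _⟩ }
  have hM : Disjoint ((⊥ : Ideal S) : Set S) (M : Set S) := by
    rw [Set.disjoint_left]
    rintro t ht ⟨f, hf, hft⟩
    refine hs ⟨f, hf, hft.trans ?_⟩
    simpa using ht
  obtain ⟨q, hq, -, hqM⟩ := Ideal.exists_le_prime_disjoint ⊥ M hM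
  refine ⟨q, hq, fun {L} _ ψ hψ => ?_⟩
  let _ : Algebra R L := (ψ.comp φ).toAlgebra
  have hint : ψ s ∉ (integralClosure R L).toSubring := by
    rintro ⟨f, hf, hf0⟩
    have h1 : ψ (f.eval₂ φ s) = 0 := by
      rw [hom_eval₂]
      exact hf0
    exact Set.disjoint_left.mp hqM (hψ ▸ h1 : f.eval₂ φ s ∈ q) ⟨f, hf, rfl⟩
  have : IsIntegrallyClosedIn (integralClosure R L).toSubring L :=
    inferInstanceAs (IsIntegrallyClosedIn (integralClosure R L) L)
  obtain ⟨V, hV, hsV⟩ := Subring.exists_le_valuationSubring_of_isIntegrallyClosedIn hint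
  exact ⟨V, fun r => hV ((integralClosure R L).algebraMap_mem r), hsV⟩

lemma valuationSubring_mem_of_pow_mem {L : Type*} [Field L] (V : ValuationSubring L) {x : L} {m : ℕ}
    (hm : m ≠ 0) (hx : x ^ m ∈ V) : x ∈ V := by
  have h1 : IsIntegral V (x ^ m) := isIntegral_algebraMap (x := (⟨x ^ m, hx⟩ : V))
  obtain ⟨z, rfl⟩ := IsIntegrallyClosed.isIntegral_iff.mp (h1.of_pow (Nat.pos_of_ne_zero hm))
  exact z.2

/-- Lift a monic polynomial to `V`; a root in `L` is integral over `V`, so it lies in `V` and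
reduces. -/
instance isAlgClosed_residueField {L : Type*} [Field L] [IsAlgClosed L] (V : ValuationSubring L) :
    IsAlgClosed (IsLocalRing.ResidueField V) := by
  refine IsAlgClosed.of_exists_root _ fun f hf hirr => ?_
  obtain ⟨F, hF, hdeg, hFm⟩ := lifts_and_natDegree_eq_and_monic
    ((lifts_iff_set_range (f := IsLocalRing.residue V) _).mpr
      (map_surjective _ IsLocalRing.residue_surjective f)) hf
  have hF0 : (F.map (algebraMap V L)).degree ≠ 0 := by
    rw [hFm.degree_map, degree_eq_natDegree hFm.ne_zero, hdeg]
    exact_mod_cast hirr.natDegree_pos.ne'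
  obtain ⟨z, hz⟩ := IsAlgClosed.exists_root _ hF0
  rw [IsRoot, Polynomial.eval_map] at hz
  obtain ⟨z, rfl⟩ := IsIntegrallyClosed.isIntegral_iff.mp (⟨F, hFm, hz⟩ : IsIntegral V z)
  refine ⟨IsLocalRing.residue V z, ?_⟩
  rw [← hF, Polynomial.eval_map, eval₂_at_apply]
  rw [eval₂_at_apply] at hz
  rw [(IsFractionRing.injective V L) (hz.trans (map_zero _).symm), map_zero]

namespace Ramified

variable {p : ℕ} [Fact p.Prime] {κ : Type u} [Field κ] [CharP κ p] [PerfectRing κ p]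
  {O : Type v} [CommRing O] [Algebra (WittVector p κ) O] (E : Ramified (κ := κ) p O)

variable {T C W : Type*} [CommRing T] [CommRing C] [Algebra C T] [Group W] [Finite W]
  [MulSemiringAction W T] [Algebra.IsInvariant C T W] [SMulCommClass W C T] [FaithfulSMul C T]
  {d : C} {n : ℕ}

/-- The residue field of `V` is algebraically closed, so the special fibre of the arc has a lift
`xk`, and `mem_range_of_valuationRing` compares `x` with it. -/
lemma mem_range_of_valuationSubring (hW : (Nat.card W : κ) ≠ 0)
    (hd : ∀ g : W, g ≠ 1 → algebraMap C T d ∈ fixedIdeal T g)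
    {L : Type u} [Field L] [IsAlgClosed L] [Algebra κ L] [PerfectRing L p] (V : ValuationSubring L)
    [Algebra κ V] [IsScalarTower κ V L] [PerfectRing V p]
    (y : C →+* OWitt p O (PerfAlg.of (κ := κ) p V))
    (hy : Associated (algebraMap O _ (E.series.unif ^ n)) (y d))
    (x : T →+* OWittExt p E.series.unif (Nat.card W) (PerfAlg.of (κ := κ) p L))
    (hx : ∀ c, x (algebraMap C T c) = oWittIncl p E.series.unif (Nat.card W) _
      (oWittMap p O (PerfAlg.homMk (R := PerfAlg.of (κ := κ) p V) (S := PerfAlg.of (κ := κ) p L)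
        (IsScalarTower.toAlgHom κ V L)) (y c)))
    (f : T) (j : ℕ) : (E.oWittExt (Nat.card_pos (α := W)).ne' _).coef (x f) j ∈ V := by
  have ha : Nat.card W ≠ 0 := Nat.card_pos.ne'
  cases nonempty_fintype W
  let k := IsLocalRing.ResidueField V
  have := perfectRing_of_isAlgClosed p (κ := κ) k
  let α : PerfAlg.of (κ := κ) p V ⟶ PerfAlg.of (κ := κ) p L :=
    PerfAlg.homMk (IsScalarTower.toAlgHom κ V L)
  let β : PerfAlg.of (κ := κ) p V ⟶ PerfAlg.of (κ := κ) p k :=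
    PerfAlg.homMk (IsScalarTower.toAlgHom κ V k)
  have hyk := E.map_associated β hy
  obtain ⟨xk, hxk⟩ := E.exists_point_of_isAlgClosed hW hd
    ((oWittMap p O β).toRingHom.comp y) hyk
  obtain ⟨r, xs, ys, m, hxy, hxy'⟩ := exists_galois_coordinates (W := W) hd
  obtain ⟨u, hu⟩ := hy
  have hV : IsDomain (PerfAlg.of (κ := κ) p V) := inferInstanceAs (IsDomain V)
  have key := mem_range_of_valuationRing (W := W) (L := L) (k := k) (V := V)
    (A := OWittExt p E.series.unif (Nat.card W) (PerfAlg.of (κ := κ) p V))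
    (A' := OWittExt p E.series.unif (Nat.card W) (PerfAlg.of (κ := κ) p L))
    (Ak := OWittExt p E.series.unif (Nat.card W) (PerfAlg.of (κ := κ) p k))
    (D := E.oWittExt ha (PerfAlg.of p V)) (D' := E.oWittExt ha (PerfAlg.of p L))
    (Dk := E.oWittExt ha (PerfAlg.of p k))
    (i := (oWittExtMap p E.series.unif _ α).toRingHom)
    (E.isMap_oWittExt ha α) (j := (oWittExtMap p E.series.unif _ β).toRingHom)
    (ρ := IsLocalRing.residue V)
    (E.isMap_oWittExt ha β) IsLocalRing.residue_surjective
    (fun v => by rw [IsLocalRing.residue_eq_zero_iff]; rfl) x xk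
    (fun f hf => by
      obtain ⟨c, rfl⟩ := Algebra.IsInvariant.isInvariant (A := C) (G := W) f hf
      refine ⟨oWittIncl p E.series.unif _ _ (y c), ?_, ?_⟩
      · rw [hx]
        exact E.oWittExtMap_incl_apply α _
      · rw [hxk]
        exact E.oWittExtMap_incl_apply β _)
    hxy hxy' (fun g => by rw [← map_pow, smul_algebraMap])
    -- Here `δ = d ^ m`, the value of `d` is `ϖ ^ n` times a unit, and `ϖ` is the power of exponent
    -- `|W|` of the new uniformizer.
    (N := Nat.card W * n * m)
    (u := oWittIncl p E.series.unif _ _ (u ^ m))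
    ((u ^ m).isUnit.map _)
    (by
      rw [← map_pow, hx, map_pow y, ← hu]
      change _ = _ * oWittExtMap p E.series.unif _ α _
      rw [E.oWittExtMap_incl_apply, pow_mul, pow_mul, E.oWittExt_unif_pow ha, E.oWitt_unif]
      simp only [map_mul, map_pow, mul_pow, AlgHom.commutes]
      rfl)
    (by
      rw [← map_pow, hxk, map_pow, map_pow]
      have := (E.oWittExt ha (PerfAlg.of (κ := κ) p k)).isDomain
      exact pow_ne_zero _ (E.incl_ne_zero_of_associated ha hyk)) f
  obtain ⟨v, hv⟩ := (E.isMap_oWittExt ha α).mem_range_iff.mp key j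
  rw [← hv]
  exact v.2

/-- A valuative criterion: if the coefficient were not integral, some valuation ring of an
algebraically closed field over `S` would contain the image of `R` but not the coefficient, against
`mem_range_of_valuationSubring`. -/
theorem isIntegralElem_coef (hW : (Nat.card W : κ) ≠ 0)
    (hd : ∀ g : W, g ≠ 1 → algebraMap C T d ∈ fixedIdeal T g) {R S : PerfAlg p κ} (φ : R ⟶ S)
    (y : C →+* OWitt p O R) (hy : Associated (algebraMap O _ (E.series.unif ^ n)) (y d))
    (x : T →+* OWittExt p E.series.unif (Nat.card W) S)
    (hx : ∀ c, x (algebraMap C T c) = oWittIncl p E.series.unif (Nat.card W) _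
      (oWittMap p O φ (y c))) (f : T) (j : ℕ) :
    (PerfAlg.toAlgHom φ).toRingHom.IsIntegralElem
      ((E.oWittExt (Nat.card_pos (α := W)).ne' S).coef (x f) j) := by
  have ha : Nat.card W ≠ 0 := Nat.card_pos.ne'
  by_contra hcon
  obtain ⟨q, hq, hqV⟩ := exists_valuationSubring_of_not_isIntegralElem _ hcon
  obtain ⟨L, _, _, _, _, ψ, hψ⟩ := exists_geometric_point p S q
  obtain ⟨V, hV, hxV⟩ := hqV (PerfAlg.toAlgHom ψ).toRingHom hψ
  have hκ : ∀ c, algebraMap κ L c ∈ V := fun c => by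
    have h := hV (algebraMap κ R c)
    change PerfAlg.toAlgHom ψ (PerfAlg.toAlgHom φ (algebraMap κ R c)) ∈ V at h
    rwa [AlgHom.commutes, AlgHom.commutes] at h
  let _ : Algebra κ V := ((algebraMap κ L).codRestrict V hκ).toAlgebra
  have : IsScalarTower κ V L := IsScalarTower.of_algebraMap_eq fun _ => rfl
  have : PerfectRing V p := by
    refine ⟨fun a b hab => ?_, fun b => ?_⟩
    · refine Subtype.ext ((PerfectRing.bijective_frobenius (R := L) (p := p)).1 ?_)
      exact congrArg Subtype.val hab
    · obtain ⟨c, hc⟩ := (PerfectRing.bijective_frobenius (R := L) (p := p)).2 (b : L)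
      refine ⟨⟨c, valuationSubring_mem_of_pow_mem V (Nat.Prime.ne_zero (Fact.out : p.Prime)) ?_⟩,
        Subtype.ext hc⟩
      change c ^ p = b at hc
      rw [hc]
      exact b.2
  let γ : R ⟶ PerfAlg.of p V := PerfAlg.homMk
    { ((PerfAlg.toAlgHom ψ).comp (PerfAlg.toAlgHom φ)).toRingHom.codRestrict V hV with
      commutes' := fun c => Subtype.ext
        (((PerfAlg.toAlgHom ψ).comp (PerfAlg.toAlgHom φ)).commutes c) }
  let α : PerfAlg.of (κ := κ) p V ⟶ PerfAlg.of (κ := κ) p L :=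
    PerfAlg.homMk (IsScalarTower.toAlgHom κ V L)
  have hα : γ ≫ α = φ ≫ ψ := rfl
  have key := E.mem_range_of_valuationSubring hW hd V ((oWittMap p O γ).toRingHom.comp y)
    (E.map_associated γ hy) ((oWittExtMap p E.series.unif _ ψ).toRingHom.comp x) (fun c => by
      change oWittExtMap p E.series.unif _ ψ (x _) = oWittIncl p E.series.unif _ _
        (oWittMap p O α (oWittMap p O γ (y c)))
      rw [hx, E.oWittExtMap_incl_apply,
        ← oWittMap_comp_apply, ← oWittMap_comp_apply, hα]) f j
  refine hxV ?_
  rw [← (E.isMap_oWittExt ha ψ).coef_map]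
  exact key

end Ramified

/-! ### The perfect algebra generated by the coefficients of a point -/

section PerfectClosure

variable (p : ℕ) {R S : Type*} [CommRing R] [CommRing S] [Algebra R S]

/-- The `R`-algebra generated by the `p`-power roots of the elements of `Z`. -/
def perfectAdjoin (R : Type*) {S : Type*} [CommRing R] [CommRing S] [Algebra R S] (Z : Set S) :
    Subalgebra R S :=
  Algebra.adjoin R {s | ∃ m : ℕ, s ^ p ^ m ∈ Z}

lemma subset_perfectAdjoin (Z : Set S) : Z ⊆ perfectAdjoin p R Z := fun z hz =>
  Algebra.subset_adjoin ⟨0, by rwa [pow_zero, pow_one]⟩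

lemma isIntegral_perfectAdjoin [Fact p.Prime] {Z : Set S} (hZ : ∀ z ∈ Z, IsIntegral R z) :
    Algebra.IsIntegral R (perfectAdjoin p R Z) := by
  refine Algebra.IsIntegral.adjoin ?_
  rintro s ⟨m, hm⟩
  exact (hZ _ hm).of_pow (pow_pos (Nat.Prime.pos Fact.out) m)

lemma perfectRing_perfectAdjoin [Fact p.Prime] [CharP S p] [PerfectRing R p] [PerfectRing S p]
    (Z : Set S) : PerfectRing (perfectAdjoin p R Z) p := by
  have hp0 : p ≠ 0 := Nat.Prime.ne_zero Fact.out
  refine ⟨fun a b hab => Subtype.ext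
    ((PerfectRing.bijective_frobenius (R := S) (p := p)).1 (congrArg Subtype.val hab)), ?_⟩
  suffices h : ∀ b ∈ perfectAdjoin p R Z, ∃ c ∈ perfectAdjoin p R Z, c ^ p = b by
    rintro ⟨b, hb⟩
    obtain ⟨c, hc, hcb⟩ := h b hb
    exact ⟨⟨c, hc⟩, Subtype.ext hcb⟩
  intro b hb
  induction hb using Algebra.adjoin_induction with
  | mem s hs =>
    obtain ⟨m, hm⟩ := hs
    obtain ⟨c, hc⟩ := (PerfectRing.bijective_frobenius (R := S) (p := p)).2 s
    change c ^ p = s at hc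
    exact ⟨c, Algebra.subset_adjoin ⟨m + 1, by rwa [pow_succ', pow_mul, hc]⟩, hc⟩
  | algebraMap r =>
    obtain ⟨c, hc⟩ := (PerfectRing.bijective_frobenius (R := R) (p := p)).2 r
    exact ⟨_, Subalgebra.algebraMap_mem _ c, by rw [← map_pow]; exact congrArg _ hc⟩
  | add x y _ _ hx hy =>
    obtain ⟨a, ha, rfl⟩ := hx
    obtain ⟨b, hb, rfl⟩ := hy
    exact ⟨a + b, add_mem ha hb, add_pow_char a b p⟩
  | mul x y _ _ hx hy =>
    obtain ⟨a, ha, rfl⟩ := hx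
    obtain ⟨b, hb, rfl⟩ := hy
    exact ⟨a * b, mul_mem ha hb, mul_pow a b p⟩

lemma smul_mem_perfectAdjoin {W : Type*} [Group W] [MulSemiringAction W S] [SMulCommClass W R S]
    {Z : Set S} (hZ : ∀ (g : W), ∀ z ∈ Z, g • z ∈ Z) (g : W) {s : S}
    (hs : s ∈ perfectAdjoin p R Z) : g • s ∈ perfectAdjoin p R Z := by
  induction hs using Algebra.adjoin_induction with
  | mem s hs =>
    obtain ⟨m, hm⟩ := hs
    exact Algebra.subset_adjoin ⟨m, by rw [← smul_pow']; exact hZ g _ hm⟩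
  | algebraMap r =>
    rw [smul_algebraMap]
    exact Subalgebra.algebraMap_mem _ r
  | add x y _ _ hx hy => rw [smul_add]; exact add_mem hx hy
  | mul x y _ _ hx hy => rw [smul_mul']; exact mul_mem hx hy

/-- Homomorphisms to a perfect ring are determined by their values on `R` and `Z`. -/
lemma hom_ext_perfectAdjoin [Fact p.Prime] {k : Type*} [CommRing k] [PerfectRing k p] {Z : Set S}
    {φ ψ : perfectAdjoin p R Z →+* k} (hR : ∀ r, φ (algebraMap R _ r) = ψ (algebraMap R _ r))
    (hZ : ∀ z (hz : z ∈ Z), φ ⟨z, subset_perfectAdjoin p Z hz⟩ =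
      ψ ⟨z, subset_perfectAdjoin p Z hz⟩) : φ = ψ := by
  ext ⟨s, hs⟩
  induction hs using Algebra.adjoin_induction with
  | mem s hs =>
    obtain ⟨m, hm⟩ := hs
    have hinj : ∀ (m : ℕ) (a b : k), a ^ p ^ m = b ^ p ^ m → a = b := by
      intro m
      induction m with
      | zero => simp
      | succ m ih =>
        intro a b hab
        rw [pow_succ, pow_mul, pow_mul] at hab
        exact ih a b ((PerfectRing.bijective_frobenius (R := k) (p := p)).1 hab)
    refine hinj m _ _ ?_
    rw [← map_pow, ← map_pow]
    exact hZ _ hm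
  | algebraMap r => exact hR r
  | add x y hx' hy' hx hy =>
    have : (⟨x + y, add_mem hx' hy'⟩ : perfectAdjoin p R Z) = ⟨x, hx'⟩ + ⟨y, hy'⟩ := rfl
    rw [this, map_add, map_add, hx, hy]
  | mul x y hx' hy' hx hy =>
    have : (⟨x * y, mul_mem hx' hy'⟩ : perfectAdjoin p R Z) = ⟨x, hx'⟩ * ⟨y, hy'⟩ := rfl
    rw [this, map_mul, map_mul, hx, hy]

/-- The action on a stable subalgebra. -/
abbrev subalgebraMulSemiringAction {W : Type*} [Group W] [MulSemiringAction W S]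
    (B : Subalgebra R S) (hB : ∀ (g : W), ∀ s ∈ B, g • s ∈ B) : MulSemiringAction W B where
  smul g s := ⟨g • s.1, hB g s.1 s.2⟩
  one_smul s := Subtype.ext (one_smul W s.1)
  mul_smul g h s := Subtype.ext (mul_smul g h s.1)
  smul_zero g := Subtype.ext (smul_zero g)
  smul_add g s t := Subtype.ext (smul_add g s.1 t.1)
  smul_one g := Subtype.ext (smul_one g)
  smul_mul g s t := Subtype.ext (smul_mul' g s.1 t.1)

end PerfectClosure

namespace Ramified

variable {p : ℕ} [Fact p.Prime] {κ : Type u} [Field κ] [CharP κ p] [PerfectRing κ p]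
  {O : Type v} [CommRing O] [Algebra (WittVector p κ) O] (E : Ramified (κ := κ) p O)

variable {T C W : Type*} [CommRing T] [CommRing C] [Algebra C T] [Group W] [Finite W]
  [MulSemiringAction W T] [Algebra.IsInvariant C T W] [SMulCommClass W C T] [FaithfulSMul C T]
  {d : C} {n : ℕ}

/-- Two points over the same base point over a field differ by an element of `W`. -/
lemma exists_smul_eq {k : Type u} [Field k] [Algebra κ k] [PerfectRing k p]
    (x x' : T →+* OWittExt p E.series.unif (Nat.card W) (PerfAlg.of (κ := κ) p k))
    (h : ∀ c, x' (algebraMap C T c) = x (algebraMap C T c)) : ∃ g : W, ∀ f, x' f = x (g • f) := by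
  have ha : Nat.card W ≠ 0 := Nat.card_pos.ne'
  have := (E.oWittExt ha (PerfAlg.of (κ := κ) p k)).isDomain
  refine exists_smul_of_eq_on_invariants x x' fun f hf => ?_
  obtain ⟨c, rfl⟩ := Algebra.IsInvariant.isInvariant (A := C) (G := W) f hf
  exact h c

lemma eq_one_of_smul_eq {k : Type u} [Field k] [Algebra κ k] [PerfectRing k p]
    (hd : ∀ g : W, g ≠ 1 → algebraMap C T d ∈ fixedIdeal T g)
    {y : OWitt p O (PerfAlg.of (κ := κ) p k)}
    (hy : Associated (algebraMap O _ (E.series.unif ^ n)) y)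
    (x : T →+* OWittExt p E.series.unif (Nat.card W) (PerfAlg.of (κ := κ) p k))
    (hx : x (algebraMap C T d) = oWittIncl p E.series.unif (Nat.card W) _ y)
    {g : W} (h : ∀ f, x (g • f) = x f) : g = 1 := by
  refine eq_one_of_map_smul_eq hd x ?_ h
  rw [hx]
  exact E.incl_ne_zero_of_associated Nat.card_pos.ne' hy

/-- The coefficients of a point on which the actions of `W` on the coordinates and on the
coefficients agree generate an étale cover. -/
theorem exists_etale_cover_of_equivariant (hW : (Nat.card W : κ) ≠ 0)
    (hd : ∀ g : W, g ≠ 1 → algebraMap C T d ∈ fixedIdeal T g) {R S : PerfAlg p κ} [Nontrivial R]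
    (φ : R ⟶ S) (hφ : Function.Injective (PerfAlg.toAlgHom φ)) [MulSemiringAction W S]
    (hfix : ∀ (g : W) r, g • PerfAlg.toAlgHom φ r = PerfAlg.toAlgHom φ r)
    (y : C →+* OWitt p O R) (hy : Associated (algebraMap O _ (E.series.unif ^ n)) (y d))
    (x : T →+* OWittExt p E.series.unif (Nat.card W) S)
    (hx : ∀ c, x (algebraMap C T c) = oWittIncl p E.series.unif (Nat.card W) _
      (oWittMap p O φ (y c)))
    (hact : ∀ (g : W) f j, g • (E.oWittExt (Nat.card_pos (α := W)).ne' S).coef (x f) j =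
      (E.oWittExt (Nat.card_pos (α := W)).ne' S).coef (x (g • f)) j) :
    ∃ (B : PerfAlg p κ) (ψ : R ⟶ B), (PerfAlg.toAlgHom ψ).toRingHom.Etale ∧
      Function.Surjective (PrimeSpectrum.comap (PerfAlg.toAlgHom ψ).toRingHom) ∧
      ∃ x' : T →+* OWittExt p E.series.unif (Nat.card W) B, ∀ c, x' (algebraMap C T c) =
        oWittIncl p E.series.unif (Nat.card W) _ (oWittMap p O ψ (y c)) := by
  have ha : Nat.card W ≠ 0 := Nat.card_pos.ne'
  cases nonempty_fintype W
  have hS : Nontrivial S := hφ.nontrivial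
  have hcR : CharP R p := charP_of_injective_algebraMap (algebraMap κ R).injective p
  have hcS : CharP S p := charP_of_injective_algebraMap (algebraMap κ S).injective p
  let _ : Algebra R S := (PerfAlg.toAlgHom φ).toRingHom.toAlgebra
  have hRS : ∀ r, algebraMap R S r = PerfAlg.toAlgHom φ r := fun r => rfl
  have : IsScalarTower κ R S :=
    IsScalarTower.of_algebraMap_eq fun c => ((PerfAlg.toAlgHom φ).commutes c).symm
  have : SMulCommClass W R S := ⟨fun g r s => by
    rw [Algebra.smul_def, Algebra.smul_def, smul_mul', hRS, hfix]⟩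
  let Z : Set S := Set.range fun fj : T × ℕ => (E.oWittExt ha S).coef (x fj.1) fj.2
  let B₀ : Subalgebra R S := perfectAdjoin p R Z
  have hint : Algebra.IsIntegral R B₀ := isIntegral_perfectAdjoin p (by
    rintro _ ⟨⟨f, j⟩, rfl⟩
    exact E.isIntegralElem_coef hW hd φ y hy x hx f j)
  have : PerfectRing B₀ p := perfectRing_perfectAdjoin p Z
  let _ : MulSemiringAction W B₀ := subalgebraMulSemiringAction B₀ fun g s hs =>
    smul_mem_perfectAdjoin p (by
      rintro g _ ⟨⟨f, j⟩, rfl⟩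
      exact ⟨(g • f, j), (hact g f j).symm⟩) g hs
  have : SMulCommClass W R B₀ := ⟨fun g r s => Subtype.ext (smul_comm g r s.1)⟩
  have hinjB : Function.Injective (algebraMap R B₀) := fun r r' h =>
    hφ (congrArg Subtype.val h)
  have : FaithfulSMul R B₀ := (faithfulSMul_iff_algebraMap_injective _ _).mpr hinjB
  let B : PerfAlg p κ := PerfAlg.of p B₀
  let ψ : R ⟶ B := PerfAlg.homMk (IsScalarTower.toAlgHom κ R B₀)
  let ι : B ⟶ S := PerfAlg.homMk (B₀.val.restrictScalars κ)
  have hψι : ψ ≫ ι = φ := rfl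
  have hι : Function.Injective (PerfAlg.toAlgHom ι).toRingHom := Subtype.val_injective
  have hιmap := E.isMap_oWittExt ha ι
  have hιinj := hιmap.injective hι
  obtain ⟨x', hx'⟩ := exists_lift_of_injective (oWittExtMap p E.series.unif (Nat.card W) ι).toRingHom
    hιinj x (fun f => hιmap.mem_range_iff.mpr fun j =>
      ⟨⟨_, subset_perfectAdjoin p Z ⟨(f, j), rfl⟩⟩, rfl⟩)
  have hx'C : ∀ c, x' (algebraMap C T c) =
      oWittIncl p E.series.unif (Nat.card W) _ (oWittMap p O ψ (y c)) := fun c => hιinj (by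
    refine (RingHom.congr_fun hx' _).trans ?_
    rw [hx]
    refine Eq.trans ?_ (E.oWittExtMap_incl_apply ι _).symm
    rw [← oWittMap_comp_apply, hψι])
  have hcoef : ∀ f j, ((E.oWittExt ha B).coef (x' f) j : B₀).1 = (E.oWittExt ha S).coef (x f) j := by
    intro f j
    rw [← hx']
    exact (hιmap.coef_map _ j).symm
  have hact' : ∀ (g : W) f j, (g • ((E.oWittExt ha B).coef (x' f) j : B₀) : B₀) =
      (E.oWittExt ha B).coef (x' (g • f)) j := fun g f j => Subtype.ext (by
    rw [hcoef, ← hact, ← hcoef]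
    rfl)
  -- At a geometric point of the fixed locus of `g`, the lifts `x'` and `x' ∘ g` have the same
  -- coefficients, which contradicts freeness where `d ≠ 0`.
  have hfree : ∀ g : W, g ≠ 1 → fixedIdeal B₀ g = ⊤ := by
    intro g hg
    by_contra hne
    obtain ⟨q, hq, hgq⟩ := Ideal.exists_le_maximal _ hne
    have := hq.isPrime
    obtain ⟨k, _, _, _, _, χ, hχ⟩ := exists_geometric_point p B q
    refine hg (E.eq_one_of_smul_eq hd (E.map_associated (ψ ≫ χ) hy)
      ((oWittExtMap p E.series.unif _ χ).toRingHom.comp x') ?_ fun f =>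
        (E.oWittExt ha _).coef_injective fun j => ?_)
    · refine (congrArg (oWittExtMap p E.series.unif _ χ) (hx'C d)).trans ?_
      rw [E.oWittExtMap_incl_apply, ← oWittMap_comp_apply]
    · refine ((E.isMap_oWittExt ha χ).coef_map _ j).trans
        (Eq.trans ?_ ((E.isMap_oWittExt ha χ).coef_map _ j).symm)
      rw [← hact']
      have h1 : ((E.oWittExt ha B).coef (x' f) j : B₀) - g • ((E.oWittExt ha B).coef (x' f) j : B₀) ∈
          RingHom.ker (PerfAlg.toAlgHom χ).toRingHom := by
        rw [hχ]
        exact hgq (Ideal.subset_span ⟨_, rfl⟩)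
      rw [RingHom.mem_ker, map_sub, sub_eq_zero] at h1
      exact h1.symm
  -- The ring `I` of invariants is perfect and integral over `R`, so it suffices that its geometric
  -- points are determined on `R`. Two of them over the same point of `R` extend to `B₀` and push
  -- `x'` to two lifts of one arc. These differ by some `g`, and `g` acts trivially on `I`.
  have hinv : Algebra.IsInvariant R B₀ W := by
    let I : Subalgebra R B₀ := FixedPoints.subalgebra R B₀ W
    have hI : ∀ b : I, ∀ g : W, g • (b : B₀) = b := fun b => b.2
    have : PerfectRing I p := by
      refine ⟨fun a b hab => Subtype.ext
        ((PerfectRing.bijective_frobenius (R := B₀) (p := p)).1 (congrArg Subtype.val hab)), ?_⟩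
      intro b
      obtain ⟨c, hc⟩ := (PerfectRing.bijective_frobenius (R := B₀) (p := p)).2 b.1
      change c ^ p = b at hc
      refine ⟨⟨c, fun g => (PerfectRing.bijective_frobenius (R := B₀) (p := p)).1 ?_⟩,
        Subtype.ext hc⟩
      change (g • c) ^ p = c ^ p
      rw [← smul_pow', hc]
      exact hI b g
    have : Algebra.IsIntegral R I := ⟨fun b => by
      have := Algebra.IsIntegral.isIntegral (R := R) (b : B₀)
      exact (isIntegral_algHom_iff I.val Subtype.val_injective).mp this⟩
    have : FaithfulSMul R I := (faithfulSMul_iff_algebraMap_injective _ _).mpr fun r r' h =>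
      hinjB (congrArg Subtype.val h)
    have : Algebra.IsIntegral I B₀ := Algebra.IsIntegral.tower_top R
    have hsurj := surjective_of_unique_geometric_points p (A := R) (B := I) (by
      intro k _ _ χ₁ χ₂ hχ
      let _ : Algebra κ k := ((χ₁.comp (algebraMap R I)).comp (algebraMap κ R)).toAlgebra
      have := perfectRing_of_isAlgClosed p (κ := κ) k
      have hlift : ∀ χ : I →+* k, ∃ χ' : B₀ →+* k, χ'.comp (algebraMap I B₀) = χ := by
        intro χ
        have := RingHom.ker_isPrime χ
        obtain ⟨Q, -, hQ, hQχ⟩ := Ideal.exists_ideal_over_prime_of_isIntegral (S := B₀)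
          (RingHom.ker χ) ⊥ (by
            rw [← RingHom.ker_eq_comap_bot, (RingHom.injective_iff_ker_eq_bot _).mp
              (Subtype.val_injective : Function.Injective (algebraMap I B₀))]
            exact bot_le)
        obtain ⟨χ', h, -⟩ := exists_lift_of_isIntegral χ Q hQχ
        exact ⟨χ', h⟩
      obtain ⟨χ₁', h₁⟩ := hlift χ₁
      obtain ⟨χ₂', h₂⟩ := hlift χ₂
      have h₁R : ∀ r, χ₁' (algebraMap R B₀ r) = χ₁ (algebraMap R I r) := fun r =>
        RingHom.congr_fun h₁ (algebraMap R I r)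
      have h₂R : ∀ r, χ₂' (algebraMap R B₀ r) = χ₁ (algebraMap R I r) := fun r =>
        (RingHom.congr_fun h₂ (algebraMap R I r)).trans (RingHom.congr_fun hχ r).symm
      let α₁ : B ⟶ PerfAlg.of p k := PerfAlg.homMk { χ₁' with
        commutes' := fun c => by
          change χ₁' (algebraMap κ B₀ c) = _
          rw [IsScalarTower.algebraMap_apply κ R B₀, h₁R]
          rfl }
      let α₂ : B ⟶ PerfAlg.of p k := PerfAlg.homMk { χ₂' with
        commutes' := fun c => by
          change χ₂' (algebraMap κ B₀ c) = _
          rw [IsScalarTower.algebraMap_apply κ R B₀, h₂R]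
          rfl }
      have hα : ψ ≫ α₁ = ψ ≫ α₂ := AlgHom.ext fun r => (h₁R r).trans (h₂R r).symm
      obtain ⟨g, hg⟩ := E.exists_smul_eq (C := C) (W := W)
        ((oWittExtMap p E.series.unif _ α₁).toRingHom.comp x')
        ((oWittExtMap p E.series.unif _ α₂).toRingHom.comp x') (fun c => by
          change oWittExtMap p E.series.unif _ α₂ (x' _) = oWittExtMap p E.series.unif _ α₁ (x' _)
          rw [hx'C, E.oWittExtMap_incl_apply, E.oWittExtMap_incl_apply, ← oWittMap_comp_apply,
            ← oWittMap_comp_apply, hα])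
      -- A map from `B₀` to a field is determined by `R` and the coefficients of `x`, and on these
      -- the two points differ by `g`.
      have key : χ₂' = χ₁'.comp (MulSemiringAction.toRingHom W B₀ g) := by
        refine hom_ext_perfectAdjoin p (fun r => ?_) ?_
        · change χ₂' (algebraMap R B₀ r) = χ₁' (g • algebraMap R B₀ r)
          rw [smul_algebraMap, h₁R, h₂R]
        · rintro _ ⟨⟨f, j⟩, rfl⟩
          have h3 : (⟨(E.oWittExt ha S).coef (x f) j, subset_perfectAdjoin p Z ⟨(f, j), rfl⟩⟩ : B₀) =
              (E.oWittExt ha B).coef (x' f) j := Subtype.ext (hcoef f j).symm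
          change χ₂' ⟨(E.oWittExt ha S).coef (x f) j, _⟩ =
            χ₁' (g • ⟨(E.oWittExt ha S).coef (x f) j, _⟩)
          rw [h3, hact']
          have h4 := congrArg (fun z => (E.oWittExt ha (PerfAlg.of p k)).coef z j) (hg f)
          exact ((E.isMap_oWittExt ha α₂).coef_map _ j).symm.trans
            (h4.trans ((E.isMap_oWittExt ha α₁).coef_map _ j))
      rw [← h₁, ← h₂]
      ext b
      change χ₁' b = χ₂' b
      rw [key]
      exact congrArg χ₁' (hI b g).symm)
    refine ⟨fun b hb => ?_⟩
    obtain ⟨r, hr⟩ := hsurj ⟨b, hb⟩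
    exact ⟨r, congrArg Subtype.val hr⟩
  refine ⟨B, ψ, etale_of_fixedIdeal_eq_top (W := W) R hfree, ?_, x', hx'C⟩
  exact Algebra.IsIntegral.comap_surjective _ _

end Ramified

/-! ### The covering -/

instance perfectRing_pi {I : Type*} (p : ℕ) (k : I → Type*) [∀ i, CommRing (k i)]
    [∀ i, PerfectRing (k i) p] : PerfectRing (∀ i, k i) p where
  bijective_frobenius :=
    Function.Bijective.piMap fun i => PerfectRing.bijective_frobenius (R := k i) (p := p)

/-- The product over `I × W` of a family indexed by `I`, on which `W` acts by permutation of
the factors. Here `J` is a copy of `W`. -/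
abbrev permutationAction {I J W : Type*} [Group W] (σ : W ≃ J) (k : I → Type*)
    [∀ i, CommRing (k i)] : MulSemiringAction W (∀ i : I × J, k i.1) where
  smul g s := fun i => s (i.1, σ (σ.symm i.2 * g))
  one_smul s := funext fun i => by
    change s (i.1, σ (σ.symm i.2 * 1)) = s i
    rw [mul_one, σ.apply_symm_apply]
  mul_smul g h s := funext fun i => by
    change s (i.1, σ (σ.symm i.2 * (g * h))) = s (i.1, σ (σ.symm (σ (σ.symm i.2 * g)) * h))
    rw [σ.symm_apply_apply, mul_assoc]
  smul_zero _ := rfl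
  smul_add _ _ _ := rfl
  smul_one _ := rfl
  smul_mul _ _ _ := rfl

namespace Ramified

variable {p : ℕ} [Fact p.Prime] {κ : Type u} [Field κ] [CharP κ p] [PerfectRing κ p]
  {O : Type v} [CommRing O] [Algebra (WittVector p κ) O] (E : Ramified (κ := κ) p O)

variable {T C W : Type*} [CommRing T] [CommRing C] [Algebra C T] [Group W] [Finite W]
  [MulSemiringAction W T] [Algebra.IsInvariant C T W] [SMulCommClass W C T] [FaithfulSMul C T]
  {d : C} {n : ℕ}

lemma subsingleton_oWittExt {a : ℕ} (ha : a ≠ 0) (R : PerfAlg p κ) [Subsingleton R] :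
    Subsingleton (OWittExt p E.series.unif a R) :=
  ⟨fun _ _ => (E.oWittExt ha R).coef_injective fun _ => Subsingleton.elim _ _⟩

/-- The ramified points over an arc in a stratum exist étale-locally. -/
theorem exists_etale_cover (hW : (Nat.card W : κ) ≠ 0)
    (hd : ∀ g : W, g ≠ 1 → algebraMap C T d ∈ fixedIdeal T g) (R : PerfAlg p κ)
    (y : C →+* OWitt p O R) (hy : Associated (algebraMap O _ (E.series.unif ^ n)) (y d)) :
    ∃ (B : PerfAlg p κ) (ψ : R ⟶ B), (PerfAlg.toAlgHom ψ).toRingHom.Etale ∧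
      Function.Surjective (PrimeSpectrum.comap (PerfAlg.toAlgHom ψ).toRingHom) ∧
      ∃ x' : T →+* OWittExt p E.series.unif (Nat.card W) B, ∀ c, x' (algebraMap C T c) =
        oWittIncl p E.series.unif (Nat.card W) _ (oWittMap p O ψ (y c)) := by
  have ha : Nat.card W ≠ 0 := Nat.card_pos.ne'
  cases subsingleton_or_nontrivial R with
  | inl h =>
    have := E.subsingleton_oWittExt ha R
    refine ⟨R, 𝟙 R, RingHom.Etale.containsIdentities R, fun q => ⟨q, rfl⟩,
      { toFun := 0, map_one' := Subsingleton.elim _ _, map_mul' := fun _ _ => Subsingleton.elim _ _,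
        map_zero' := rfl, map_add' := fun _ _ => Subsingleton.elim _ _ },
      fun c => Subsingleton.elim _ _⟩
  | inr h =>
    choose k hk hkc hκk hkp ψ hψ using
      fun q : PrimeSpectrum R => exists_geometric_point p R q.asIdeal
    choose xk hxk using fun q => E.exists_point_of_isAlgClosed hW hd
      ((oWittMap p O (ψ q)).toRingHom.comp y) (E.map_associated (ψ q) hy)
    -- A copy of `W` in the universe of `κ`, so that the product `S` is again a perfect algebra
    -- there.
    let σ : W ≃ Shrink.{u} W := equivShrink.{u} W
    let S : PerfAlg p κ := PerfAlg.of p (∀ i : PrimeSpectrum R × Shrink.{u} W, k i.1)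
    let φ : R ⟶ S := PerfAlg.homMk (AlgHom.pi fun i => PerfAlg.toAlgHom (ψ i.1))
    let pr : ∀ i : PrimeSpectrum R × Shrink.{u} W, S ⟶ PerfAlg.of p (k i.1) := fun i =>
      PerfAlg.homMk (Pi.evalAlgHom κ _ i)
    have hφpr : ∀ i, φ ≫ pr i = ψ i.1 := fun i => rfl
    have hφ : Function.Injective (PerfAlg.toAlgHom φ) := by
      have := isReduced_of_perfectRing p (A := R)
      rw [injective_iff_map_eq_zero]
      intro r hr
      refine (isNilpotent_iff_eq_zero (x := r)).mp ?_
      rw [nilpotent_iff_mem_prime]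
      intro q hq
      have h1 := congrFun hr (⟨q, hq⟩, σ 1)
      exact (hψ ⟨q, hq⟩).le h1
    let _ : MulSemiringAction W S := permutationAction σ k
    let Φ : OWittExt p E.series.unif (Nat.card W) S →+*
        ∀ i : PrimeSpectrum R × Shrink.{u} W,
          OWittExt p E.series.unif (Nat.card W) (PerfAlg.of p (k i.1)) :=
      RingHom.pi fun i => (oWittExtMap p E.series.unif (Nat.card W) (pr i)).toRingHom
    have hcoef : ∀ z i j, (E.oWittExt ha _).coef (Φ z i) j = (E.oWittExt ha S).coef z j i :=
      fun z i j => (E.isMap_oWittExt ha (pr i)).coef_map z j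
    have hΦ : Function.Injective Φ := fun z z' h => (E.oWittExt ha S).coef_injective fun j =>
      funext fun i => by rw [← hcoef, ← hcoef, h]
    obtain ⟨x, hx⟩ := exists_lift_of_injective Φ hΦ
      -- The component at `(q, w)` is the chosen lift at `q` composed with `w`, so that permuting
      -- the factors matches the action on `T`. The components glue because coefficients over a
      -- product can be prescribed factor by factor.
      (RingHom.pi fun i => (xk i.1).comp (MulSemiringAction.toRingHom W T (σ.symm i.2)))
      (fun f => by
        obtain ⟨z, hz⟩ := (E.oWittExt ha S).exists_coef_eq
          fun j i => (E.oWittExt ha _).coef (xk i.1 (σ.symm i.2 • f)) j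
        refine ⟨z, funext fun i => (E.oWittExt ha _).coef_injective fun j => ?_⟩
        rw [hcoef, hz]
        rfl)
    have hxi : ∀ f i, Φ (x f) i = xk i.1 (σ.symm i.2 • f) := fun f i =>
      congrFun (RingHom.congr_fun hx f) i
    refine E.exists_etale_cover_of_equivariant hW hd φ hφ (fun g r => rfl) y hy x
      (fun c => hΦ (funext fun i => ?_)) (fun g f j => funext fun i => ?_)
    · rw [hxi, smul_algebraMap, hxk]
      refine Eq.trans ?_ (E.oWittExtMap_incl_apply (pr i) _).symm
      rw [← oWittMap_comp_apply, hφpr]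
      rfl
    · change (E.oWittExt ha S).coef (x f) j (i.1, σ (σ.symm i.2 * g)) = _
      rw [← hcoef, ← hcoef, hxi, hxi, σ.symm_apply_apply, mul_smul]

end Ramified

/-! ### Simple transitivity -/

lemma eq_zero_of_forall_mem_prime (p : ℕ) [Fact p.Prime] {R : Type*} [CommRing R] [PerfectRing R p]
    {r : R} (h : ∀ q : PrimeSpectrum R, r ∈ q.asIdeal) : r = 0 := by
  have := isReduced_of_perfectRing p (A := R)
  refine (isNilpotent_iff_eq_zero (x := r)).mp ?_
  rw [nilpotent_iff_mem_prime]
  exact fun q hq => h ⟨q, hq⟩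

namespace Ramified

variable {p : ℕ} [Fact p.Prime] {κ : Type u} [Field κ] [CharP κ p] [PerfectRing κ p]
  {O : Type v} [CommRing O] [Algebra (WittVector p κ) O] (E : Ramified (κ := κ) p O)

variable {T C W : Type*} [CommRing T] [CommRing C] [Algebra C T] [Group W] [Finite W]
  [MulSemiringAction W T] [Algebra.IsInvariant C T W] [SMulCommClass W C T] [FaithfulSMul C T]
  {d : C} {n : ℕ}

/-- The ramified points over an arc in a stratum are permuted simply transitively. -/
theorem existsUnique_locallyConstant
    (hd : ∀ g : W, g ≠ 1 → algebraMap C T d ∈ fixedIdeal T g) (R : PerfAlg p κ)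
    (y : C →+* OWitt p O R) (hy : Associated (algebraMap O _ (E.series.unif ^ n)) (y d))
    (x x' : T →+* OWittExt p E.series.unif (Nat.card W) R)
    (hx : ∀ c, x (algebraMap C T c) = oWittIncl p E.series.unif (Nat.card W) _ (y c))
    (hx' : ∀ c, x' (algebraMap C T c) = oWittIncl p E.series.unif (Nat.card W) _ (y c)) :
    ∃! g : LocallyConstant (PrimeSpectrum R) W, ∀ (S : PerfAlg p κ) (φ : R ⟶ S) (a : W),
      (∀ q : PrimeSpectrum S, g (PrimeSpectrum.comap (PerfAlg.toAlgHom φ).toRingHom q) = a) →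
        ∀ f, oWittExtMap p E.series.unif (Nat.card W) φ (x' f) =
          oWittExtMap p E.series.unif (Nat.card W) φ (x (a⁻¹ • f)) := by
  have ha : Nat.card W ≠ 0 := Nat.card_pos.ne'
  let D := E.oWittExt ha R
  -- The locus where `x'` is the translate of `x` by `a`. It is closed, being cut out by differences
  -- of coefficients.
  let Z : W → Set (PrimeSpectrum R) := fun a =>
    {q | ∀ f j, D.coef (x' f) j - D.coef (x (a⁻¹ • f)) j ∈ q.asIdeal}
  have hZclosed : ∀ a, IsClosed (Z a) := by
    intro a
    have : Z a = PrimeSpectrum.zeroLocus (Set.range fun fj : T × ℕ =>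
        D.coef (x' fj.1) fj.2 - D.coef (x (a⁻¹ • fj.1)) fj.2) := by
      ext q
      rw [PrimeSpectrum.mem_zeroLocus, Set.range_subset_iff]
      exact ⟨fun h fj => h fj.1 fj.2, fun h f j => h (f, j)⟩
    rw [this]
    exact PrimeSpectrum.isClosed_zeroLocus _
  have hmem : ∀ {S : PerfAlg p κ} (φ : R ⟶ S) (a : W) (q : PrimeSpectrum R),
      RingHom.ker (PerfAlg.toAlgHom φ).toRingHom = q.asIdeal →
      (q ∈ Z a ↔ ∀ f, oWittExtMap p E.series.unif (Nat.card W) φ (x' f) =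
        oWittExtMap p E.series.unif (Nat.card W) φ (x (a⁻¹ • f))) := by
    intro S φ a q hq
    have h1 : ∀ f j, D.coef (x' f) j - D.coef (x (a⁻¹ • f)) j ∈ q.asIdeal ↔
        (E.oWittExt ha S).coef (oWittExtMap p E.series.unif (Nat.card W) φ (x' f)) j =
        (E.oWittExt ha S).coef (oWittExtMap p E.series.unif (Nat.card W) φ (x (a⁻¹ • f))) j := by
      intro f j
      rw [← hq, RingHom.mem_ker, map_sub, sub_eq_zero]
      exact iff_of_eq (congrArg₂ _ ((E.isMap_oWittExt ha φ).coef_map _ j).symm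
        ((E.isMap_oWittExt ha φ).coef_map _ j).symm)
    exact ⟨fun h f => (E.oWittExt ha S).coef_injective fun j => (h1 f j).mp (h f j),
      fun h f j => (h1 f j).mpr (by rw [h])⟩
  have hcover : ∀ q, ∃ a, q ∈ Z a := by
    intro q
    obtain ⟨k, _, _, _, _, ψ, hψ⟩ := exists_geometric_point p R q.asIdeal
    obtain ⟨b, hb⟩ := E.exists_smul_eq (C := C) (W := W)
      ((oWittExtMap p E.series.unif _ ψ).toRingHom.comp x)
      ((oWittExtMap p E.series.unif _ ψ).toRingHom.comp x')
      (fun c => congrArg (oWittExtMap p E.series.unif _ ψ) ((hx' c).trans (hx c).symm))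
    exact ⟨b⁻¹, (hmem ψ b⁻¹ q hψ).mpr (by rw [inv_inv]; exact hb)⟩
  have hdisj : ∀ q a b, q ∈ Z a → q ∈ Z b → a = b := by
    intro q a b hqa hqb
    obtain ⟨k, _, _, _, _, ψ, hψ⟩ := exists_geometric_point p R q.asIdeal
    rw [hmem ψ _ q hψ] at hqa hqb
    refine inv_mul_eq_one.mp (E.eq_one_of_smul_eq hd (E.map_associated ψ hy)
      ((oWittExtMap p E.series.unif _ ψ).toRingHom.comp x) ?_ fun f => ?_)
    · refine (congrArg (oWittExtMap p E.series.unif _ ψ) (hx d)).trans ?_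
      exact E.oWittExtMap_incl_apply ψ _
    · have h1 := (hqa (b • f)).symm.trans (hqb (b • f))
      rwa [smul_smul, smul_smul, inv_mul_cancel, one_smul] at h1
  choose g hg using hcover
  have hgiff : ∀ q a, g q = a ↔ q ∈ Z a := fun q a =>
    ⟨fun h => h ▸ hg q, fun h => hdisj q _ _ (hg q) h⟩
  -- The sets `Z a` are finitely many, closed, disjoint and cover `Spec R`, so each is also open.
  have hloc : IsLocallyConstant g := by
    intro s
    have : g ⁻¹' s = (⋃ a ∈ sᶜ, Z a)ᶜ := by
      ext q
      simp only [Set.mem_preimage, Set.mem_compl_iff, Set.mem_iUnion, ← hgiff]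
      simp
    rw [this, isOpen_compl_iff]
    exact (Set.toFinite _).isClosed_biUnion fun a _ => hZclosed a
  refine ⟨⟨g, hloc⟩, fun S φ a h f => (E.oWittExt ha S).coef_injective fun j => ?_,
    -- Uniqueness is tested at geometric points: the spectrum of a field is one point, so every
    -- candidate becomes constant there.
    fun g' hg' => ?_⟩
  · refine ((E.isMap_oWittExt ha φ).coef_map _ j).trans
      (Eq.trans ?_ ((E.isMap_oWittExt ha φ).coef_map _ j).symm)
    rw [← sub_eq_zero, ← map_sub]
    exact eq_zero_of_forall_mem_prime p fun q => (hgiff _ _).mp (h q) f j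
  · ext q
    obtain ⟨k, _, _, _, _, ψ, hψ⟩ := exists_geometric_point p R q.asIdeal
    refine ((hgiff q _).mpr ((hmem ψ _ q hψ).mpr (hg' _ ψ _ fun q' => congrArg g' ?_))).symm
    refine PrimeSpectrum.ext ?_
    have hq' : q'.asIdeal = ⊥ := (Ideal.eq_bot_or_top (K := k) q'.asIdeal).resolve_right q'.2.ne_top
    change q'.asIdeal.comap _ = _
    rw [hq', ← hψ]
    rfl

end Ramified

/-! ### The torsor -/

section Main

variable {p : ℕ} [Fact p.Prime] {κ : Type u} [Field κ] [CharP κ p] [PerfectRing κ p]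
  {O : Type v} [CommRing O] [Algebra (WittVector p κ) O] (E : Ramified (κ := κ) p O)
  {ι : Type*} [Fintype ι] {M : Type w} {N : Type*} [AddCommGroup M] [AddCommGroup N]
  [Module.Finite ℤ M] (P : RootDatum ι M N) [P.IsReduced]

/-- As `p` does not divide `|W|`, this order is nonzero in `κ` and, by lifting units along the
residue map, invertible in `O`. The first fact gives tameness, the second places the discriminant in
the fixed ideals. -/
theorem isTorsor_of_ramified (hp : ¬ p ∣ Nat.card P.weylGroup) (n : ℕ) :
    IsTorsor (κ := κ) (weylAction p P E.series.unif n) (chevalleyMap p P E.series.unif n) := by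
  have hW : (Nat.card P.weylGroup : κ) ≠ 0 := fun h => hp ((CharP.cast_eq_zero_iff κ p _).mp h)
  have : Finite P.weylGroup := Nat.finite_of_card_ne_zero fun h => hp (h ▸ dvd_zero p)
  have hWO : IsUnit (Nat.card P.weylGroup : O) := by
    refine E.series.isUnit_of_isUnit_res ?_
    rw [map_natCast]
    exact hW.isUnit
  have hd := discriminant_mem_fixedIdeal P O hWO
  refine ⟨fun a => rfl, fun R y => ?_, fun R x x' hxx' => ?_⟩
  · obtain ⟨S, φ, hφ, hφs, x, hx⟩ := E.exists_etale_cover hW hd R y.1.toRingHom y.2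
    refine ⟨S, φ, hφ, hφs, ⟨({ x with commutes' := fun o => ?_ },
      (stratumC p P E.series.unif n).map φ y), ?_⟩, rfl⟩
    · refine (hx (algebraMap O (CoordC P O) o)).trans ?_
      change oWittIncl p E.series.unif _ _ (oWittMap p O φ (y.1 _)) = _
      rw [AlgHom.commutes, AlgHom.commutes, AlgHom.commutes]
    · exact AlgHom.ext hx
  · have hx2 : x'.1.2 = x.1.2 := hxx'
    have hx : ∀ c, x.1.1 (algebraMap (CoordC P O) (CoordT O P) c) =
        oWittIncl p E.series.unif (Nat.card P.weylGroup) R (x.1.2.1 c) :=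
      fun c => DFunLike.congr_fun x.2 c
    have hx' : ∀ c, x'.1.1 (algebraMap (CoordC P O) (CoordT O P) c) =
        oWittIncl p E.series.unif (Nat.card P.weylGroup) R (x.1.2.1 c) := fun c => by
      rw [← hx2]
      exact DFunLike.congr_fun x'.2 c
    have key := E.existsUnique_locallyConstant hd R x.1.2.1.toRingHom x.1.2.2
      x.1.1.toRingHom x'.1.1.toRingHom hx hx'
    have hiff : ∀ (S : PerfAlg p κ) (φ : R ⟶ S) (a : P.weylGroup),
        (stratumT p P E.series.unif n).map φ x' =
          ((weylAction p P E.series.unif n) a).app S ((stratumT p P E.series.unif n).map φ x) ↔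
        ∀ f, oWittExtMap p E.series.unif (Nat.card P.weylGroup) φ (x'.1.1 f) =
          oWittExtMap p E.series.unif (Nat.card P.weylGroup) φ (x.1.1 (a⁻¹ • f)) := by
      intro S φ a
      constructor
      · intro h f
        exact DFunLike.congr_fun (congrArg (fun z => z.1.1) h) f
      · intro h
        refine Subtype.ext (Prod.ext (AlgHom.ext h) ?_)
        exact congrArg ((stratumC p P E.series.unif n).map φ) hx2
    simp only [hiff]
    exact key

end Main

end WittArc

end

theorem mainTheorem7 {p : ℕ} [Fact p.Prime] {κ : Type u} [Field κ] [IsAlgClosed κ] [CharP κ p]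
    {K : Type*} [Field K] [Algebra (WittVector p κ) K] [Algebra (FractionRing (WittVector p κ)) K]
    [IsScalarTower (WittVector p κ) (FractionRing (WittVector p κ)) K]
    [FiniteDimensional (FractionRing (WittVector p κ)) K]
    {O : Type v} [CommRing O] [Algebra (WittVector p κ) O] [Algebra O K]
    [IsScalarTower (WittVector p κ) O K] [IsIntegralClosure O (WittVector p κ) K]
    (ϖ : O) (hϖ : Irreducible ϖ)
    {ι : Type*} [Fintype ι] {M : Type w} {N : Type*} [AddCommGroup M] [AddCommGroup N]
    [Module.Finite ℤ M] [Module.Finite ℤ N] (P : RootDatum ι M N) [P.IsReduced]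
    (hp : ¬ p ∣ Nat.card P.weylGroup) (n : ℕ) :
    WittArc.IsTorsor (κ := κ) (WittArc.weylAction p P ϖ n) (WittArc.chevalleyMap p P ϖ n) := by
  obtain ⟨E, rfl⟩ := WittArc.exists_ramified (p := p) (κ := κ) (K := K) ϖ hϖ
  exact WittArc.isTorsor_of_ramified E P hp n
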